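/- Let $N=2^n$ with $n\ge 1$ and index the coordinates of $\mathbb{C}^N$ by $y\in\mathbb{Z}_2^n$. For a symmetric $n\times n$ matrix $P$ over $\mathbb{Z}_2$ and $\ell\in\mathbb{Z}_2^n$ let $\varphi_{P,\ell}\in\mathbb{C}^N$ be the unit vector $$\varphi_{P,\ell}(y)=\frac{1}{\sqrt N}\,i^{\,y^TPy+2\ell^Ty},$$ where the exponent is computed over $\mathbb{Z}$ with $\{0,1\}$-valued entries. A matrix is Hankel if it is constant along reverse diagonals. A Kerdock set is a set $\mathcal K$ of symmetric $n\times n$ matrices over $\mathbb{Z}_2$ with $0\in\mathcal K$ such that $P+P'$ has rank $n$ for all distinct $P,P'\in\mathcal K$; its Kerdock code is $\{\varphi_{P,\ell}:P\in\mathcal K,\ \ell\in\mathbb{Z}_2^n\}$, and it is a subcode of the Hankel code if all $P\in\mathcal K$ are Hankel. In particular, for a primitive polynomial $h(t)=h_0+h_1t+\dots+h_{n-1}t^{n-1}+t^n$ over $\mathbb{Z}_2$ and $a=(a_0,\dots,a_{n-1})\in\mathbb{Z}_2^n$ let $K_h(a)$ be the Hankel matrix $(a_{i+j})_{0\le i,j<n}$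 with $a_j=\sum_{0\le m<n}a_{j-n+m}h_m$ for $j\ge n$; the linear-feedback Kerdock code of $h$ is $\{\varphi_{K_h(a),\ell}: a,\ell\in\mathbb{Z}_2^n\}$. Algorithms are randomized (fair coin flips), may query any coordinate of the signal $s\in\mathbb{C}^N$, and may operate on lists and, exactly and at unit cost, on complex numbers (arithmetic operations, complex conjugation, comparison of real parts; the constants are $0,1,i$). The input is $n$ (in unary), a real number $k\ge 1$, and query access to $s$. 1. For every $c\in\mathbb{N}$ there are such an algorithm and a polynomial $p$ with the following property. For all $n\ge1$, all real $k\ge 1$ and all $s\in\mathbb{C}^N$ the algorithm halts within $p(k\log_2 N)$ steps, whatever the coin flips. If $s\ne 0$, then for every Kerdock set $\mathcal K$ of $n\times n$ Hankel matrices, with probability at least $1-N^{-c}$ the output is a list of pairs $(P,\ell)$, with $P$ Hankel, that contains every $(P,\ell)$ with $P\in\mathcal K$, $\ell\in\mathbb{Z}_2^n$ and $$|\langle s,\varphi_{P,\ell}\rangle|^2\ \ge\ \frac1k\,\|s\|^2 .$$ 2. For every $c\in\mathbb{N}$ there are such an algorithm and a polynomial $p$ with the same bound on the number of steps such that, if $s\neq0$,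 then for every primitive polynomial $h$ of degree $n$ over $\mathbb{Z}_2$, with probability at least $1-N^{-c}$ the output is a list of pairs $(a,\ell)\in\mathbb{Z}_2^n\times\mathbb{Z}_2^n$ that contains every $(a,\ell)$ with $|\langle s,\varphi_{K_h(a),\ell}\rangle|^2\ge\frac1k\|s\|^2$; so every entry of the list labels a codeword of the linear-feedback Kerdock code of $h$. -/

import Mathlib

namespace Kerdock

noncomputable section

/-! ### Codes -/

/-- Binary vectors of length `n`; they index the `N = 2 ^ n` positions of a signal. -/
abbrev BinVec (n : ℕ) := Fin n → ZMod 2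

/-- Signals in `ℂ ^ N`, `N = 2 ^ n`, with the Euclidean norm. -/
abbrev Signal (n : ℕ) := EuclideanSpace ℂ (BinVec n)

/-- Binary `n × n` matrices. -/
abbrev BinMat (n : ℕ) := Matrix (Fin n) (Fin n) (ZMod 2)

/-- The exponent `yᵀ P y + 2 ℓᵀ y`, computed over the integers from the `{0,1}`-valued
representatives of all entries. -/
def phase {n : ℕ} (P : BinMat n) (l y : BinVec n) : ℕ :=
  (∑ i, ∑ j, (y i).val * (P i j).val * (y j).val) + 2 * ∑ i, (l i).val * (y i).val

/-- The exponentiated second-order Reed-Muller codeword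
`φ_{P,ℓ}(y) = i ^ (yᵀ P y + 2 ℓᵀ y) / √N`. -/
def codeword {n : ℕ} (P : BinMat n) (l : BinVec n) : Signal n :=
  WithLp.toLp 2 fun y => Complex.I ^ phase P l y / (Real.sqrt (2 ^ n) : ℂ)

/-- A Hankel matrix is constant along reverse diagonals. -/
def IsHankel {n : ℕ} (P : BinMat n) : Prop :=
  ∀ i j i' j' : Fin n, (i : ℕ) + j = i' + j' → P i j = P i' j'

/-- A Kerdock set: symmetric binary matrices, including zero, such that the sum of any two distinct
members has full rank. -/
structure IsKerdockSet {n : ℕ} (K : Set (BinMat n)) : Prop where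
  symm : ∀ P ∈ K, P.IsSymm
  zero_mem : (0 : BinMat n) ∈ K
  rank_add : ∀ P ∈ K, ∀ P' ∈ K, P ≠ P' → (P + P').rank = n

/-- `h` is a primitive polynomial of degree `n` over `ℤ/2`: it is irreducible and the least
positive `m` such that `h` divides `t ^ m - 1` is `2 ^ n - 1`. -/
structure IsPrimitivePoly (n : ℕ) (h : Polynomial (ZMod 2)) : Prop where
  monic : h.Monic
  natDegree_eq : h.natDegree = n
  irreducible : Irreducible h
  dvd : h ∣ Polynomial.X ^ (2 ^ n - 1) - 1
  not_dvd : ∀ m : ℕ, 0 < m → m < 2 ^ n - 1 → ¬ h ∣ Polynomial.X ^ m - 1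

/-- The linear feedback rule `a_j = ∑_{m < n} a_{j - n + m} h_m` for `j ≥ n`. -/
def feedback (n : ℕ) (h : Polynomial (ZMod 2)) : LinearRecurrence (ZMod 2) where
  order := n
  coeffs := fun m => h.coeff m

/-- The linear-feedback Kerdock matrix of `h` with top row `a`: the Hankel matrix whose reverse
diagonals continue `a` by the feedback rule. -/
def lfKerdock {n : ℕ} (h : Polynomial (ZMod 2)) (a : BinVec n) : BinMat n :=
  Matrix.of fun i j => (feedback n h).mkSol a ((i : ℕ) + j)

/-- `φ` is heavy for `s`: `|⟨s, φ⟩|² ≥ (1 / k) ‖s‖²`. -/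
def Heavy {n : ℕ} (k : ℝ) (s φ : Signal n) : Prop :=
  (1 / k) * ‖s‖ ^ 2 ≤ ‖inner ℂ s φ‖ ^ 2

/-! ### Randomized algorithms with query access to a signal

A program is a `while` program over finitely many variables. Its values are binary trees whose
leaves are `nil` or complex numbers, so it is a list-processing machine that can also calculate
exactly with complex numbers (as in the real-RAM model). The only numeric constants are `0`, `1`
and `i`. -/

inductive Val : Type
  | nil : Val
  | num (z : ℂ) : Val
  | cons (a b : Val) : Val

namespace Val

def hd : Val → Val
  | cons a _ => a
  | _ => nil

def tl : Val → Val
  | cons _ b => b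
  | _ => nil

/-- The number at a leaf (`0` for other values). -/
def toNum : Val → ℂ
  | num z => z
  | _ => 0

/-- Everything but `nil` counts as true. -/
def truthy : Val → Bool
  | nil => false
  | _ => true

def ofBool : Bool → Val
  | false => nil
  | true => cons nil nil

/-- The list `[v₁, …, v_m]` that is represented by `cons v₁ (… (cons v_m nil))`. -/
def toList : Val → List Val
  | cons a b => a :: b.toList
  | _ => []

/-- Entry `i` of a list of bits as an element of `ℤ/2`; missing entries are `0`. -/
def bitAt (v : Val) (i : ℕ) : ZMod 2 :=
  if (v.toList.getD i nil).truthy then 1 else 0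

/-- The binary vector of length `n` represented by a list of bits. -/
def toVec (n : ℕ) (v : Val) : BinVec n := fun i => v.bitAt i

/-- The `n × n` Hankel matrix given by the list of the bits on its reverse diagonals. -/
def toHankel (n : ℕ) (v : Val) : BinMat n := Matrix.of fun i j => v.bitAt ((i : ℕ) + j)

/-- The natural number `n` in unary: a list of length `n`. -/
def unary : ℕ → Val
  | 0 => nil
  | n + 1 => cons nil (unary n)

end Val

/-- Expressions; variables are numbered. -/
inductive Expr : Type
  | var (x : ℕ) : Expr
  | nil : Expr
  | cons (a b : Expr) : Expr
  | hd (a : Expr) : Expr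
  | tl (a : Expr) : Expr
  | zero : Expr
  | one : Expr
  | imag : Expr
  | add (a b : Expr) : Expr
  | sub (a b : Expr) : Expr
  | mul (a b : Expr) : Expr
  | div (a b : Expr) : Expr
  | conj (a : Expr) : Expr
  | le (a b : Expr) : Expr

/-- An assignment of values to the variables. -/
abbrev Store := ℕ → Val

/-- The value of an expression. The comparison `le` compares real parts. -/
def Expr.eval (σ : Store) : Expr → Val
  | .var x => σ x
  | .nil => Val.nil
  | .cons a b => Val.cons (a.eval σ) (b.eval σ)
  | .hd a => (a.eval σ).hd
  | .tl a => (a.eval σ).tl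
  | .zero => Val.num 0
  | .one => Val.num 1
  | .imag => Val.num Complex.I
  | .add a b => Val.num ((a.eval σ).toNum + (b.eval σ).toNum)
  | .sub a b => Val.num ((a.eval σ).toNum - (b.eval σ).toNum)
  | .mul a b => Val.num ((a.eval σ).toNum * (b.eval σ).toNum)
  | .div a b => Val.num ((a.eval σ).toNum / (b.eval σ).toNum)
  | .conj a => Val.num (star (a.eval σ).toNum)
  | .le a b => by
      classical exact Val.ofBool (decide ((a.eval σ).toNum.re ≤ (b.eval σ).toNum.re))

/-- Programs. -/
inductive Prog : Type
  /-- `x := e` -/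
  | assign (x : ℕ) (e : Expr) : Prog
  /-- `x := s(e)`: query the signal at the position given by the value of `e` -/
  | query (x : ℕ) (e : Expr) : Prog
  /-- `x :=` a fair random bit -/
  | flip (x : ℕ) : Prog
  | seq (A B : Prog) : Prog
  | ite (e : Expr) (A B : Prog) : Prog
  | while (e : Expr) (A : Prog) : Prog

/-- A configuration: the programs that remain to be executed, in this order, and the store. -/
structure Config where
  todo : List Prog
  store : Store

/-- One step of the computation with query access to `s`. A step carries out one command, test or
unfolding of a sequence, hence a number of elementary operations (pairing, projections, copying,
arithmetic operations, comparisons, one query, one random bit) that is bounded by the size of the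
program. A configuration with nothing left to do stays as it is. -/
def step {n : ℕ} (s : Signal n) : Config → PMF Config
  | ⟨[], σ⟩ => PMF.pure ⟨[], σ⟩
  | ⟨.assign x e :: R, σ⟩ => PMF.pure ⟨R, Function.update σ x (e.eval σ)⟩
  | ⟨.query x e :: R, σ⟩ =>
      PMF.pure ⟨R, Function.update σ x (Val.num (s ((e.eval σ).toVec n)))⟩
  | ⟨.flip x :: R, σ⟩ =>
      (PMF.uniformOfFintype Bool).map fun b => ⟨R, Function.update σ x (Val.ofBool b)⟩
  | ⟨.seq A B :: R, σ⟩ => PMF.pure ⟨A :: B :: R, σ⟩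
  | ⟨.ite e A B :: R, σ⟩ =>
      PMF.pure (if (e.eval σ).truthy then ⟨A :: R, σ⟩ else ⟨B :: R, σ⟩)
  | ⟨.while e A :: R, σ⟩ =>
      PMF.pure (if (e.eval σ).truthy then ⟨A :: .while e A :: R, σ⟩ else ⟨R, σ⟩)

/-- The distribution of the configuration after `t` steps. -/
def run {n : ℕ} (s : Signal n) : ℕ → Config → PMF Config
  | 0, C => PMF.pure C
  | t + 1, C => (step s C).bind (run s t)

/-- The start of program `A` on the input `(n, k)`: variable `0` holds `n = log N` in unary,
variable `1` holds the number `k`, and all other variables hold `nil`. -/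
def start (A : Prog) (n : ℕ) (k : ℝ) : Config where
  todo := [A]
  store := fun x => if x = 0 then Val.unary n else if x = 1 then Val.num (k : ℂ) else Val.nil

/-- On the input `(n, k)` with query access to `s`, program `A` halts within `T` steps,
whatever the random bits are. -/
def HaltsWithin {n : ℕ} (A : Prog) (k : ℝ) (s : Signal n) (T : ℕ) : Prop :=
  ∀ C ∈ (run s T (start A n k)).support, C.todo = []

/-- The distribution of the output, that is, of the value of variable `0` after `T` steps. -/
def output {n : ℕ} (A : Prog) (k : ℝ) (s : Signal n) (T : ℕ) : PMF Val :=
  (run s T (start A n k)).map fun C => C.store 0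

/-- The list of labels `(P, ℓ)` of Hankel codewords represented by an output: each entry is a pair
of the list of the reverse diagonals of `P` and the list of the bits of `ℓ`. -/
def hankelLabels (n : ℕ) (v : Val) : List (BinMat n × BinVec n) :=
  v.toList.map fun w => (w.hd.toHankel n, w.tl.toVec n)

/-- The list of labels `(a, ℓ)` represented by an output, each entry being a pair of two lists
of bits. -/
def rowLabels (n : ℕ) (v : Val) : List (BinVec n × BinVec n) :=
  v.toList.map fun w => (w.hd.toVec n, w.tl.toVec n)

end

end Kerdock

/-!
One algorithm serves both parts: with high probability it lists the labels of all heavy Hankel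
codewords, among them those of every Kerdock code inside the Hankel code.

The algorithm is a long sequence of independent rounds (`candidate`), each of which proposes one
label. A round finds any given heavy codeword `φ = φ_{P,ℓ}` with a probability that is at least
inversely polynomial in `k n` (`round_success`). As there are at most `2 ^ (n ^ 2 + n)` labels, a
union bound over polynomially many rounds gives the claim (`decoder_correct`). A round works as
follows.

* Truncation. With `κ = ⌊k⌋ + 1`, entries of `s` larger than `8 κ |s(y₀)|` are replaced by zero,
  where `y₀` is a random position. With probability at least `1 / (8 κ)` the value `|s(y₀)|` is of
  the order of the quadratic mean of `s` (`card_typical`), and then the truncated signal `F` is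
  bounded by a number `b` such that `|∑ F φ̄| ≥ ε b N` for some `ε` of the order `κ⁻²`
  (`correlation_cut`).
* Decoding of linear functions (`linDec`). If `|∑ (-1) ^ (a · y) H(y)|` is large for a bounded
  `H`, then `a` is found from the signed sums of `H` over translates of a random affine subspace
  with `2 ^ D` points, provided that the values of `a` at the `D` spanning vectors are guessed
  correctly. The sample points are pairwise independent, so Chebyshev's inequality applies
  (`second_moment`, `avg_badness_le`, `linDec_eq`); `D` is logarithmic, so guesses are right with
  inversely polynomial probability.
* Derivatives. By the Cauchy-Schwarz inequality over the span of the first `D` unit vectors there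
  is a nonzero `e` in this span such that `F(y) F̄(y + e)` correlates with its counterpart for
  `φ`, which is up to a constant the linear phase `(-1) ^ (P e · y)` (`exists_derivative`,
  `I_pow_phase_add`). So `e` is guessed and `P e` is decoded.
* Hankel structure. Let `p` be the sequence of reverse diagonals of `P`. Then
  `(P e)_i = ∑ p_{i+j} e_j` is a linear recurrence of logarithmic order for `p`, and
  `p_0, …, p_{n-1}` follow from `P e` and a guess of the initial terms (`exists_solve_eq`,
  `exists_recover_eq`). The other half of the reverse diagonals is obtained in the same way in
  reversed coordinates.
* Finally `ℓ` is decoded as the linear function that correlates with `F` times the conjugate of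
  the phase of `P` (`exists_candidate_eq`).

To turn this into a program, the rounds are written in a small functional language with lists and
folds, which is compiled to `while` programs with an exact count of steps (`exec_compile`). All
random bits are tossed in advance, so the remaining computation is deterministic (`run_decoder`).
-/

namespace Kerdock
noncomputable section

/-! ### Execution of programs -/

theorem run_add {n : ℕ} (s : Signal n) (t u : ℕ) (C : Config) :
    run s (t + u) C = (run s t C).bind (run s u) := by
  induction t generalizing C with
  | zero => simp [run]
  | succ t ih =>
    have : t + 1 + u = (t + u) + 1 := by omega
    rw [this]
    simp only [run, PMF.bind_bind]
    congr 1
    funext C'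
    exact ih C'

theorem run_nil {n : ℕ} (s : Signal n) (t : ℕ) (σ : Store) :
    run s t ⟨[], σ⟩ = PMF.pure ⟨[], σ⟩ := by
  induction t with
  | zero => rfl
  | succ t ih => simp [run, step, ih]

/-- From the store `σ` the program `A` ends in the store `σ'` after exactly `t` steps,
without any influence of random bits. -/
def Exec {n : ℕ} (s : Signal n) (A : Prog) (σ σ' : Store) (t : ℕ) : Prop :=
  ∀ R, run s t ⟨A :: R, σ⟩ = PMF.pure ⟨R, σ'⟩

namespace Exec
variable {n : ℕ} {s : Signal n}

theorem assign (x : ℕ) (e : Expr) (σ : Store) :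
    Exec s (.assign x e) σ (Function.update σ x (e.eval σ)) 1 := by
  intro R
  simp [run, step]

theorem query (x : ℕ) (e : Expr) (σ : Store) :
    Exec s (.query x e) σ (Function.update σ x (Val.num (s ((e.eval σ).toVec n)))) 1 := by
  intro R
  simp [run, step]

theorem seq {A B : Prog} {σ σ₁ σ₂ : Store} {t u : ℕ} (hA : Exec s A σ σ₁ t)
    (hB : Exec s B σ₁ σ₂ u) : Exec s (.seq A B) σ σ₂ (t + u + 1) := by
  intro R
  simp [run, step, run_add, hA (B :: R), hB R]

theorem ite_true {e : Expr} {A B : Prog} {σ σ₁ : Store} {t : ℕ} (he : (e.eval σ).truthy = true)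
    (hA : Exec s A σ σ₁ t) : Exec s (.ite e A B) σ σ₁ (t + 1) := by
  intro R
  simp [run, step, he, hA R]

theorem ite_false {e : Expr} {A B : Prog} {σ σ₁ : Store} {t : ℕ} (he : (e.eval σ).truthy = false)
    (hB : Exec s B σ σ₁ t) : Exec s (.ite e A B) σ σ₁ (t + 1) := by
  intro R
  simp [run, step, he, hB R]

theorem while_false {e : Expr} {A : Prog} {σ : Store} (he : (e.eval σ).truthy = false) :
    Exec s (.while e A) σ σ 1 := by
  intro R
  simp [run, step, he]

theorem while_true {e : Expr} {A : Prog} {σ σ₁ σ₂ : Store} {t u : ℕ}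
    (he : (e.eval σ).truthy = true) (hA : Exec s A σ σ₁ t) (hW : Exec s (.while e A) σ₁ σ₂ u) :
    Exec s (.while e A) σ σ₂ (t + 1 + u) := by
  intro R
  have h₁ : t + 1 + u = (t + u) + 1 := by omega
  have h₂ : step s ⟨.while e A :: R, σ⟩ = PMF.pure ⟨A :: .while e A :: R, σ⟩ := by
    simp [step, he]
  rw [h₁, run, h₂, PMF.pure_bind, run_add, hA, PMF.pure_bind, hW]

end Exec

/-! ### A functional language and its compiler -/

/-- Terms of a first-order functional language. Variables are de Bruijn indices into an
environment, which is a list of values. `bind t u` evaluates `u` with the value of `t` pushed on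
the environment; `fold l i b` folds `b` over the list `l`, starting from `i`, where `b` sees the
current entry, the accumulator and the remaining list as variables `0`, `1`, `2`. -/
inductive Tm : Type
  | ex (e : Expr) : Tm
  | qry (e : Expr) : Tm
  | bind (t u : Tm) : Tm
  | ite (c : Expr) (t u : Tm) : Tm
  | fold (l i : Expr) (b : Tm) : Tm

/-- The value of an expression in an environment. -/
def Ev (Γ : List Val) (e : Expr) : Val := e.eval fun i => Γ.getD i Val.nil

/-- Iteration along a list, as a `while` loop carries it out; `f` gets the remaining list and
the accumulator. -/
def Val.fold (f : Val → Val → Val) : Val → Val → Val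
  | .nil, acc => acc
  | .num z, acc => f (.num z) acc
  | .cons a b, acc => Val.fold f b (f (.cons a b) acc)

/-- The number of steps of the `while` loop that carries out `Val.fold f`, if a pass through the
body takes `c` steps besides the bookkeeping. -/
def Val.foldCost (f : Val → Val → Val) (c : Val → Val → ℕ) : Val → Val → ℕ
  | .nil, _ => 1
  | .num z, acc => c (.num z) acc + 7 + 1
  | .cons a b, acc => c (.cons a b) acc + 7 + Val.foldCost f c b (f (.cons a b) acc)

/-- The value of a term, where `o` answers the queries. -/
def den (o : Val → ℂ) : Tm → List Val → Val
  | .ex e, Γ => Ev Γ e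
  | .qry e, Γ => .num (o (Ev Γ e))
  | .bind t u, Γ => den o u (den o t Γ :: Γ)
  | .ite c t u, Γ => if (Ev Γ c).truthy then den o t Γ else den o u Γ
  | .fold l i b, Γ => Val.fold (fun r acc => den o b (r.hd :: acc :: r :: Γ)) (Ev Γ l) (Ev Γ i)

/-- The number of steps of the compiled term. -/
def cost (o : Val → ℂ) : Tm → List Val → ℕ
  | .ex _, _ => 1
  | .qry _, _ => 1
  | .bind t u, Γ => cost o t Γ + (cost o u (den o t Γ :: Γ) + 1 + 1) + 1
  | .ite c t u, Γ => (if (Ev Γ c).truthy then cost o t Γ else cost o u Γ) + 1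
  | .fold l i b, Γ =>
      1 + (1 + (Val.foldCost (fun r acc => den o b (r.hd :: acc :: r :: Γ))
        (fun r acc => cost o b (r.hd :: acc :: r :: Γ)) (Ev Γ l) (Ev Γ i) + 1 + 1) + 1) + 1

/-- Replaces the de Bruijn indices of an environment of length `b` by store variables. The oldest
entry of the environment is in variable `0`. -/
def Expr.lower (b : ℕ) : Expr → Expr
  | .var i => if i < b then .var (b - 1 - i) else .nil
  | .nil => .nil
  | .cons e f => .cons (e.lower b) (f.lower b)
  | .hd e => .hd (e.lower b)
  | .tl e => .tl (e.lower b)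
  | .zero => .zero
  | .one => .one
  | .imag => .imag
  | .add e f => .add (e.lower b) (f.lower b)
  | .sub e f => .sub (e.lower b) (f.lower b)
  | .mul e f => .mul (e.lower b) (f.lower b)
  | .div e f => .div (e.lower b) (f.lower b)
  | .conj e => .conj (e.lower b)
  | .le e f => .le (e.lower b) (f.lower b)

/-- The program of a term in an environment that occupies the variables below `b`. It puts its
result into variable `b` and changes no variable below `b`. -/
def compile (b : ℕ) : Tm → Prog
  | .ex e => .assign b (e.lower b)
  | .qry e => .query b (e.lower b)
  | .bind t u => .seq (compile b t) (.seq (compile (b + 1) u) (.assign b (.var (b + 1))))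
  | .ite c t u => .ite (c.lower b) (compile b t) (compile b u)
  | .fold l i t =>
      .seq (.assign b (l.lower b)) (.seq (.assign (b + 1) (i.lower b)) (.seq
        (.while (.var b)
          (.seq (.assign (b + 2) (.hd (.var b))) (.seq (compile (b + 3) t)
            (.seq (.assign (b + 1) (.var (b + 3))) (.assign b (.tl (.var b)))))))
        (.assign b (.var (b + 1)))))

/-- The store holds the environment. -/
def Agree (σ : Store) : List Val → Prop
  | [] => True
  | v :: Γ => σ Γ.length = v ∧ Agree σ Γ

theorem Agree.congr {σ τ : Store} {Γ : List Val} (h : Agree σ Γ)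
    (hστ : ∀ j < Γ.length, τ j = σ j) : Agree τ Γ := by
  induction Γ with
  | nil => trivial
  | cons v Γ ih =>
    exact ⟨(hστ _ (by simp)).trans h.1, ih h.2 fun j hj => hστ j (by simp; omega)⟩

theorem Agree.get {σ : Store} {Γ : List Val} (h : Agree σ Γ) {i : ℕ} (hi : i < Γ.length) :
    σ (Γ.length - 1 - i) = Γ.getD i Val.nil := by
  induction Γ generalizing i with
  | nil => simp at hi
  | cons v Γ ih =>
    cases i with
    | zero => simpa using h.1
    | succ i =>
      have hi' : i < Γ.length := by simpa using hi
      have := ih h.2 hi'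
      rw [List.getD_cons_succ, ← this]
      congr 1
      simp
      omega

theorem Agree.eval_lower {σ : Store} {Γ : List Val} (h : Agree σ Γ) (e : Expr) :
    (e.lower Γ.length).eval σ = Ev Γ e := by
  induction e with
  | var i =>
    by_cases hi : i < Γ.length
    · simpa [Expr.lower, hi, Expr.eval, Ev] using h.get hi
    · simp [Expr.lower, hi, Expr.eval, Ev, List.getD_eq_getElem?_getD]
  | _ => simp_all [Expr.lower, Expr.eval, Ev]

/-- Compiled terms compute their value, in the number of steps given by `cost`. -/
theorem exec_compile {n : ℕ} (s : Signal n) (t : Tm) (Γ : List Val) (σ : Store)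
    (h : Agree σ Γ) :
    ∃ σ', Exec s (compile Γ.length t) σ σ' (cost (fun v => s (v.toVec n)) t Γ) ∧
      σ' Γ.length = den (fun v => s (v.toVec n)) t Γ ∧ ∀ j < Γ.length, σ' j = σ j := by
  induction t generalizing Γ σ with
  | ex e =>
    refine ⟨_, Exec.assign _ _ _, ?_, ?_⟩
    · simp [h.eval_lower, den]
    · intro j hj
      exact Function.update_of_ne hj.ne _ _
  | qry e =>
    refine ⟨_, Exec.query _ _ _, ?_, ?_⟩
    · simp [h.eval_lower, den]
    · intro j hj
      exact Function.update_of_ne hj.ne _ _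
  | bind t u iht ihu =>
    obtain ⟨σ₁, e₁, v₁, k₁⟩ := iht Γ σ h
    obtain ⟨σ₂, e₂, v₂, k₂⟩ := ihu (_ :: Γ) σ₁ ⟨v₁, h.congr k₁⟩
    refine ⟨_, e₁.seq (e₂.seq (Exec.assign _ _ _)), ?_, ?_⟩
    · simpa [Expr.eval, den] using v₂
    · intro j hj
      rw [Function.update_of_ne hj.ne, k₂ j (by simp; omega), k₁ j hj]
  | ite c t u iht ihu =>
    by_cases hc : (Ev Γ c).truthy
    · obtain ⟨σ₁, e₁, v₁, k₁⟩ := iht Γ σ h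
      refine ⟨σ₁, ?_, ?_, k₁⟩
      · simpa [cost, hc, compile] using e₁.ite_true (by rw [h.eval_lower, hc])
      · simpa [den, hc] using v₁
    · obtain ⟨σ₁, e₁, v₁, k₁⟩ := ihu Γ σ h
      refine ⟨σ₁, ?_, ?_, k₁⟩
      · simpa [cost, hc, compile] using e₁.ite_false (by rw [h.eval_lower]; simpa using hc)
      · simpa [den, hc] using v₁
  | fold l i t ih =>
    set b := Γ.length with hb
    set o : Val → ℂ := fun v => s (v.toVec n)
    set f : Val → Val → Val := fun r acc => den o t (r.hd :: acc :: r :: Γ) with hf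
    set c : Val → Val → ℕ := fun r acc => cost o t (r.hd :: acc :: r :: Γ) with hc
    set body : Prog := .seq (.assign (b + 2) (.hd (.var b))) (.seq (compile (b + 3) t)
            (.seq (.assign (b + 1) (.var (b + 3))) (.assign b (.tl (.var b))))) with hbody
    -- one pass through the loop body
    have pass : ∀ (r acc : Val) (τ : Store), Agree τ Γ → τ b = r → τ (b + 1) = acc →
        ∃ τ', Exec s body τ τ' (c r acc + 6) ∧ Agree τ' Γ ∧ (∀ j < b, τ' j = τ j) ∧
          τ' b = r.tl ∧ τ' (b + 1) = f r acc := by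
      intro r acc τ hτ hr hacc
      obtain ⟨τ₁, e₁, v₁, k₁⟩ := ih (r.hd :: acc :: r :: Γ)
        (Function.update τ (b + 2) r.hd) (by
          refine ⟨by simp [hb], ?_, ?_, ?_⟩
          · simp [← hb, hacc]
          · simp [← hb, hr]
          · exact hτ.congr fun j hj => Function.update_of_ne (by omega) _ _)
      have e₀ : Exec s (.assign (b + 2) (.hd (.var b))) τ (Function.update τ (b + 2) r.hd) 1 := by
        simpa [Expr.eval, hr] using Exec.assign (s := s) (b + 2) (.hd (.var b)) τ
      have e := e₀.seq (e₁.seq ((Exec.assign (b + 1) (.var (b + 3)) τ₁).seq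
        (Exec.assign b (.tl (.var b)) _)))
      have key : ∀ j < b, τ₁ j = τ j := fun j hj => by
        rw [k₁ j (by simp; omega), Function.update_of_ne (by omega)]
      refine ⟨Function.update (Function.update τ₁ (b + 1) (τ₁ (b + 3))) b (τ₁ b).tl,
        ?_, ?_, ?_, ?_, ?_⟩
      · have ht : 1 + (c r acc + (1 + 1 + 1) + 1) + 1 = c r acc + 6 := by omega
        rw [← ht]
        simpa [Expr.eval] using e
      · exact hτ.congr fun j hj => by
            rw [Function.update_of_ne (by omega), Function.update_of_ne (by omega), key j hj]
      · intro j hj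
        rw [Function.update_of_ne (by omega), Function.update_of_ne (by omega), key j hj]
      · rw [Function.update_self, k₁ b (by simp; omega), Function.update_of_ne (by omega), hr]
      · rw [Function.update_of_ne (by omega), Function.update_self]
        simpa [← hb] using v₁
    -- the loop
    have loop : ∀ (r acc : Val) (τ : Store), Agree τ Γ → τ b = r → τ (b + 1) = acc →
        ∃ τ', Exec s (.while (.var b) body) τ τ' (Val.foldCost f c r acc) ∧
          (∀ j < b, τ' j = τ j) ∧ τ' (b + 1) = Val.fold f r acc := by
      intro r
      induction r with
      | nil =>
        intro acc τ hτ hr hacc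
        exact ⟨τ, Exec.while_false (by simp [Expr.eval, hr, Val.truthy]), fun _ _ => rfl, hacc⟩
      | num z =>
        intro acc τ hτ hr hacc
        obtain ⟨τ₁, e₁, a₁, k₁, r₁, v₁⟩ := pass _ _ τ hτ hr hacc
        refine ⟨τ₁, ?_, k₁, v₁⟩
        exact Exec.while_true (by simp [Expr.eval, hr, Val.truthy]) e₁
          (Exec.while_false (by simp [Expr.eval, r₁, Val.truthy, Val.tl]))
      | cons a r' _ ihr =>
        intro acc τ hτ hr hacc
        obtain ⟨τ₁, e₁, a₁, k₁, r₁, v₁⟩ := pass _ _ τ hτ hr hacc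
        obtain ⟨τ₂, e₂, k₂, v₂⟩ := ihr _ τ₁ a₁ r₁ v₁
        refine ⟨τ₂, ?_, fun j hj => (k₂ j hj).trans (k₁ j hj), v₂⟩
        exact Exec.while_true (by simp [Expr.eval, hr, Val.truthy]) e₁ e₂
    have e₁ := Exec.assign (s := s) b (l.lower b) σ
    rw [h.eval_lower] at e₁
    have h₁ : Agree (Function.update σ b (Ev Γ l)) Γ :=
      h.congr fun j hj => Function.update_of_ne (by omega) _ _
    have e₂ := Exec.assign (s := s) (b + 1) (i.lower b) (Function.update σ b (Ev Γ l))
    rw [h₁.eval_lower] at e₂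
    obtain ⟨τ, e₃, k₃, v₃⟩ := loop (Ev Γ l) (Ev Γ i)
      (Function.update (Function.update σ b (Ev Γ l)) (b + 1) (Ev Γ i))
      (h₁.congr fun j hj => Function.update_of_ne (by omega) _ _)
      (by rw [Function.update_of_ne (by omega), Function.update_self])
      (by rw [Function.update_self])
    refine ⟨_, e₁.seq (e₂.seq (e₃.seq (Exec.assign b (.var (b + 1)) τ))), ?_, ?_⟩
    · simpa [Expr.eval, den] using v₃
    · intro j hj
      rw [Function.update_of_ne hj.ne, k₃ j hj, Function.update_of_ne (by omega),
        Function.update_of_ne (by omega)]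

/-! ### Values and running times of terms -/

/-- The term `t` has the value `v` in the environment `Γ`, and it takes at most `p(Y)` steps.

For a function `f` on lists, numbers and so on, the term `fT` below computes `f` on encoded
arguments, and the theorem `f_spec` states this together with the existence of a polynomial `p`
that bounds the number of steps whenever the sizes of the arguments are at most `Y`. In the proofs
the polynomial is a metavariable that the rules for `Cp` determine. -/
def Cp (o : Val → ℂ) (t : Tm) (Γ : List Val) (v : Val) (p : Polynomial ℕ) (Y : ℕ) : Prop :=
  den o t Γ = v ∧ cost o t Γ ≤ p.eval Y

/-- `t` applied to the value of `e`. -/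
def Tm.on (t : Tm) (e : Expr) : Tm := .bind (.ex e) t

/-- The list of values `l` as a value. -/
def Val.ofList : List Val → Val
  | [] => .nil
  | a :: l => .cons a (ofList l)

theorem Val.toList_ofList (l : List Val) : (Val.ofList l).toList = l := by
  induction l with
  | nil => rfl
  | cons a l ih => simp [Val.ofList, Val.toList, ih]

theorem Val.unary_eq (n : ℕ) :
    Val.unary n = Val.ofList ((List.replicate n ()).map fun _ => Val.nil) := by
  induction n with
  | zero => rfl
  | succ n ih => simp [Val.unary, ih, List.replicate_succ, Val.ofList]

@[simp] theorem Val.hd_cons (a b : Val) : (Val.cons a b).hd = a := rfl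
@[simp] theorem Val.tl_cons (a b : Val) : (Val.cons a b).tl = b := rfl
@[simp] theorem Val.toNum_num (z : ℂ) : (Val.num z).toNum = z := rfl

namespace Cp
variable {o : Val → ℂ} {t u b : Tm} {Γ : List Val} {v w x : Val} {p q : Polynomial ℕ} {Y : ℕ}
  {e l i c : Expr}

theorem ex (h : Ev Γ e = v) : Cp o (.ex e) Γ v 1 Y :=
  ⟨h, by simp [cost]⟩

theorem qry (h : Ev Γ e = v) : Cp o (.qry e) Γ (.num (o v)) 1 Y :=
  ⟨by simp [den, h], by simp [cost]⟩

theorem bind (ht : Cp o t Γ v p Y) (hu : Cp o u (v :: Γ) w q Y) :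
    Cp o (.bind t u) Γ w (p + q + 3) Y := by
  obtain ⟨rfl, h₁⟩ := ht
  obtain ⟨rfl, h₂⟩ := hu
  refine ⟨rfl, ?_⟩
  simp only [cost, Polynomial.eval_add, Polynomial.eval_ofNat]
  omega

theorem on (h : Ev Γ e = x) (ht : Cp o t (x :: Γ) v p Y) : Cp o (t.on e) Γ v (1 + p + 3) Y :=
  (Cp.ex h).bind ht

theorem ite (a : Bool) (h : (Ev Γ c).truthy = a) (ht : a = true → Cp o t Γ v p Y)
    (hu : a = false → Cp o u Γ v q Y) : Cp o (.ite c t u) Γ v (p + q + 1) Y := by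
  cases a with
  | true =>
    obtain ⟨h₁, h₂⟩ := ht rfl
    refine ⟨by simp [den, h, h₁], ?_⟩
    simp only [cost, h, Polynomial.eval_add, Polynomial.eval_one]
    simp; omega
  | false =>
    obtain ⟨h₁, h₂⟩ := hu rfl
    refine ⟨by simp [den, h, h₁], ?_⟩
    simp only [cost, h, Polynomial.eval_add, Polynomial.eval_one]
    simp; omega

/-- The rule for loops. The invariant `I m` holds for the accumulator when `m` entries of the list
remain. -/
theorem foldI {α β : Type*} (encA : α → Val) (encB : β → Val) (g : β → α → β) (I : ℕ → β → Prop)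
    (L : List α) (b₀ : β) (hl : Ev Γ l = Val.ofList (L.map encA)) (hi : Ev Γ i = encB b₀)
    (hL : L.length ≤ Y) (hI : I L.length b₀)
    (hb : ∀ a ∈ L, ∀ m d r, I (m + 1) d → Cp o b (encA a :: encB d :: r :: Γ) (encB (g d a)) p Y)
    (hI' : ∀ a ∈ L, ∀ m d, I (m + 1) d → I m (g d a)) :
    Cp o (.fold l i b) Γ (encB (L.foldl g b₀)) (Polynomial.X * (p + 7) + 7) Y := by
  have key : ∀ (L : List α) (d : β), I L.length d →
      (∀ a ∈ L, ∀ m d r, I (m + 1) d → Cp o b (encA a :: encB d :: r :: Γ) (encB (g d a)) p Y) →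
      (∀ a ∈ L, ∀ m d, I (m + 1) d → I m (g d a)) →
      Val.fold (fun r acc => den o b (r.hd :: acc :: r :: Γ)) (Val.ofList (L.map encA)) (encB d)
        = encB (L.foldl g d) ∧
      Val.foldCost (fun r acc => den o b (r.hd :: acc :: r :: Γ))
        (fun r acc => cost o b (r.hd :: acc :: r :: Γ)) (Val.ofList (L.map encA)) (encB d)
        ≤ L.length * (p.eval Y + 7) + 1 := by
    intro L
    induction L with
    | nil => intro d _ _ _; simp [Val.ofList, Val.fold, Val.foldCost]
    | cons a L ih =>
      intro d hd hb hI'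
      obtain ⟨h₁, h₂⟩ := hb a (by simp) L.length d (Val.cons (encA a) (Val.ofList (L.map encA))) hd
      obtain ⟨h₃, h₄⟩ := ih (g d a) (hI' a (by simp) L.length d hd)
        (fun a ha => hb a (by simp [ha])) (fun a ha => hI' a (by simp [ha]))
      simp only [List.map_cons, Val.ofList, Val.fold, Val.foldCost, Val.hd_cons, h₁,
        List.foldl_cons, List.length_cons]
      refine ⟨h₃, ?_⟩
      rw [add_mul]
      omega
  obtain ⟨h₁, h₂⟩ := key L b₀ hI hb hI'
  refine ⟨by simp only [den, hl, hi]; exact h₁, ?_⟩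
  simp only [cost, hl, hi, Polynomial.eval_add, Polynomial.eval_mul, Polynomial.eval_X,
    Polynomial.eval_ofNat]
  have : L.length * (p.eval Y + 7) ≤ Y * (p.eval Y + 7) := Nat.mul_le_mul_right _ hL
  omega

theorem fold {α β : Type*} (encA : α → Val) (encB : β → Val) (g : β → α → β)
    (L : List α) (b₀ : β) (hl : Ev Γ l = Val.ofList (L.map encA)) (hi : Ev Γ i = encB b₀)
    (hL : L.length ≤ Y)
    (hb : ∀ a ∈ L, ∀ d r, Cp o b (encA a :: encB d :: r :: Γ) (encB (g d a)) p Y) :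
    Cp o (.fold l i b) Γ (encB (L.foldl g b₀)) (Polynomial.X * (p + 7) + 7) Y :=
  foldI encA encB g (fun _ _ => True) L b₀ hl hi hL trivial (fun a ha _ d r _ => hb a ha d r)
    (fun _ _ _ _ _ => trivial)

/-- The rule for loops that count down a unary number. -/
theorem iterI {β : Type*} (encB : β → Val) (g : β → β) (I : ℕ → β → Prop)
    (m : ℕ) (b₀ : β) (hl : Ev Γ l = Val.unary m) (hi : Ev Γ i = encB b₀)
    (hL : m ≤ Y) (hI : I m b₀)
    (hb : ∀ k d r, I (k + 1) d → Cp o b (Val.nil :: encB d :: r :: Γ) (encB (g d)) p Y)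
    (hI' : ∀ k d, I (k + 1) d → I k (g d)) :
    Cp o (.fold l i b) Γ (encB (g^[m] b₀)) (Polynomial.X * (p + 7) + 7) Y := by
  have := foldI (o := o) (b := b) (p := p) (Y := Y) (fun _ : Unit => Val.nil) encB
    (fun d _ => g d) I (List.replicate m ()) b₀
    (by rw [hl, Val.unary_eq]) hi (by simpa using hL) (by simpa using hI)
    (fun _ _ k d r hd => hb k d r hd) (fun _ _ k d hd => hI' k d hd)
  have h : ∀ (m : ℕ) (d : β), (List.replicate m ()).foldl (fun d _ => g d) d = g^[m] d := by
    intro m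
    induction m with
    | zero => intro d; rfl
    | succ m ih => intro d; simp [List.replicate_succ, ih]
  rwa [h] at this

theorem iter {β : Type*} (encB : β → Val) (g : β → β)
    (m : ℕ) (b₀ : β) (hl : Ev Γ l = Val.unary m) (hi : Ev Γ i = encB b₀) (hL : m ≤ Y)
    (hb : ∀ d r, Cp o b (Val.nil :: encB d :: r :: Γ) (encB (g d)) p Y) :
    Cp o (.fold l i b) Γ (encB (g^[m] b₀)) (Polynomial.X * (p + 7) + 7) Y :=
  iterI encB g (fun _ _ => True) m b₀ hl hi hL trivial (fun _ d r _ => hb d r)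
    (fun _ _ _ => trivial)

end Cp

attribute [simp] Ev Expr.eval

/-! ### Lists of bits -/

/-- A bit as a value. -/
def bitV (z : ZMod 2) : Val := if z = 0 then .nil else .cons .nil .nil

/-- A list of bits as a value. -/
def bits (l : List (ZMod 2)) : Val := .ofList (l.map bitV)

/-- The value `true` as an expression. -/
def tt : Expr := .cons .nil .nil

theorem bit_cases (z : ZMod 2) : z = 0 ∨ z = 1 := by
  revert z; decide

theorem truthy_bitV (z : ZMod 2) : (bitV z).truthy = decide (z ≠ 0) := by
  rcases bit_cases z with rfl | rfl <;> simp [bitV, Val.truthy]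

@[simp] theorem hd_bits (l : List (ZMod 2)) : (bits l).hd = bitV (l.headD 0) := by
  cases l <;> simp [bits, Val.ofList, Val.hd, bitV]

@[simp] theorem tl_bits (l : List (ZMod 2)) : (bits l).tl = bits l.tail := by
  cases l <;> simp [bits, Val.ofList, Val.tl]

theorem cons_bits (z : ZMod 2) (l : List (ZMod 2)) : Val.cons (bitV z) (bits l) = bits (z :: l) :=
  rfl

theorem bitV_zero : bitV 0 = .nil := by simp [bitV]
theorem bitV_one : bitV 1 = .cons .nil .nil := by simp [bitV]
theorem one_add_one_bit : (1 + 1 : ZMod 2) = 0 := by decide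

/-- Moves as many entries as its first argument has from its second argument to the front of an
empty list. -/
def popRevT : Tm :=
  .fold (.hd (.var 0)) (.cons (.tl (.var 0)) .nil)
    (.ex (.cons (.tl (.hd (.var 1))) (.cons (.hd (.hd (.var 1))) (.tl (.var 1)))))

theorem iterate_popRev (m : ℕ) (l r : List Val) (h : m ≤ l.length) :
    (fun x : List Val × List Val => (x.1.tail, x.1.headD .nil :: x.2))^[m] (l, r) =
      (l.drop m, (l.take m).reverse ++ r) := by
  induction m generalizing l r with
  | zero => simp
  | succ m ih =>
    cases l with
    | nil => simp at h
    | cons a l =>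
      rw [Function.iterate_succ_apply]
      exact (ih l _ (by simpa using h)).trans (by simp)

theorem popRev_spec : ∃ p, ∀ (o : Val → ℂ) Y Γ m (l : List Val), m ≤ l.length → m ≤ Y →
    Cp o popRevT (.cons (Val.unary m) (.ofList l) :: Γ)
      (.cons (.ofList (l.drop m)) (.ofList (l.take m).reverse)) p Y := by
  apply Exists.intro
  intro o Y Γ m l h hm
  have := Cp.iter (o := o) (p := 1) (Γ := .cons (Val.unary m) (.ofList l) :: Γ) (Y := Y)
    (fun x : List Val × List Val => Val.cons (.ofList x.1) (.ofList x.2))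
    (fun x => (x.1.tail, x.1.headD .nil :: x.2)) m (l, [])
    (l := .hd (.var 0)) (i := .cons (.tl (.var 0)) .nil) rfl rfl hm
    (b := (.ex (.cons (.tl (.hd (.var 1))) (.cons (.hd (.hd (.var 1))) (.tl (.var 1))))))
    (fun d r => Cp.ex (by
      rcases d with ⟨_ | ⟨a, d⟩, e⟩ <;> rfl))
  rw [iterate_popRev m l [] h, List.append_nil] at this
  exact this

/-- Reverses a list. -/
def revT : Tm :=
  .fold (.var 0) .nil (.ex (.cons (.var 0) (.var 1)))

theorem rev_spec : ∃ p, ∀ (o : Val → ℂ) Y Γ (l : List Val), l.length ≤ Y →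
    Cp o revT (.ofList l :: Γ) (.ofList l.reverse) p Y := by
  apply Exists.intro
  intro o Y Γ l h
  have := Cp.fold (o := o) (p := 1) (Γ := .ofList l :: Γ) (Y := Y) id Val.ofList
    (fun d a => a :: d) l [] (l := .var 0) (i := .nil)
    (by simp [Ev, Expr.eval]) rfl h
    (b := (.ex (.cons (.var 0) (.var 1))))
    (fun a _ d r => Cp.ex rfl)
  have h : ∀ (l r : List Val), l.foldl (fun d a => a :: d) r = l.reverse ++ r := by
    intro l
    induction l with
    | nil => simp
    | cons a l ih => simp [ih]
  rw [h, List.append_nil] at this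
  exact this

theorem rev_bits_spec : ∃ p, ∀ (o : Val → ℂ) Y Γ (l : List (ZMod 2)), l.length ≤ Y →
    Cp o revT (bits l :: Γ) (bits l.reverse) p Y := by
  obtain ⟨p, hp⟩ := rev_spec
  refine ⟨p, fun o Y Γ l h => ?_⟩
  simpa [bits] using hp o Y Γ (l.map bitV) (by simpa using h)

/-- Splits a list: the input is a unary number and a list, the output is the pair of the rest and
the initial part. -/
def popT : Tm :=
  .bind popRevT (.bind (revT.on (.tl (.var 0))) (.ex (.cons (.hd (.var 1)) (.var 0))))

theorem pop_spec : ∃ p, ∀ (o : Val → ℂ) Y Γ m (l : List (ZMod 2)), m ≤ l.length → m ≤ Y →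
    Cp o popT (.cons (Val.unary m) (bits l) :: Γ)
      (.cons (bits (l.drop m)) (bits (l.take m))) p Y := by
  obtain ⟨p, hp⟩ := popRev_spec
  obtain ⟨q, hq⟩ := rev_spec
  apply Exists.intro
  intro o Y Γ m l h hm
  refine (hp o Y Γ m (l.map bitV) (by simpa) hm).bind
    ((Cp.on rfl (hq o Y _ _ (by simp; omega))).bind (Cp.ex ?_))
  simp [bits, List.map_drop, List.map_take]

/-- The sum of two vectors; the second one is truncated or continued by zeros to the length of the
first one. -/
def addL : List (ZMod 2) → List (ZMod 2) → List (ZMod 2)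
  | [], _ => []
  | a :: x, e => (a + e.headD 0) :: addL x e.tail

theorem length_addL (x e : List (ZMod 2)) : (addL x e).length = x.length := by
  induction x generalizing e with
  | nil => rfl
  | cons a x ih => simp [addL, ih]

theorem foldl_addL (x e r : List (ZMod 2)) :
    x.foldl (fun (d : List (ZMod 2) × List (ZMod 2)) a => (d.1.tail, (a + d.1.headD 0) :: d.2))
      (e, r) = (e.drop x.length, (addL x e).reverse ++ r) := by
  induction x generalizing e r with
  | nil => simp [addL]
  | cons a x ih => simpa [addL] using ih e.tail ((a + e.headD 0) :: r)

/-- The sum of two bits; the two arguments are expressions. -/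
def xorT (a b : Expr) : Tm :=
  .ite a (.ite b (.ex .nil) (.ex tt)) (.ite b (.ex tt) (.ex .nil))

theorem xor_spec : ∃ p, ∀ (o : Val → ℂ) Y Γ a b x y, Ev Γ a = bitV x → Ev Γ b = bitV y →
    Cp o (xorT a b) Γ (bitV (x + y)) p Y := by
  apply Exists.intro
  intro o Y Γ a b x y ha hb
  refine Cp.ite _ (by rw [ha, truthy_bitV])
    (fun hx => Cp.ite _ (by rw [hb, truthy_bitV]) (fun hy => Cp.ex ?_) (fun hy => Cp.ex ?_))
    (fun hx => Cp.ite _ (by rw [hb, truthy_bitV]) (fun hy => Cp.ex ?_) (fun hy => Cp.ex ?_)) <;>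
  · rcases bit_cases x with rfl | rfl <;> rcases bit_cases y with rfl | rfl <;>
      simp_all [Ev, tt, Expr.eval, bitV_zero, bitV_one, one_add_one_bit]

/-- The sum of two vectors. -/
def addT : Tm :=
  .bind
    (.fold (.hd (.var 0)) (.cons (.tl (.var 0)) .nil)
      (.bind (xorT (.var 0) (.hd (.hd (.var 1))))
        (.ex (.cons (.tl (.hd (.var 2))) (.cons (.var 0) (.tl (.var 2)))))))
    (revT.on (.tl (.var 0)))

theorem add_spec : ∃ p, ∀ (o : Val → ℂ) Y Γ x e, x.length ≤ Y →
    Cp o addT (.cons (bits x) (bits e) :: Γ) (bits (addL x e)) p Y := by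
  obtain ⟨p, hp⟩ := xor_spec
  obtain ⟨q, hq⟩ := rev_bits_spec
  apply Exists.intro
  intro o Y Γ x e h
  apply Cp.bind
  · refine Cp.fold bitV
      (fun d : List (ZMod 2) × List (ZMod 2) => Val.cons (bits d.1) (bits d.2))
      (fun d a => (d.1.tail, (a + d.1.headD 0) :: d.2)) x (e, []) rfl rfl h
      (fun a _ d r => (hp o Y _ _ _ a (d.1.headD 0) rfl ?_).bind (Cp.ex ?_))
    · simp
    · simp [cons_bits]
  · rw [foldl_addL]
    have := hq o Y (Val.cons (bits (e.drop x.length)) (bits ((addL x e).reverse ++ [])) ::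
      .cons (bits x) (bits e) :: Γ) (addL x e).reverse (by simpa [length_addL] using h)
    rw [List.reverse_reverse] at this
    exact Cp.on (by simp) this

/-! ### Decoding of linear functions -/

/-- A sample point with a sign, as a value. -/
def ptV (x : List (ZMod 2) × ℂ) : Val := .cons (bits x.1) (.num x.2)

/-- A list of sample points with signs, as a value. -/
def ptsV (P : List (List (ZMod 2) × ℂ)) : Val := .ofList (P.map ptV)

/-- Adds the translates of the sample points by `v`; `b` tells whether their signs change. -/
def dbl (P : List (List (ZMod 2) × ℂ)) (v : List (ZMod 2)) (b : ZMod 2) :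
    List (List (ZMod 2) × ℂ) :=
  P.foldl (fun acc x => x :: (addL x.1 v, if b = 0 then x.2 else 0 - x.2) :: acc) []

theorem dbl_aux (P : List (List (ZMod 2) × ℂ)) (v : List (ZMod 2)) (b : ZMod 2)
    (acc : List (List (ZMod 2) × ℂ)) :
    P.foldl (fun acc x => x :: (addL x.1 v, if b = 0 then x.2 else 0 - x.2) :: acc) acc =
      dbl P v b ++ acc := by
  unfold dbl
  induction P generalizing acc with
  | nil => simp
  | cons x P ih => rw [List.foldl_cons, List.foldl_cons, ih, ih [_, _]]; simp

theorem dbl_cons (x : List (ZMod 2) × ℂ) (P : List (List (ZMod 2) × ℂ)) (v : List (ZMod 2))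
    (b : ZMod 2) :
    dbl (x :: P) v b = dbl P v b ++ [x, (addL x.1 v, if b = 0 then x.2 else 0 - x.2)] := by
  conv_lhs => rw [dbl, List.foldl_cons, dbl_aux]

theorem length_dbl (P : List (List (ZMod 2) × ℂ)) (v : List (ZMod 2)) (b : ZMod 2) :
    (dbl P v b).length = 2 * P.length := by
  induction P with
  | nil => rfl
  | cons x P ih => simp [dbl_cons, ih]; omega

theorem mem_dbl_length {n : ℕ} {P : List (List (ZMod 2) × ℂ)} {v : List (ZMod 2)} {b : ZMod 2}
    (h : ∀ x ∈ P, x.1.length = n) : ∀ x ∈ dbl P v b, x.1.length = n := by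
  induction P with
  | nil => simp [dbl]
  | cons x P ih =>
    intro y hy
    rw [dbl_cons, List.mem_append] at hy
    rcases hy with hy | hy
    · exact ih (fun x hx => h x (by simp [hx])) y hy
    · have := h x (by simp)
      simp only [List.mem_cons, List.not_mem_nil, or_false] at hy
      rcases hy with rfl | rfl
      · exact this
      · simpa [length_addL] using this

/-- The input consists of the sample points, the vector `v` and the bit `b`. -/
def dblT : Tm :=
  .fold (.hd (.var 0)) .nil
    (.bind (addT.on (.cons (.hd (.var 0)) (.hd (.tl (.var 3)))))
      (.ite (.tl (.tl (.var 4)))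
        (.ex (.cons (.var 1) (.cons (.cons (.var 0) (.sub .zero (.tl (.var 1)))) (.var 2))))
        (.ex (.cons (.var 1) (.cons (.cons (.var 0) (.tl (.var 1))) (.var 2))))))

theorem dbl_spec : ∃ p, ∀ (o : Val → ℂ) Y Γ P v b, P.length ≤ Y → (∀ x ∈ P, x.1.length ≤ Y) →
    Cp o dblT (.cons (ptsV P) (.cons (bits v) (bitV b)) :: Γ) (ptsV (dbl P v b)) p Y := by
  obtain ⟨p, hp⟩ := add_spec
  apply Exists.intro
  intro o Y Γ P v b hP hx
  refine Cp.fold ptV ptsV _ P [] rfl rfl hP fun x hxP d r =>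
    (Cp.on rfl (hp o Y _ x.1 v (hx x hxP))).bind
    (Cp.ite _ (truthy_bitV b) (fun hb => Cp.ex ?_) (fun hb => Cp.ex ?_))
  · have : b ≠ 0 := by simpa using hb
    simp [ptsV, ptV, Val.ofList, this]
  · have : b = 0 := by simpa using hb
    simp [ptsV, ptV, Val.ofList, this]

/-- The points `w + ∑ i ∈ S, v i`, where `S` runs over the subsets of the indices of `vs`, with the
signs `∏ i ∈ S, (-1) ^ b i`. -/
def points (w : List (ZMod 2)) (vs : List (List (ZMod 2))) (bs : List (ZMod 2)) :
    List (List (ZMod 2) × ℂ) :=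
  (vs.foldl (fun d v => (d.1.tail, dbl d.2 v (d.1.headD 0))) (bs, [(w, (1 : ℂ))])).2

theorem points_inv (n : ℕ) (vs : List (List (ZMod 2)))
    (d : List (ZMod 2) × List (List (ZMod 2) × ℂ)) (h : ∀ x ∈ d.2, x.1.length = n) :
    let d' := vs.foldl (fun d v => (d.1.tail, dbl d.2 v (d.1.headD 0))) d
    (∀ x ∈ d'.2, x.1.length = n) ∧ d'.2.length = 2 ^ vs.length * d.2.length := by
  induction vs generalizing d with
  | nil => simpa using h
  | cons v vs ih =>
    obtain ⟨h₁, h₂⟩ := ih (d.1.tail, dbl d.2 v (d.1.headD 0)) (mem_dbl_length h)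
    refine ⟨h₁, h₂.trans ?_⟩
    simp [length_dbl, pow_succ]
    ring

theorem length_points (w : List (ZMod 2)) (vs : List (List (ZMod 2))) (bs : List (ZMod 2)) :
    (points w vs bs).length = 2 ^ vs.length := by
  exact (points_inv w.length vs (bs, [(w, (1 : ℂ))]) (by simp)).2.trans (by simp)

theorem mem_points_length (w : List (ZMod 2)) (vs : List (List (ZMod 2))) (bs : List (ZMod 2)) :
    ∀ x ∈ points w vs bs, x.1.length = w.length :=
  (points_inv w.length vs (bs, [(w, (1 : ℂ))]) (by simp)).1

/-- The input consists of the base point, the spanning vectors and the bits for the signs. -/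
def pointsT : Tm :=
  .bind
    (.fold (.hd (.tl (.var 0)))
      (.cons (.tl (.tl (.var 0))) (.cons (.cons (.hd (.var 0)) .one) .nil))
      (.bind (dblT.on (.cons (.tl (.var 1)) (.cons (.var 0) (.hd (.hd (.var 1))))))
        (.ex (.cons (.tl (.hd (.var 2))) (.var 0)))))
    (.ex (.tl (.var 0)))

theorem points_spec : ∃ p, ∀ (o : Val → ℂ) Y Γ w (vs : List (List (ZMod 2))) bs,
    w.length ≤ Y → vs.length ≤ Y → 2 ^ vs.length ≤ Y →
    Cp o pointsT (.cons (bits w) (.cons (.ofList (vs.map bits)) (bits bs)) :: Γ)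
      (ptsV (points w vs bs)) p Y := by
  obtain ⟨p, hp⟩ := dbl_spec
  apply Exists.intro
  intro o Y Γ w vs bs hw hvs hY
  refine Cp.bind (Cp.foldI (p := 1 + p + 3 + 1 + 3) bits
    (fun d : List (ZMod 2) × List (List (ZMod 2) × ℂ) => Val.cons (bits d.1) (ptsV d.2))
    (fun d v => (d.1.tail, dbl d.2 v (d.1.headD 0)))
    (fun m d => d.2.length * 2 ^ m ≤ Y ∧ ∀ x ∈ d.2, x.1.length = w.length) vs
    (bs, [(w, (1 : ℂ))]) rfl rfl hvs (by simpa using hY) (fun v _ m d r hd => ?_)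
    (fun v _ m d hd => ?_)) (Cp.ex rfl)
  · exact (Cp.on (by simp) (hp o Y _ d.2 v (d.1.headD 0)
      (le_trans (Nat.le_mul_of_pos_right _ (by positivity)) hd.1)
      (fun x hx => (hd.2 x hx).trans_le hw))).bind (Cp.ex (by simp))
  · refine ⟨?_, mem_dbl_length hd.2⟩
    rw [length_dbl]
    calc 2 * d.2.length * 2 ^ m = d.2.length * 2 ^ (m + 1) := by ring
      _ ≤ Y := hd.1

/-- The signed sum of the values of `G` at the sample points, translated by `sh`. -/
def corr (G : List (ZMod 2) → ℂ) (P : List (List (ZMod 2) × ℂ)) (sh : List (ZMod 2)) : ℂ :=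
  P.foldl (fun acc x => acc + x.2 * G (addL x.1 sh)) 0

/-- The term `g` computes the function `G`. The input consists of the translation, the sample
points and further data for `g`. -/
def corrT (g : Tm) : Tm :=
  .fold (.hd (.tl (.var 0))) .zero
    (.bind (addT.on (.cons (.hd (.var 0)) (.hd (.var 3))))
      (.bind (g.on (.cons (.var 0) (.tl (.tl (.var 4)))))
        (.ex (.add (.var 3) (.mul (.tl (.var 2)) (.var 0))))))

theorem corr_spec (pg : Polynomial ℕ) : ∃ p, ∀ (o : Val → ℂ) Y Γ g ctx G n P sh,
    (∀ y Γ, y.length = n → Cp o g (.cons (bits y) ctx :: Γ) (.num (G y)) pg Y) → n ≤ Y →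
    P.length ≤ Y → (∀ x ∈ P, x.1.length = n) →
    Cp o (corrT g) (.cons (bits sh) (.cons (ptsV P) ctx) :: Γ) (.num (corr G P sh)) p Y := by
  obtain ⟨p, hp⟩ := add_spec
  apply Exists.intro
  intro o Y Γ g ctx G n P sh hg hn hP hx
  exact Cp.fold ptV Val.num _ P 0 rfl rfl hP fun x hxP d r =>
    (Cp.on rfl (hp o Y _ x.1 sh (by rw [hx x hxP]; exact hn))).bind
    ((Cp.on rfl (hg _ _ (by rw [length_addL, hx x hxP]))).bind (Cp.ex (by simp [ptV])))

/-- The `j`-th unit vector. -/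
def unitL (j : ℕ) : List (ZMod 2) := List.replicate j 0 ++ [1]

/-- The `j`-th bit of the linear function that the signed samples of `G` suggest. -/
def linBit (G : List (ZMod 2) → ℂ) (P : List (List (ZMod 2) × ℂ)) (j : ℕ) : ZMod 2 :=
  open Classical in if 0 ≤ (corr G P (unitL j) * star (corr G P [])).re then 0 else 1

/-- All `n` bits of the linear function that the signed samples of `G` suggest. -/
def linDec (n : ℕ) (G : List (ZMod 2) → ℂ) (P : List (List (ZMod 2) × ℂ)) : List (ZMod 2) :=
  (List.range n).map (linBit G P)

/-- The term `g` computes the function `G`. The input consists of `n` in unary, the sample points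
and further data for `g`. -/
def linT (g : Tm) : Tm :=
  .bind ((corrT g).on (.cons .nil (.tl (.var 0))))
    (.bind (.fold (.hd (.var 1)) (.cons (.cons tt .nil) .nil)
      (.bind ((corrT g).on (.cons (.hd (.var 1)) (.tl (.var 4))))
        (.ite (.le .zero (.mul (.var 0) (.conj (.var 4))))
          (.ex (.cons (.cons .nil (.hd (.var 2))) (.cons .nil (.tl (.var 2)))))
          (.ex (.cons (.cons .nil (.hd (.var 2))) (.cons tt (.tl (.var 2))))))))
      (revT.on (.tl (.var 0))))

theorem truthy_ofBool (b : Bool) : (Val.ofBool b).truthy = b := by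
  cases b <;> rfl

theorem iterate_linDec (G : List (ZMod 2) → ℂ) (P : List (List (ZMod 2) × ℂ)) (n : ℕ) :
    (fun d : ℕ × List (ZMod 2) => (d.1 + 1, linBit G P d.1 :: d.2))^[n] (0, []) =
      (n, (linDec n G P).reverse) := by
  induction n with
  | zero => rfl
  | succ n ih => rw [Function.iterate_succ_apply', ih]; simp [linDec, List.range_succ]

theorem lin_spec (pg : Polynomial ℕ) : ∃ p, ∀ (o : Val → ℂ) Y Γ g ctx G n P,
    (∀ y Γ, y.length = n → Cp o g (.cons (bits y) ctx :: Γ) (.num (G y)) pg Y) → n ≤ Y →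
    P.length ≤ Y → (∀ x ∈ P, x.1.length = n) →
    Cp o (linT g) (.cons (Val.unary n) (.cons (ptsV P) ctx) :: Γ) (bits (linDec n G P)) p Y := by
  obtain ⟨p, hp⟩ := corr_spec pg
  obtain ⟨q, hq⟩ := rev_bits_spec
  apply Exists.intro
  intro o Y Γ g ctx G n P hg hn hP hx
  apply Cp.bind (Cp.on rfl (hp o Y _ g ctx G n P [] hg hn hP hx))
  apply Cp.bind
  · refine Cp.iter (fun d : ℕ × List (ZMod 2) => Val.cons (bits (unitL d.1)) (bits d.2))
      (fun d => (d.1 + 1, linBit G P d.1 :: d.2)) n (0, []) rfl ?_ hn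
      (fun d r => Cp.bind (Cp.on rfl (hp o Y _ g ctx G n P (unitL d.1) hg hn hP hx))
        (Cp.ite _ (truthy_ofBool _) (fun h => Cp.ex ?_) (fun h => Cp.ex ?_)))
    · simp [unitL, tt, bits, Val.ofList, bitV_one]
    · have h' : 0 ≤ (corr G P (unitL d.1) * star (corr G P [])).re := by
        simpa using h
      simp only [linBit, if_pos h']
      simp [unitL, List.replicate_succ, ← cons_bits, bitV_zero]
    · have h' : ¬ 0 ≤ (corr G P (unitL d.1) * star (corr G P [])).re := by
        simpa using h
      simp only [linBit, if_neg h']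
      simp [unitL, List.replicate_succ, ← cons_bits, bitV_zero, tt, bitV_one]
  · rw [iterate_linDec]
    have := hq o Y (Val.cons (bits (unitL n)) (bits (linDec n G P).reverse) ::
      .num (corr G P []) :: .cons (Val.unary n) (.cons (ptsV P) ctx) :: Γ)
      (linDec n G P).reverse (by simpa [linDec] using hn)
    rw [List.reverse_reverse] at this
    exact Cp.on (by simp) this

/-! ### Evaluation of truncated signals, derivatives and phases -/

/-- The signal `S`, with the values of absolute square above `T` replaced by `0`. -/
def trunc (S : List (ZMod 2) → ℂ) (T : ℂ) (y : List (ZMod 2)) : ℂ :=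
  open Classical in if (S y * star (S y)).re ≤ T.re then S y else 0

/-- The input consists of the bound and the position. -/
def truncT : Tm :=
  .bind (.qry (.tl (.var 0)))
    (.ite (.le (.mul (.var 0) (.conj (.var 0))) (.hd (.var 1))) (.ex (.var 0)) (.ex .zero))

theorem trunc_spec : ∃ p, ∀ (o : Val → ℂ) Y Γ T y,
    Cp o truncT (.cons (.num T) (bits y) :: Γ) (.num (trunc (fun y => o (bits y)) T y)) p Y := by
  apply Exists.intro
  intro o Y Γ T y
  refine Cp.bind (Cp.qry rfl) (Cp.ite _ (truthy_ofBool _) (fun h => Cp.ex ?_) (fun h => Cp.ex ?_))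
  · have h' : (o (bits y) * star (o (bits y))).re ≤ T.re := by simpa using h
    simp only [trunc, if_pos h']
    simp
  · have h' : ¬ (o (bits y) * star (o (bits y))).re ≤ T.re := by simpa using h
    simp only [trunc, if_neg h']
    simp

/-- The truncated signal in reversed coordinates. -/
def truncRevT : Tm :=
  .bind (revT.on (.tl (.var 0))) (truncT.on (.cons (.hd (.var 1)) (.var 0)))

theorem truncRev_spec : ∃ p, ∀ (o : Val → ℂ) Y Γ T y, y.length ≤ Y →
    Cp o truncRevT (.cons (.num T) (bits y) :: Γ)
      (.num (trunc (fun y => o (bits y)) T y.reverse)) p Y := by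
  obtain ⟨p, hp⟩ := trunc_spec
  obtain ⟨q, hq⟩ := rev_bits_spec
  apply Exists.intro
  intro o Y Γ T y hy
  exact Cp.bind (Cp.on rfl (hq o Y _ y hy)) (Cp.on rfl (hp o Y _ T _))

/-- The derivative of the function computed by `f` in the direction of a given vector. -/
def diffT (f : Tm) : Tm :=
  .bind (f.on (.cons (.hd (.tl (.var 0))) (.hd (.var 0))))
    (.bind (addT.on (.cons (.hd (.var 1)) (.tl (.tl (.var 1)))))
      (.bind (f.on (.cons (.hd (.tl (.var 2))) (.var 0)))
        (.ex (.mul (.var 2) (.conj (.var 0))))))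

theorem diff_spec (pf : Polynomial ℕ) : ∃ p, ∀ (o : Val → ℂ) Y Γ f (T : ℂ)
    (F : List (ZMod 2) → ℂ) y e,
    (∀ z Γ, z.length = y.length → Cp o f (.cons (.num T) (bits z) :: Γ) (.num (F z)) pf Y) →
    y.length ≤ Y →
    Cp o (diffT f) (.cons (bits y) (.cons (.num T) (bits e)) :: Γ)
      (.num (F y * star (F (addL y e)))) p Y := by
  obtain ⟨p, hp⟩ := add_spec
  apply Exists.intro
  intro o Y Γ f T F y e hf hy
  exact Cp.bind (Cp.on rfl (hf y _ rfl)) (Cp.bind (Cp.on rfl (hp o Y _ y e hy))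
    (Cp.bind (Cp.on rfl (hf (addL y e) _ (length_addL y e))) (Cp.ex rfl)))

/-- The number of `j` such that `y j = 1` and `p j = 1`. -/
def overlap (p y : List (ZMod 2)) : ℕ :=
  (y.foldl (fun d b => (d.1.tail,
    if b ≠ 0 then (if d.1.headD 0 ≠ 0 then d.2 + 1 else d.2) else d.2)) (p, 0)).2

/-- The value at `y` of the quadratic form of the Hankel matrix with reverse diagonals `p`,
computed over the integers. -/
def quadL (p y : List (ZMod 2)) : ℕ :=
  (y.foldl (fun d a => (d.1.tail, if a ≠ 0 then d.2 + overlap d.1 y else d.2)) (p, 0)).2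

theorem foldl_overlap (p y : List (ZMod 2)) (k : ℕ) :
    y.foldl (fun d b => (d.1.tail,
      if b ≠ 0 then (if d.1.headD 0 ≠ 0 then d.2 + 1 else d.2) else d.2)) (p, k) =
      (p.drop y.length, k + overlap p y) := by
  unfold overlap
  induction y generalizing p k with
  | nil => simp
  | cons a y ih =>
    simp only [List.foldl_cons]
    rw [ih, ih p.tail (if a ≠ 0 then (if p.headD 0 ≠ 0 then 0 + 1 else 0) else 0)]
    rw [List.length_cons, List.drop_tail]
    dsimp only
    congr 1
    split_ifs <;> omega

/-- The power of `i` whose exponent is the value of a quadratic form; the input consists of the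
reverse diagonals and the vector. -/
def quadT : Tm :=
  .bind (.fold (.tl (.var 0)) (.cons (.hd (.var 0)) .one)
    (.ite (.var 0)
      (.bind (.fold (.tl (.var 3)) (.var 1)
        (.ite (.var 0)
          (.ite (.hd (.hd (.var 1)))
            (.ex (.cons (.tl (.hd (.var 1))) (.mul .imag (.tl (.var 1)))))
            (.ex (.cons (.tl (.hd (.var 1))) (.tl (.var 1)))))
          (.ex (.cons (.tl (.hd (.var 1))) (.tl (.var 1))))))
        (.ex (.cons (.tl (.hd (.var 2))) (.tl (.var 0)))))
      (.ex (.cons (.tl (.hd (.var 1))) (.tl (.var 1))))))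
    (.ex (.tl (.var 0)))

theorem quad_spec : ∃ p, ∀ (o : Val → ℂ) Y Γ p' y, y.length ≤ Y →
    Cp o quadT (.cons (bits p') (bits y) :: Γ) (.num (Complex.I ^ quadL p' y)) p Y := by
  apply Exists.intro
  intro o Y Γ p' y hy
  set enc : List (ZMod 2) × ℕ → Val := fun d => .cons (bits d.1) (.num (Complex.I ^ d.2)) with henc
  apply Cp.bind
  · apply Cp.fold bitV enc
      (fun d a => (d.1.tail, if a ≠ 0 then d.2 + overlap d.1 y else d.2)) y (p', 0) rfl
      (by simp [henc]) hy
    intro a _ d r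
    refine Cp.ite (p := Polynomial.X * (1 + 1 + 1 + 1 + 1 + 7) + 7 + 1 + 3) _ (truthy_bitV a)
      (fun ha => Cp.bind (Cp.fold bitV enc
        (fun d b => (d.1.tail, if b ≠ 0 then (if d.1.headD 0 ≠ 0 then d.2 + 1 else d.2) else d.2))
        y d rfl rfl hy (fun b _ d' r' =>
          Cp.ite _ (truthy_bitV b)
            (fun hb => Cp.ite _ ((congrArg Val.truthy ?_).trans (truthy_bitV (d'.1.headD 0)))
              (fun h => Cp.ex ?_) (fun h => Cp.ex ?_))
            (fun hb => Cp.ex ?_))) (Cp.ex ?_))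
      (fun ha => Cp.ex ?_)
    · simp [henc]
    · simp only [decide_eq_true_eq] at hb h
      rw [if_pos hb, if_pos h]
      simp [henc, pow_succ']
    · simp only [decide_eq_true_eq] at hb
      simp only [decide_eq_false_iff_not] at h
      rw [if_pos hb, if_neg h]
      simp [henc]
    · simp only [decide_eq_false_iff_not] at hb
      rw [if_neg hb]
      simp [henc]
    · simp only [decide_eq_true_eq] at ha
      rw [if_pos ha, show d = (d.1, d.2) from rfl, foldl_overlap]
      simp [henc]
    · simp only [decide_eq_false_iff_not] at ha
      rw [if_neg ha]
      simp [henc]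
  · exact Cp.ex rfl

/-- The truncated signal times the conjugate of the codeword of a Hankel matrix. -/
def dephaseT : Tm :=
  .bind (truncT.on (.cons (.hd (.tl (.var 0))) (.hd (.var 0))))
    (.bind (quadT.on (.cons (.tl (.tl (.var 1))) (.hd (.var 1))))
      (.ex (.mul (.var 1) (.conj (.var 0)))))

theorem dephase_spec : ∃ p, ∀ (o : Val → ℂ) Y Γ (T : ℂ) p' y, y.length ≤ Y →
    Cp o dephaseT (.cons (bits y) (.cons (.num T) (bits p')) :: Γ)
      (.num (trunc (fun y => o (bits y)) T y * star (Complex.I ^ quadL p' y))) p Y := by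
  obtain ⟨p, hp⟩ := trunc_spec
  obtain ⟨q, hq⟩ := quad_spec
  apply Exists.intro
  intro o Y Γ T p' y hy
  exact Cp.bind (Cp.on rfl (hp o Y _ T y)) (Cp.bind (Cp.on rfl (hq o Y _ p' y hy)) (Cp.ex rfl))

/-! ### Solving the recurrence for the reverse diagonals -/

/-- Removes the leading zeros of `u`, and as many entries of `g`. -/
def strip (u g : List (ZMod 2)) : List (ZMod 2) × List (ZMod 2) :=
  u.foldl (fun d _ => if d.1.headD 0 ≠ 0 then d else (d.1.tail, d.2.tail)) (u, g)

/-- The input is the pair of the two lists. -/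
def stripT : Tm :=
  .fold (.hd (.var 0)) (.var 0)
    (.ite (.hd (.hd (.var 1))) (.ex (.var 1))
      (.ex (.cons (.tl (.hd (.var 1))) (.tl (.tl (.var 1))))))

theorem strip_spec : ∃ p, ∀ (o : Val → ℂ) Y Γ u g, u.length ≤ Y →
    Cp o stripT (.cons (bits u) (bits g) :: Γ)
      (.cons (bits (strip u g).1) (bits (strip u g).2)) p Y := by
  apply Exists.intro
  intro o Y Γ u g hu
  refine Cp.fold bitV
    (fun d : List (ZMod 2) × List (ZMod 2) => Val.cons (bits d.1) (bits d.2)) _ u (u, g) rfl rfl hu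
    fun a _ d r => Cp.ite _ ((congrArg Val.truthy ?_).trans (truthy_bitV (d.1.headD 0)))
      (fun h => Cp.ex ?_) (fun h => Cp.ex ?_)
  · simp
  · simp only [decide_eq_true_eq] at h
    rw [if_pos h]
    simp
  · simp only [decide_eq_false_iff_not] at h
    rw [if_neg h]
    simp

/-- The scalar product of two lists of bits. -/
def dotL : List (ZMod 2) → List (ZMod 2) → ZMod 2
  | [], _ => 0
  | a :: f, x => a * x.headD 0 + dotL f x.tail

theorem foldl_dotL (f x : List (ZMod 2)) (z : ZMod 2) :
    f.foldl (fun (d : List (ZMod 2) × ZMod 2) a =>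
      (d.1.tail, if a ≠ 0 then d.2 + d.1.headD 0 else d.2)) (x, z) =
      (x.drop f.length, z + dotL f x) := by
  induction f generalizing x z with
  | nil => simp [dotL]
  | cons a f ih =>
    rw [List.foldl_cons, ih]
    rw [List.length_cons, List.drop_tail, dotL]
    dsimp only
    congr 1
    rcases bit_cases a with rfl | rfl <;> simp [add_assoc]

/-- The input is the pair of the two lists. -/
def dotT : Tm :=
  .bind (.fold (.hd (.var 0)) (.cons (.tl (.var 0)) .nil)
    (.ite (.var 0)
      (.bind (xorT (.tl (.var 1)) (.hd (.hd (.var 1))))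
        (.ex (.cons (.tl (.hd (.var 2))) (.var 0))))
      (.ex (.cons (.tl (.hd (.var 1))) (.tl (.var 1))))))
    (.ex (.tl (.var 0)))

theorem dot_spec : ∃ p, ∀ (o : Val → ℂ) Y Γ f x, f.length ≤ Y →
    Cp o dotT (.cons (bits f) (bits x) :: Γ) (bitV (dotL f x)) p Y := by
  obtain ⟨p, hp⟩ := xor_spec
  apply Exists.intro
  intro o Y Γ f x hf
  apply Cp.bind
  · refine Cp.fold bitV (fun d : List (ZMod 2) × ZMod 2 => Val.cons (bits d.1) (bitV d.2))
      (fun d a => (d.1.tail, if a ≠ 0 then d.2 + d.1.headD 0 else d.2)) f (x, 0) rfl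
      (by simp [bitV_zero]) hf (fun a _ d r => Cp.ite _ (truthy_bitV a)
        (fun h => Cp.bind (hp o Y _ _ _ d.2 (d.1.headD 0) ?_ ?_) (Cp.ex ?_)) (fun h => Cp.ex ?_))
    · simp
    · simp
    · simp only [decide_eq_true_eq] at h
      rw [if_pos h]
      simp
    · simp only [decide_eq_false_iff_not] at h
      rw [if_neg h]
      simp
  · rw [foldl_dotL, zero_add]
    exact Cp.ex (by simp)

/-- The concatenation of a pair of lists. -/
def appendT : Tm :=
  .bind (revT.on (.hd (.var 0))) (.fold (.var 0) (.tl (.var 1)) (.ex (.cons (.var 0) (.var 1))))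

theorem append_spec : ∃ p, ∀ (o : Val → ℂ) Y Γ (x y : List Val), x.length ≤ Y →
    Cp o appendT (.cons (.ofList x) (.ofList y) :: Γ) (.ofList (x ++ y)) p Y := by
  obtain ⟨p, hp⟩ := rev_spec
  apply Exists.intro
  intro o Y Γ x y hx
  apply Cp.bind (Cp.on rfl (hp o Y _ x hx))
  have h : ∀ x : List Val, x ++ y = x.reverse.foldl (fun d a => a :: d) y := by
    intro x
    rw [List.foldl_reverse]
    induction x with
    | nil => rfl
    | cons a x ih => rw [List.cons_append, ih, List.foldr_cons]
  rw [h]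
  exact Cp.fold id Val.ofList (fun d a => a :: d) x.reverse y (by simp) rfl (by simpa using hx)
    fun a _ d r => Cp.ex rfl

/-- The solution of the recurrence `x_j = r_j + ∑ i, f_i x_{j-1-i}`, where `r` is `g` (without the
entries that belong to the leading zeros of `u`) followed by `c`, and `f` consists of the entries
of `u` behind its leading coefficient. The last of the `n` bits comes first. -/
def solve (n : ℕ) (u g c : List (ZMod 2)) : List (ZMod 2) :=
  ((fun d : List (ZMod 2) × List (ZMod 2) =>
    (d.1.tail, (d.1.headD 0 + dotL (strip u g).1.tail d.2) :: d.2))^[n]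
    ((strip u g).2.tail ++ c, [])).2

/-- The input consists of `n` in unary, the pair of `u` and `g`, and `c`. -/
def solveT : Tm :=
  .bind (stripT.on (.hd (.tl (.var 0))))
    (.bind (appendT.on (.cons (.tl (.tl (.var 0))) (.tl (.tl (.var 1)))))
      (.bind (.fold (.hd (.var 2)) (.cons (.var 0) .nil)
        (.bind (dotT.on (.cons (.tl (.hd (.var 4))) (.tl (.var 1))))
          (.bind (xorT (.hd (.hd (.var 2))) (.var 0))
            (.ex (.cons (.tl (.hd (.var 3))) (.cons (.var 0) (.tl (.var 3))))))))
        (.ex (.tl (.var 0)))))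

theorem length_strip (u g : List (ZMod 2)) :
    (strip u g).1.length ≤ u.length ∧ (strip u g).2.length ≤ g.length := by
  have : ∀ (l : List (ZMod 2)) (d : List (ZMod 2) × List (ZMod 2)),
      (l.foldl (fun d _ => if d.1.headD 0 ≠ 0 then d else (d.1.tail, d.2.tail)) d).1.length
        ≤ d.1.length ∧
      (l.foldl (fun d _ => if d.1.headD 0 ≠ 0 then d else (d.1.tail, d.2.tail)) d).2.length
        ≤ d.2.length := by
    intro l
    induction l with
    | nil => simp
    | cons a l ih =>
      intro d
      rw [List.foldl_cons]
      refine ⟨(ih _).1.trans ?_, (ih _).2.trans ?_⟩ <;> split_ifs <;> simp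
  exact this u (u, g)

theorem solve_spec : ∃ p, ∀ (o : Val → ℂ) Y Γ n u g c, u.length ≤ Y → g.length ≤ Y → n ≤ Y →
    Cp o solveT (.cons (Val.unary n) (.cons (.cons (bits u) (bits g)) (bits c)) :: Γ)
      (bits (solve n u g c)) p Y := by
  obtain ⟨p₁, h₁⟩ := strip_spec
  obtain ⟨p₂, h₂⟩ := append_spec
  obtain ⟨p₃, h₃⟩ := dot_spec
  obtain ⟨p₄, h₄⟩ := xor_spec
  apply Exists.intro
  intro o Y Γ n u g c hu hg hn
  apply Cp.bind (Cp.on rfl (h₁ o Y _ u g hu))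
  apply Cp.bind (Cp.on (by simp; exact ⟨by rw [← List.map_tail]; rfl, rfl⟩)
    (h₂ o Y _ ((strip u g).2.tail.map bitV) (c.map bitV)
      (by have := (length_strip u g).2; simp; omega)))
  apply Cp.bind
  · refine Cp.iter (fun d : List (ZMod 2) × List (ZMod 2) => Val.cons (bits d.1) (bits d.2))
      (fun d => (d.1.tail, (d.1.headD 0 + dotL (strip u g).1.tail d.2) :: d.2)) n
      ((strip u g).2.tail ++ c, []) rfl ?_ hn
      (fun d r => Cp.bind (Cp.on rfl (v := bitV (dotL (strip u g).1.tail d.2)) (p := p₃) ?_)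
      (Cp.bind (h₄ o Y _ _ _ (d.1.headD 0) (dotL (strip u g).1.tail d.2) ?_ ?_) (Cp.ex ?_)))
    · simp [bits, Val.ofList]
    · have := h₃ o Y (Val.nil :: Val.cons (bits d.1) (bits d.2) :: r ::
        .ofList ((strip u g).2.tail.map bitV ++ c.map bitV) ::
        .cons (bits (strip u g).1) (bits (strip u g).2) ::
        .cons (Val.unary n) (.cons (.cons (bits u) (bits g)) (bits c)) :: Γ)
        (strip u g).1.tail d.2 (by have := (length_strip u g).1; simp; omega)
      rw [← tl_bits] at this
      exact this
    · simp
    · simp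
    · simp [cons_bits]
  · exact Cp.ex rfl

/-! ### One round of the algorithm -/

/-- The last `n` reverse diagonals of a Hankel matrix or the first `n` of them, in decreasing
order, recovered from the signal `F`, the sample points and the guesses. -/
def recover (n : ℕ) (F : List (ZMod 2) → ℂ) (w : List (ZMod 2)) (vs : List (List (ZMod 2)))
    (u g b : List (ZMod 2)) : List (ZMod 2) :=
  solve n u g (linDec n (fun y => F y * star (F (addL y u.reverse))) (points w vs b))

/-- The term `f` computes `F` from a bound for the truncation and a position. The input consists
of `n` in unary, the bound, the pair of the base point and the spanning vectors, the pair of `u`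
and `g`, and `b`. -/
def recoverT (f : Tm) : Tm :=
  .bind (revT.on (.hd (.hd (.tl (.tl (.tl (.var 0)))))))
    (.bind (pointsT.on (.cons (.hd (.hd (.tl (.tl (.var 1)))))
        (.cons (.tl (.hd (.tl (.tl (.var 1))))) (.tl (.tl (.tl (.tl (.var 1))))))))
      (.bind ((linT (diffT f)).on
          (.cons (.hd (.var 2)) (.cons (.var 0) (.cons (.hd (.tl (.var 2))) (.var 1)))))
        (solveT.on (.cons (.hd (.var 3)) (.cons (.hd (.tl (.tl (.tl (.var 3))))) (.var 0))))))

theorem recover_spec (pf : Polynomial ℕ) : ∃ p, ∀ (o : Val → ℂ) Y Γ f (T : ℂ)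
    (F : List (ZMod 2) → ℂ) n w (vs : List (List (ZMod 2))) u g b,
    (∀ z Γ, z.length = n → Cp o f (.cons (.num T) (bits z) :: Γ) (.num (F z)) pf Y) →
    n ≤ Y → w.length = n → vs.length ≤ Y → 2 ^ vs.length ≤ Y → u.length ≤ Y → g.length ≤ Y →
    Cp o (recoverT f) (.cons (Val.unary n) (.cons (.num T) (.cons (.cons (bits w)
      (.ofList (vs.map bits))) (.cons (.cons (bits u) (bits g)) (bits b)))) :: Γ)
      (bits (recover n F w vs u g b)) p Y := by
  obtain ⟨p₁, h₁⟩ := rev_bits_spec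
  obtain ⟨p₂, h₂⟩ := points_spec
  obtain ⟨p₃, h₃⟩ := diff_spec pf
  obtain ⟨p₄, h₄⟩ := lin_spec p₃
  obtain ⟨p₅, h₅⟩ := solve_spec
  apply Exists.intro
  intro o Y Γ f T F n w vs u g b hf hn hw hvs hY hu hg
  exact Cp.bind (Cp.on rfl (h₁ o Y _ u hu)) (Cp.bind
    (Cp.on rfl (h₂ o Y _ w vs b (by omega) hvs hY)) (Cp.bind
    (Cp.on rfl (h₄ o Y _ (diffT f) (.cons (.num T) (bits u.reverse)) _ n (points w vs b)
      (fun y Γ hy => h₃ o Y Γ f T F y u.reverse (fun z Γ hz => hf z Γ (hz.trans hy)) (by omega))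
      hn (by rw [length_points]; exact hY)
      (fun x hx => (mem_points_length w vs b x hx).trans hw)))
    (Cp.on rfl (h₅ o Y _ n u g _ hu hg hn))))

/-- The random bits that one round uses: a sample point `y₀` for the truncation, the points that
span the affine subspace of sample points, and guesses. -/
structure Seed where
  y₀ : List (ZMod 2)
  w : List (ZMod 2)
  vs : List (List (ZMod 2))
  u₁ : List (ZMod 2)
  g₁ : List (ZMod 2)
  u₂ : List (ZMod 2)
  g₂ : List (ZMod 2)
  b₁ : List (ZMod 2)
  b₂ : List (ZMod 2)
  b₃ : List (ZMod 2)

/-- A seed as a value. -/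
def Seed.toVal (x : Seed) : Val :=
  .cons (bits x.y₀) (.cons (bits x.w) (.cons (.ofList (x.vs.map bits)) (.cons (bits x.u₁)
    (.cons (bits x.g₁) (.cons (bits x.u₂) (.cons (bits x.g₂) (.cons (bits x.b₁)
    (.cons (bits x.b₂) (bits x.b₃)))))))))

/-- The label `(p, ℓ)` that one round suggests; `p` lists the reverse diagonals. -/
def candidate (n : ℕ) (t : ℂ) (S : List (ZMod 2) → ℂ) (x : Seed) :
    List (ZMod 2) × List (ZMod 2) :=
  let F := trunc S (t * (S x.y₀ * star (S x.y₀)))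
  let p := (recover n F x.w x.vs x.u₁ x.g₁ x.b₁).tail.reverse ++
    recover n (fun y => F y.reverse) x.w x.vs x.u₂ x.g₂ x.b₂
  (p, linDec n (fun y => F y * star (Complex.I ^ quadL p y)) (points x.w x.vs x.b₃))

/-- The part of the seed from component `k` on, if the seed is the second component of variable
`i`. -/
def seedE (i : ℕ) : ℕ → Expr
  | 0 => .tl (.var i)
  | k + 1 => .tl (seedE i k)

/-- The input consists of the pair of `n` in unary and the factor for the truncation, and a seed.
-/
def candidateT : Tm :=
  .bind (.qry (.hd (seedE 0 0)))
    (.bind (.ex (.mul (.tl (.hd (.var 1))) (.mul (.var 0) (.conj (.var 0)))))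
    (.bind ((recoverT truncT).on (.cons (.hd (.hd (.var 2))) (.cons (.var 0) (.cons
      (.cons (.hd (seedE 2 1)) (.hd (seedE 2 2)))
      (.cons (.cons (.hd (seedE 2 3)) (.hd (seedE 2 4))) (.hd (seedE 2 7)))))))
    (.bind ((recoverT truncRevT).on (.cons (.hd (.hd (.var 3))) (.cons (.var 1) (.cons
      (.cons (.hd (seedE 3 1)) (.hd (seedE 3 2)))
      (.cons (.cons (.hd (seedE 3 5)) (.hd (seedE 3 6))) (.hd (seedE 3 8)))))))
    (.bind (.fold (.tl (.var 1)) (.var 0) (.ex (.cons (.var 0) (.var 1))))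
    (.bind (pointsT.on (.cons (.hd (seedE 5 1)) (.cons (.hd (seedE 5 2)) (seedE 5 9))))
    (.bind ((linT dephaseT).on (.cons (.hd (.hd (.var 6))) (.cons (.var 0)
      (.cons (.var 4) (.var 1)))))
    (.ex (.cons (.var 2) (.var 0)))))))))

theorem length_recover (n : ℕ) (F : List (ZMod 2) → ℂ) (w : List (ZMod 2))
    (vs : List (List (ZMod 2))) (u g b : List (ZMod 2)) :
    (recover n F w vs u g b).length = n := by
  have : ∀ (f : List (ZMod 2)) (m : ℕ) (d : List (ZMod 2) × List (ZMod 2)),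
      ((fun d : List (ZMod 2) × List (ZMod 2) =>
        (d.1.tail, (d.1.headD 0 + dotL f d.2) :: d.2))^[m] d).2.length = m + d.2.length := by
    intro f m
    induction m with
    | zero => simp
    | succ m ih => intro d; rw [Function.iterate_succ_apply, ih]; simp; omega
  exact (this _ n _).trans (by simp)

theorem candidate_spec : ∃ p, ∀ (o : Val → ℂ) Y Γ n (t : ℂ) (x : Seed),
    n ≤ Y → x.w.length = n → x.vs.length ≤ Y → 2 ^ x.vs.length ≤ Y →
    x.u₁.length ≤ Y → x.g₁.length ≤ Y → x.u₂.length ≤ Y → x.g₂.length ≤ Y →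
    Cp o candidateT (.cons (.cons (Val.unary n) (.num t)) x.toVal :: Γ)
      (.cons (bits (candidate n t (fun y => o (bits y)) x).1)
        (bits (candidate n t (fun y => o (bits y)) x).2)) p Y := by
  obtain ⟨p₁, h₁⟩ := trunc_spec
  obtain ⟨p₂, h₂⟩ := truncRev_spec
  obtain ⟨p₃, h₃⟩ := recover_spec p₁
  obtain ⟨p₄, h₄⟩ := recover_spec p₂
  obtain ⟨p₅, h₅⟩ := points_spec
  obtain ⟨p₆, h₆⟩ := dephase_spec
  obtain ⟨p₇, h₇⟩ := lin_spec p₆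
  apply Exists.intro
  intro o Y Γ n t x hn hw hvs hY hu₁ hg₁ hu₂ hg₂
  set S : List (ZMod 2) → ℂ := fun y => o (bits y) with hS
  set T := t * (S x.y₀ * star (S x.y₀)) with hT
  set ps₁ := recover n (trunc S T) x.w x.vs x.u₁ x.g₁ x.b₁ with hps₁
  set ps₂ := recover n (fun y => trunc S T y.reverse) x.w x.vs x.u₂ x.g₂ x.b₂ with hps₂
  have l₁ : ps₁.length = n := length_recover _ _ _ _ _ _ _
  have hp : ps₁.tail.foldl (fun d a => a :: d) ps₂ = ps₁.tail.reverse ++ ps₂ := by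
    generalize ps₁.tail = l
    generalize ps₂ = r
    induction l generalizing r with
    | nil => rfl
    | cons a l ih => simp [ih]
  refine Cp.bind (Cp.qry rfl) (Cp.bind (Cp.ex rfl) (Cp.bind
    (Cp.on rfl (h₃ o Y _ truncT T (trunc S T) n x.w x.vs x.u₁ x.g₁ x.b₁
      (fun z Γ _ => h₁ o Y Γ T z) hn hw hvs hY hu₁ hg₁))
    (Cp.bind
    (Cp.on rfl (h₄ o Y _ truncRevT T (fun y => trunc S T y.reverse) n x.w x.vs x.u₂ x.g₂ x.b₂
      (fun z Γ hz => h₂ o Y Γ T z (by omega)) hn hw hvs hY hu₂ hg₂))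
    (Cp.bind (v := bits (ps₁.tail.reverse ++ ps₂)) (p := Polynomial.X * (1 + 7) + 7) ?_
    (Cp.bind (Cp.on rfl (h₅ o Y _ x.w x.vs x.b₃ (by omega) hvs hY)) (Cp.bind
    (Cp.on rfl (h₇ o Y _ dephaseT (.cons (.num T) (bits (ps₁.tail.reverse ++ ps₂))) _ n
      (points x.w x.vs x.b₃) (fun y Γ hy => h₆ o Y Γ T _ y (by omega))
      hn (by rw [length_points]; exact hY)
      (fun z hz => (mem_points_length _ _ _ z hz).trans hw)))
    (Cp.ex rfl)))))))
  rw [← hp]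
  exact Cp.fold bitV bits (fun d a => a :: d) ps₁.tail ps₂
    (by simp; rw [← List.map_tail]; rfl) rfl (by simp; omega) fun a _ d r => Cp.ex rfl

/-! ### Arithmetic of unary numbers -/

/-- The unary number `m` as an expression. -/
def litE : ℕ → Expr
  | 0 => .nil
  | m + 1 => .cons .nil (litE m)

@[simp] theorem eval_litE (σ : Store) (m : ℕ) : (litE m).eval σ = Val.unary m := by
  induction m with
  | zero => rfl
  | succ m ih => simp [litE, Val.unary, ih]

/-- The sum of two unary numbers. -/
def uaddT : Tm := .fold (.hd (.var 0)) (.tl (.var 0)) (.ex (.cons .nil (.var 1)))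

theorem uadd_spec : ∃ p, ∀ (o : Val → ℂ) Y Γ x y, x ≤ Y →
    Cp o uaddT (.cons (Val.unary x) (Val.unary y) :: Γ) (Val.unary (x + y)) p Y := by
  apply Exists.intro
  intro o Y Γ x y hx
  have h : x + y = Nat.succ^[x] y := by rw [Nat.succ_iterate, add_comm]
  rw [h]
  exact Cp.iter Val.unary Nat.succ x y rfl rfl hx fun d r => Cp.ex rfl

/-- The product of two unary numbers. -/
def umulT : Tm := .fold (.hd (.var 0)) .nil (uaddT.on (.cons (.tl (.var 3)) (.var 1)))

theorem umul_spec : ∃ p, ∀ (o : Val → ℂ) Y Γ x y, x ≤ Y → y ≤ Y →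
    Cp o umulT (.cons (Val.unary x) (Val.unary y) :: Γ) (Val.unary (x * y)) p Y := by
  obtain ⟨p, hp⟩ := uadd_spec
  apply Exists.intro
  intro o Y Γ x y hx hy
  have h : x * y = (fun z => y + z)^[x] 0 := by
    rw [add_left_iterate]; simp
  rw [h]
  exact Cp.iter Val.unary (fun z => y + z) x 0 rfl rfl hx fun d r =>
    Cp.on rfl (hp o Y _ y d hy)

/-- The power of two with a unary exponent. -/
def upowT : Tm := .fold (.var 0) (litE 1) (uaddT.on (.cons (.var 1) (.var 1)))

theorem upow_spec : ∃ p, ∀ (o : Val → ℂ) Y Γ x, 2 ^ x ≤ Y →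
    Cp o upowT (Val.unary x :: Γ) (Val.unary (2 ^ x)) p Y := by
  obtain ⟨p, hp⟩ := uadd_spec
  apply Exists.intro
  intro o Y Γ x hx
  have h : ∀ x : ℕ, 2 ^ x = (fun z => z + z)^[x] 1 := by
    intro x
    induction x with
    | zero => rfl
    | succ x ih => rw [Function.iterate_succ_apply', ← ih]; ring
  rw [h]
  exact Cp.iterI Val.unary (fun z => z + z) (fun m d => d * 2 ^ m ≤ Y) x 1 rfl rfl
    (Nat.lt_two_pow_self.le.trans hx) (by simpa using hx)
    (fun m d r hd => Cp.on rfl (hp o Y _ d d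
      ((Nat.le_mul_of_pos_right d (by positivity)).trans hd)))
    (fun m d hd => by rw [pow_succ] at hd; linarith)

/-- The least number `L` with `M ≤ 2 ^ L`. -/
def ulogT : Tm :=
  .bind (.fold (.var 0) .zero (.ex (.add (.var 1) .one)))
    (.bind (.fold (.var 1) (.cons .one .nil)
      (.ite (.le (.var 3) (.hd (.var 1))) (.ex (.var 1))
        (.ex (.cons (.add (.hd (.var 1)) (.hd (.var 1))) (.cons .nil (.tl (.var 1)))))))
      (.ex (.tl (.var 0))))

theorem iterate_clog (M m : ℕ) :
    (fun j => if M ≤ 2 ^ j then j else j + 1)^[m] 0 = min m (Nat.clog 2 M) := by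
  induction m with
  | zero => simp
  | succ m ih =>
    rw [Function.iterate_succ_apply', ih]
    by_cases h : Nat.clog 2 M ≤ m
    · rw [min_eq_right h, min_eq_right (by omega), if_pos (Nat.le_pow_clog (by norm_num) M)]
    · have h' : ¬ M ≤ 2 ^ m := by rwa [← Nat.clog_le_iff_le_pow (by norm_num)]
      rw [min_eq_left (by omega), min_eq_left (by omega), if_neg h']

theorem ulog_spec : ∃ p, ∀ (o : Val → ℂ) Y Γ M, M ≤ Y →
    Cp o ulogT (Val.unary M :: Γ) (Val.unary (Nat.clog 2 M)) p Y := by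
  apply Exists.intro
  intro o Y Γ M hM
  have h₁ : ∀ m : ℕ, (fun z : ℂ => z + 1)^[m] 0 = m := by
    intro m; rw [add_right_iterate]; simp
  have h₂ := iterate_clog M M
  rw [min_eq_right (Nat.clog_le_of_le_pow Nat.lt_two_pow_self.le)] at h₂
  apply Cp.bind (Cp.iter Val.num (fun z => z + 1) M 0 rfl rfl hM fun d r => Cp.ex rfl)
  rw [h₁]
  apply Cp.bind
  · refine Cp.iter (fun j : ℕ => Val.cons (.num (2 ^ j)) (Val.unary j))
      (fun j => if M ≤ 2 ^ j then j else j + 1) M 0 rfl (by simp; rfl) hM fun d r =>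
      Cp.ite _ (truthy_ofBool _) (fun h => Cp.ex ?_) (fun h => Cp.ex ?_)
    · have h' : M ≤ 2 ^ d := by
        rw [← Nat.cast_le (α := ℝ)]; simpa [← Complex.ofReal_ofNat, ← Complex.ofReal_pow] using h
      rw [if_pos h']; simp
    · have h' : ¬ M ≤ 2 ^ d := by
        rw [← Nat.cast_le (α := ℝ)]; simpa [← Complex.ofReal_ofNat, ← Complex.ofReal_pow] using h
      rw [if_neg h']; simp [pow_succ, mul_two, Val.unary]
  · rw [h₂]
    exact Cp.ex rfl

/-! ### The whole algorithm -/

/-- The number of bits of each of the guesses, and also the number of vectors that span the affine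
subspace of sample points. Its power of two is at least `2 ^ 29 * (κ * n) ^ 9`, which is enough for
the second moment bound on the samples, and it is at most polynomial in `κ * n`. -/
def guessLen (n κ : ℕ) : ℕ := 9 * Nat.clog 2 (κ * n) + 29

/-- The number of random bits of a round: `guessLen n κ + 2` vectors of length `n` and seven
guesses. -/
def roundLen (n κ : ℕ) : ℕ := (guessLen n κ + 2) * n + 7 * guessLen n κ

/-- The number of rounds. A round finds a given heavy codeword with probability at least
`1 / (κ * 2 ^ (7 * guessLen n κ + 4))`, so in all rounds it is missed with probability at most
`exp (-(c + 2) * n ^ 2)`. -/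
def rounds (c n κ : ℕ) : ℕ := 2 ^ (7 * guessLen n κ + 4) * ((c + 2) * (n * (κ * n)))

/-- From the pair of `n` and `κ`, the numbers `guessLen`, `roundLen` and `rounds`. -/
def sizesT (c : ℕ) : Tm :=
  .bind (umulT.on (.cons (.tl (.var 0)) (.hd (.var 0))))
  (.bind (ulogT.on (.var 0))
  (.bind (umulT.on (.cons (litE 9) (.var 0)))
  (.bind (uaddT.on (.cons (.var 0) (litE 29)))
  (.bind (uaddT.on (.cons (.var 0) (litE 2)))
  (.bind (umulT.on (.cons (.var 0) (.hd (.var 5))))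
  (.bind (umulT.on (.cons (litE 7) (.var 2)))
  (.bind (uaddT.on (.cons (.var 1) (.var 0)))
  (.bind (uaddT.on (.cons (.var 1) (litE 4)))
  (.bind (upowT.on (.var 0))
  (.bind (umulT.on (.cons (.hd (.var 10)) (.var 9)))
  (.bind (umulT.on (.cons (litE (c + 2)) (.var 0)))
  (.bind (umulT.on (.cons (.var 2) (.var 0)))
    (.ex (.cons (.var 9) (.cons (.var 5) (.var 0))))))))))))))))

theorem sizes_bounds {c n κ Y : ℕ} (hn : 1 ≤ n) (hκ : 1 ≤ κ)
    (hY : rounds c n κ * roundLen n κ ≤ Y) :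
    rounds c n κ ≤ Y ∧ roundLen n κ ≤ Y ∧ 2 ^ (7 * guessLen n κ + 4) ≤ Y ∧
      (c + 2) * (n * (κ * n)) ≤ Y := by
  have hM : 1 ≤ (c + 2) * (n * (κ * n)) := Nat.mul_pos (by omega) (by positivity)
  have hP : 1 ≤ 2 ^ (7 * guessLen n κ + 4) := Nat.one_le_two_pow
  have hR : 1 ≤ rounds c n κ := Nat.mul_pos hP hM
  have hB : 1 ≤ roundLen n κ := by unfold roundLen guessLen; omega
  have h₁ : rounds c n κ ≤ Y := (Nat.le_mul_of_pos_right _ hB).trans hY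
  exact ⟨h₁, (Nat.le_mul_of_pos_left _ hR).trans hY, (Nat.le_mul_of_pos_right _ hM).trans h₁,
    (Nat.le_mul_of_pos_left _ hP).trans h₁⟩

theorem sizes_spec (c : ℕ) : ∃ p, ∀ (o : Val → ℂ) Y Γ n κ, 1 ≤ n → 1 ≤ κ →
    rounds c n κ * roundLen n κ ≤ Y →
    Cp o (sizesT c) (.cons (Val.unary n) (Val.unary κ) :: Γ)
      (.cons (Val.unary (guessLen n κ)) (.cons (Val.unary (roundLen n κ))
        (Val.unary (rounds c n κ)))) p Y := by
  obtain ⟨pa, ha⟩ := uadd_spec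
  obtain ⟨pm, hm⟩ := umul_spec
  obtain ⟨pp, hp⟩ := upow_spec
  obtain ⟨pl, hl⟩ := ulog_spec
  apply Exists.intro
  intro o Y Γ n κ hn hκ hY
  obtain ⟨y₁, y₂, y₃, y₄⟩ := sizes_bounds hn hκ hY
  have z₁ : 7 * guessLen n κ + 4 ≤ Y := Nat.lt_two_pow_self.le.trans y₃
  have z₂ : n * (κ * n) ≤ Y := (Nat.le_mul_of_pos_left _ (by omega)).trans y₄
  have z₃ : κ * n ≤ Y := (Nat.le_mul_of_pos_left _ (by omega)).trans z₂
  have z₄ : κ ≤ Y := (Nat.le_mul_of_pos_right _ (by omega)).trans z₃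
  have z₅ : n ≤ Y := (Nat.le_mul_of_pos_left _ (by omega)).trans z₃
  have z₆ : c + 2 ≤ Y := (Nat.le_mul_of_pos_right _ (by positivity)).trans y₄
  have z₇ : guessLen n κ = 9 * Nat.clog 2 (κ * n) + 29 := rfl
  have z₈ : roundLen n κ = (guessLen n κ + 2) * n + 7 * guessLen n κ := rfl
  exact Cp.bind (Cp.on rfl (hm o Y _ κ n z₄ z₅))
    (Cp.bind (Cp.on rfl (hl o Y _ (κ * n) z₃))
    (Cp.bind (Cp.on (by simp) (hm o Y _ 9 (Nat.clog 2 (κ * n)) (by omega) (by omega)))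
    (Cp.bind (Cp.on (by simp) (ha o Y _ (9 * Nat.clog 2 (κ * n)) 29 (by omega)))
    (Cp.bind (Cp.on (by simp; rfl) (ha o Y _ (guessLen n κ) 2 (by omega)))
    (Cp.bind (Cp.on rfl (hm o Y _ (guessLen n κ + 2) n (by omega) z₅))
    (Cp.bind (Cp.on (by simp; rfl) (hm o Y _ 7 (guessLen n κ) (by omega) (by omega)))
    (Cp.bind (Cp.on rfl (ha o Y _ ((guessLen n κ + 2) * n) (7 * guessLen n κ) (by omega)))
    (Cp.bind (Cp.on (by simp) (ha o Y _ (7 * guessLen n κ) 4 (by omega)))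
    (Cp.bind (Cp.on rfl (hp o Y _ (7 * guessLen n κ + 4) y₃))
    (Cp.bind (Cp.on rfl (hm o Y _ n (κ * n) z₅ z₃))
    (Cp.bind (Cp.on (by simp) (hm o Y _ (c + 2) (n * (κ * n)) z₆ z₂))
    (Cp.bind (Cp.on (by simp) (hm o Y _ (2 ^ (7 * guessLen n κ + 4))
      ((c + 2) * (n * (κ * n))) y₃ y₄))
    (Cp.ex rfl)))))))))))))

/-- Splits a list into `q` pieces of length `n`. -/
def chunks (n : ℕ) : ℕ → List (ZMod 2) → List (List (ZMod 2))
  | 0, _ => []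
  | q + 1, l => l.take n :: chunks n q (l.drop n)

theorem length_chunks (n q : ℕ) (l : List (ZMod 2)) : (chunks n q l).length = q := by
  induction q generalizing l with
  | zero => rfl
  | succ q ih => simp [chunks, ih]

/-- The input consists of the pair of `n` and `q` in unary, and a list. The output is the pair of
the rest of the list and the list of pieces. -/
def chunksT : Tm :=
  .bind (.fold (.tl (.hd (.var 0))) (.cons (.tl (.var 0)) .nil)
    (.bind (popT.on (.cons (.hd (.hd (.var 3))) (.hd (.var 1))))
      (.ex (.cons (.hd (.var 0)) (.cons (.tl (.var 0)) (.tl (.var 2)))))))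
    (.bind (revT.on (.tl (.var 0))) (.ex (.cons (.hd (.var 1)) (.var 0))))

theorem iterate_chunks (n q : ℕ) (l : List (ZMod 2)) (r : List (List (ZMod 2))) :
    (fun d : List (ZMod 2) × List (List (ZMod 2)) => (d.1.drop n, d.1.take n :: d.2))^[q] (l, r) =
      (l.drop (q * n), (chunks n q l).reverse ++ r) := by
  induction q generalizing l r with
  | zero => simp [chunks]
  | succ q ih =>
    rw [Function.iterate_succ_apply, ih]
    simp [chunks, add_mul, add_comm]

theorem chunks_spec : ∃ p, ∀ (o : Val → ℂ) Y Γ n q l, n ≤ Y → q ≤ Y → q * n ≤ l.length →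
    Cp o chunksT (.cons (.cons (Val.unary n) (Val.unary q)) (bits l) :: Γ)
      (.cons (bits (l.drop (q * n))) (.ofList ((chunks n q l).map bits))) p Y := by
  obtain ⟨p, hp⟩ := pop_spec
  obtain ⟨p', hp'⟩ := rev_spec
  apply Exists.intro
  intro o Y Γ n q l hn hq hl
  apply Cp.bind
  · exact Cp.iterI (fun d : List (ZMod 2) × List (List (ZMod 2)) =>
      Val.cons (bits d.1) (.ofList (d.2.map bits)))
      (fun d => (d.1.drop n, d.1.take n :: d.2)) (fun m d => m * n ≤ d.1.length) q (l, [])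
      rfl rfl hq hl
      (fun m d r hd => Cp.bind (Cp.on rfl (hp o Y _ n d.1 (by nlinarith) hn)) (Cp.ex rfl))
      (fun m d hd => by rw [add_mul] at hd; simp; omega)
  · rw [iterate_chunks]
    have h := hp' o Y (Val.cons (bits (l.drop (q * n)))
      (.ofList (((chunks n q l).reverse ++ []).map bits)) ::
      .cons (.cons (Val.unary n) (Val.unary q)) (bits l) :: Γ)
      ((chunks n q l).map bits).reverse (by simpa [length_chunks] using hq)
    rw [List.reverse_reverse] at h
    exact Cp.bind (Cp.on (by simp) h) (Cp.ex rfl)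

/-- The seed that is read off from a list of random bits; `D` is the length of the guesses. -/
def Seed.parse (n D : ℕ) (l : List (ZMod 2)) : Seed :=
  let r := ((l.drop n).drop n).drop (D * n)
  { y₀ := l.take n
    w := (l.drop n).take n
    vs := chunks n D ((l.drop n).drop n)
    u₁ := r.take D
    g₁ := (r.drop D).take D
    u₂ := ((r.drop D).drop D).take D
    g₂ := (((r.drop D).drop D).drop D).take D
    b₁ := ((((r.drop D).drop D).drop D).drop D).take D
    b₂ := (((((r.drop D).drop D).drop D).drop D).drop D).take D
    b₃ := ((((((r.drop D).drop D).drop D).drop D).drop D).drop D).take D }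

/-- Reads a seed; the input consists of `n`, `D` and a list of random bits. -/
def parseT : Tm :=
  .bind (popT.on (.cons (.hd (.hd (.var 0))) (.tl (.var 0))))
  (.bind (popT.on (.cons (.hd (.hd (.var 1))) (.hd (.var 0))))
  (.bind (chunksT.on (.cons (.hd (.var 2)) (.hd (.var 0))))
  (.bind (popT.on (.cons (.tl (.hd (.var 3))) (.hd (.var 0))))
  (.bind (popT.on (.cons (.tl (.hd (.var 4))) (.hd (.var 0))))
  (.bind (popT.on (.cons (.tl (.hd (.var 5))) (.hd (.var 0))))
  (.bind (popT.on (.cons (.tl (.hd (.var 6))) (.hd (.var 0))))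
  (.bind (popT.on (.cons (.tl (.hd (.var 7))) (.hd (.var 0))))
  (.bind (popT.on (.cons (.tl (.hd (.var 8))) (.hd (.var 0))))
  (.bind (popT.on (.cons (.tl (.hd (.var 9))) (.hd (.var 0))))
    (.ex (.cons (.hd (.var 0)) (.cons (.tl (.var 9)) (.cons (.tl (.var 8)) (.cons (.tl (.var 7))
      (.cons (.tl (.var 6)) (.cons (.tl (.var 5)) (.cons (.tl (.var 4)) (.cons (.tl (.var 3))
      (.cons (.tl (.var 2)) (.cons (.tl (.var 1)) (.tl (.var 0))))))))))))))))))))))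

theorem parse_spec : ∃ p, ∀ (o : Val → ℂ) Y Γ n D l, n ≤ Y → D ≤ Y →
    (D + 2) * n + 7 * D ≤ l.length →
    Cp o parseT (.cons (.cons (Val.unary n) (Val.unary D)) (bits l) :: Γ)
      (.cons (bits (l.drop ((D + 2) * n + 7 * D))) (Seed.parse n D l).toVal) p Y := by
  obtain ⟨p, h⟩ := pop_spec
  obtain ⟨q, hq⟩ := chunks_spec
  apply Exists.intro
  intro o Y Γ n D l hn hD hl
  rw [add_mul] at hl
  refine Cp.bind (Cp.on rfl (h o Y _ n l (by omega) hn))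
    (Cp.bind (Cp.on rfl (h o Y _ n (l.drop n) (by simp; omega) hn))
    (Cp.bind (Cp.on rfl (hq o Y _ n D ((l.drop n).drop n) hn hD (by simp; omega)))
    (Cp.bind (Cp.on rfl (h o Y _ D _ (by simp; omega) hD))
    (Cp.bind (Cp.on rfl (h o Y _ D _ (by simp; omega) hD))
    (Cp.bind (Cp.on rfl (h o Y _ D _ (by simp; omega) hD))
    (Cp.bind (Cp.on rfl (h o Y _ D _ (by simp; omega) hD))
    (Cp.bind (Cp.on rfl (h o Y _ D _ (by simp; omega) hD))
    (Cp.bind (Cp.on rfl (h o Y _ D _ (by simp; omega) hD))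
    (Cp.bind (Cp.on rfl (h o Y _ D _ (by simp; omega) hD))
    (Cp.ex ?_))))))))))
  have e : l.drop ((D + 2) * n + 7 * D) = ((((((((((l.drop n).drop n).drop (D * n)).drop D).drop
      D).drop D).drop D).drop D).drop D).drop D) := by
    simp only [List.drop_drop]
    congr 1
    ring
  rw [e]
  rfl

/-- The labels found in `R` rounds with the random bits `l`, the last one first. -/
def search (n D : ℕ) (t : ℂ) (S : List (ZMod 2) → ℂ) (R : ℕ) (l : List (ZMod 2)) :
    List (List (ZMod 2) × List (ZMod 2)) :=
  ((fun d : List (ZMod 2) × List (List (ZMod 2) × List (ZMod 2)) =>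
    (d.1.drop ((D + 2) * n + 7 * D), candidate n t S (Seed.parse n D d.1) :: d.2))^[R] (l, [])).2

/-- A label as a value. -/
def labV (x : List (ZMod 2) × List (ZMod 2)) : Val := .cons (bits x.1) (bits x.2)

/-- The loop over all rounds. The environment contains the random bits, the exhausted counter of
these bits, `κ` as a number, `κ` in unary, `k`, and `n` in unary. -/
def searchT (c : ℕ) : Tm :=
  .bind ((sizesT c).on (.cons (.var 5) (.var 3)))
  (.bind (.ex (.mul (.mul (.var 3) (.var 3)) (.mul (.add .one .one) (.mul (.add .one .one)
    (.mul (.add .one .one) (.mul (.add .one .one) (.mul (.add .one .one) (.add .one .one))))))))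
  (.bind (.fold (.tl (.tl (.var 1))) (.cons (.var 2) .nil)
    (.bind (parseT.on (.cons (.cons (.var 10) (.hd (.var 4))) (.hd (.var 1))))
    (.bind (candidateT.on (.cons (.cons (.var 11) (.var 4)) (.tl (.var 0))))
      (.ex (.cons (.hd (.var 1)) (.cons (.var 0) (.tl (.var 3))))))))
  (.ex (.tl (.var 0)))))

theorem search_spec (c : ℕ) : ∃ p, ∀ (o : Val → ℂ) Y n κ a b l, 1 ≤ n → 1 ≤ κ →
    rounds c n κ * roundLen n κ ≤ Y → l.length = rounds c n κ * roundLen n κ →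
    Cp o (searchT c) [bits l, a, .num κ, Val.unary κ, b, Val.unary n]
      (.ofList ((search n (guessLen n κ) (64 * κ ^ 2) (fun y => o (bits y)) (rounds c n κ) l).map
        labV)) p Y := by
  obtain ⟨p, h₁⟩ := sizes_spec c
  obtain ⟨q, h₂⟩ := parse_spec
  obtain ⟨r, h₃⟩ := candidate_spec
  apply Exists.intro
  intro o Y n κ a b l hn hκ hY hl
  obtain ⟨y₁, y₂, y₃, y₄⟩ := sizes_bounds hn hκ hY
  have z₁ : 2 ^ guessLen n κ ≤ Y := le_trans (Nat.pow_le_pow_right (by norm_num) (by omega)) y₃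
  have z₂ : guessLen n κ ≤ Y := Nat.lt_two_pow_self.le.trans z₁
  have z₃ : n ≤ Y := by
    unfold roundLen at y₂
    rw [add_mul] at y₂
    omega
  set t : ℂ := 64 * (κ : ℂ) ^ 2 with ht
  set D := guessLen n κ with hD
  apply Cp.bind (Cp.on rfl (h₁ o Y _ n κ hn hκ hY))
  apply Cp.bind (v := .num t) (Cp.ex _)
  apply Cp.bind
  · refine Cp.iterI (fun d : List (ZMod 2) × List (List (ZMod 2) × List (ZMod 2)) =>
      Val.cons (bits d.1) (.ofList (d.2.map labV)))
      (fun d => (d.1.drop ((D + 2) * n + 7 * D),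
        candidate n t (fun y => o (bits y)) (Seed.parse n D d.1) :: d.2))
      (fun m d => d.1.length = m * ((D + 2) * n + 7 * D)) (rounds c n κ) (l, []) rfl rfl y₁ hl
      (fun m d v hd => Cp.bind (Cp.on rfl (h₂ o Y _ n D d.1 z₃ z₂ ?_))
        (Cp.bind (Cp.on rfl (h₃ o Y _ n t (Seed.parse n D d.1) z₃ ?_ ?_ ?_ ?_ ?_ ?_ ?_))
        (Cp.ex rfl))) ?_
    · rw [hd, add_mul m, one_mul]; omega
    · rw [add_mul m, one_mul, add_mul D] at hd
      simp [Seed.parse]; omega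
    · simpa [Seed.parse, length_chunks] using z₂
    · simpa [Seed.parse, length_chunks] using z₁
    · exact (List.length_take_le _ _).trans z₂
    · exact (List.length_take_le _ _).trans z₂
    · exact (List.length_take_le _ _).trans z₂
    · exact (List.length_take_le _ _).trans z₂
    · intro m d hd
      rw [add_mul m] at hd
      rw [List.length_drop, hd]
      omega
  · exact Cp.ex rfl
  · simp [ht]
    ring

/-! ### Random bits -/

/-- A Boolean as an element of `ℤ/2`. -/
def bitOf (b : Bool) : ZMod 2 := if b then 1 else 0

theorem ofBool_eq (b : Bool) : Val.ofBool b = bitV (bitOf b) := by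
  cases b <;> simp [bitOf, bitV, Val.ofBool]

/-- The distribution of a list of `m` fair random bits. -/
def coinList : ℕ → PMF (List (ZMod 2))
  | 0 => PMF.pure []
  | m + 1 => (PMF.uniformOfFintype Bool).bind fun b => (coinList m).map fun l => l ++ [bitOf b]

/-- The average of `f` over all lists of `m` bits. -/
def avg : ℕ → (List (ZMod 2) → ℝ) → ℝ
  | 0, f => f []
  | m + 1, f => (avg m (fun l => f (l ++ [0])) + avg m (fun l => f (l ++ [1]))) / 2

theorem length_of_mem_coinList {m : ℕ} {l : List (ZMod 2)} (h : l ∈ (coinList m).support) :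
    l.length = m := by
  induction m generalizing l with
  | zero => simp [coinList] at h; simp [h]
  | succ m ih =>
    simp only [coinList, PMF.mem_support_bind_iff, PMF.mem_support_map_iff] at h
    obtain ⟨b, _, l', hl', rfl⟩ := h
    simp [ih hl']

theorem avg_add_fun (m : ℕ) (f g : List (ZMod 2) → ℝ) :
    avg m (fun l => f l + g l) = avg m f + avg m g := by
  induction m generalizing f g with
  | zero => rfl
  | succ m ih => simp only [avg, ih]; ring

theorem avg_mul_left (m : ℕ) (c : ℝ) (f : List (ZMod 2) → ℝ) :
    avg m (fun l => c * f l) = c * avg m f := by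
  induction m generalizing f with
  | zero => rfl
  | succ m ih => simp only [avg, ih]; ring

theorem avg_const (m : ℕ) (c : ℝ) : avg m (fun _ => c) = c := by
  induction m with
  | zero => rfl
  | succ m ih => simp only [avg, ih]; ring

theorem avg_mono {m : ℕ} {f g : List (ZMod 2) → ℝ} (h : ∀ l, l.length = m → f l ≤ g l) :
    avg m f ≤ avg m g := by
  induction m generalizing f g with
  | zero => exact h [] rfl
  | succ m ih =>
    have h₀ := ih (f := fun l => f (l ++ [0])) (g := fun l => g (l ++ [0]))
      fun l hl => h _ (by simp [hl])
    have h₁ := ih (f := fun l => f (l ++ [1])) (g := fun l => g (l ++ [1]))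
      fun l hl => h _ (by simp [hl])
    simp only [avg]
    linarith

theorem avg_congr {m : ℕ} {f g : List (ZMod 2) → ℝ} (h : ∀ l, l.length = m → f l = g l) :
    avg m f = avg m g :=
  le_antisymm (avg_mono fun l hl => (h l hl).le) (avg_mono fun l hl => (h l hl).ge)

theorem avg_nonneg {m : ℕ} {f : List (ZMod 2) → ℝ} (h : ∀ l, 0 ≤ f l) : 0 ≤ avg m f := by
  simpa [avg_const] using avg_mono (m := m) (f := fun _ => 0) (g := f) fun l _ => h l

theorem avg_append (a b : ℕ) (f : List (ZMod 2) → ℝ) :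
    avg (a + b) f = avg a fun x => avg b fun y => f (x ++ y) := by
  induction b generalizing f with
  | zero => simp [avg]
  | succ b ih =>
    have h : ∀ g h : List (ZMod 2) → ℝ, avg a (fun x => (g x + h x) / 2) =
        (avg a g + avg a h) / 2 := by
      intro g h
      have := avg_mul_left a (1 / 2) (fun x => g x + h x)
      rw [avg_add_fun] at this
      rw [show (avg a g + avg a h) / 2 = 1 / 2 * (avg a g + avg a h) by ring, ← this]
      congr 1; funext x; ring
    rw [← add_assoc]
    simp only [avg, ih, h, List.append_assoc]

/-- The average over lists of `n` bits, as a sum over binary vectors. -/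
theorem avg_eq_sum (n : ℕ) (f : List (ZMod 2) → ℝ) :
    avg n f = (∑ y : BinVec n, f (List.ofFn y)) / 2 ^ n := by
  induction n generalizing f with
  | zero => simp [avg]
  | succ n ih =>
    rw [avg, ih, ih, ← (Fin.snocEquiv fun _ : Fin (n + 1) => ZMod 2).sum_comp,
      Fintype.sum_prod_type]
    have h : ∀ (b : ZMod 2) (y : Fin n → ZMod 2),
        List.ofFn (Fin.snocEquiv (fun _ : Fin (n + 1) => ZMod 2) (b, y)) =
          List.ofFn y ++ [b] := by
      intro b y
      rw [List.ofFn_succ']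
      simp [Fin.snocEquiv, List.concat_eq_append]
    simp only [h]
    have h2 : ∀ g : ZMod 2 → ℝ, ∑ b, g b = g 0 + g 1 := fun g => Fin.sum_univ_two g
    rw [h2, pow_succ]
    field_simp

theorem avg_eq_point (m : ℕ) (x : List (ZMod 2)) (hx : x.length = m) :
    (1 / 2) ^ m ≤ avg m fun l => open Classical in if l = x then (1 : ℝ) else 0 := by
  obtain ⟨y, rfl⟩ : ∃ y : BinVec m, List.ofFn y = x := by
    subst hx
    exact ⟨x.get, List.ofFn_get x⟩
  rw [avg_eq_sum]
  have := Finset.single_le_sum (s := Finset.univ)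
    (f := fun z : BinVec m => open Classical in if List.ofFn z = List.ofFn y then (1 : ℝ) else 0)
    (fun z _ => by split_ifs <;> norm_num) (Finset.mem_univ y)
  simp only [if_true] at this
  rw [div_pow, one_pow]
  exact div_le_div_of_nonneg_right this (by positivity)

/-- Probabilities of events as averages. -/
theorem coinList_toOuterMeasure (m : ℕ) (S : Set (List (ZMod 2))) :
    (coinList m).toOuterMeasure S = ENNReal.ofReal (avg m (S.indicator fun _ => 1)) := by
  induction m generalizing S with
  | zero =>
    classical
    simp only [coinList, PMF.toOuterMeasure_pure_apply, avg, Set.indicator_apply]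
    split_ifs <;> simp
  | succ m ih =>
    rw [coinList, PMF.toOuterMeasure_bind_apply, tsum_fintype, Fintype.sum_bool]
    simp only [PMF.toOuterMeasure_map_apply, ih, PMF.uniformOfFintype_apply, Fintype.card_bool]
    have h : ∀ b, (S.indicator fun _ => (1 : ℝ)) ∘ (fun l : List (ZMod 2) => l ++ [bitOf b]) =
        ((fun l : List (ZMod 2) => l ++ [bitOf b]) ⁻¹' S).indicator fun _ => (1 : ℝ) := by
      intro b; rfl
    have n₀ : ∀ T : Set (List (ZMod 2)), 0 ≤ avg m (T.indicator fun _ => (1 : ℝ)) :=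
      fun T => avg_nonneg fun l => Set.indicator_nonneg (fun _ _ => zero_le_one) l
    have e : avg (m + 1) (S.indicator fun _ => (1 : ℝ)) =
        2⁻¹ * avg m (((fun l : List (ZMod 2) => l ++ [bitOf true]) ⁻¹' S).indicator fun _ => 1) +
        2⁻¹ * avg m
          (((fun l : List (ZMod 2) => l ++ [bitOf false]) ⁻¹' S).indicator fun _ => 1) := by
      rw [← h, ← h]
      simp only [avg, bitOf, Function.comp_def]
      simp
      ring
    have h2 : ((2 : ℕ) : ENNReal)⁻¹ = ENNReal.ofReal (2⁻¹) := by
      rw [ENNReal.ofReal_inv_of_pos (by norm_num)]; simp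
    rw [e, ENNReal.ofReal_add (mul_nonneg (by norm_num) (n₀ _)) (mul_nonneg (by norm_num) (n₀ _)),
      ENNReal.ofReal_mul (by norm_num), ENNReal.ofReal_mul (by norm_num), h2]

theorem pmf_bind_congr {α β : Type*} {p : PMF α} {f g : α → PMF β}
    (h : ∀ a ∈ p.support, f a = g a) : p.bind f = p.bind g := by
  ext b
  simp only [PMF.bind_apply]
  refine tsum_congr fun a => ?_
  by_cases ha : p a = 0
  · simp [ha]
  · rw [h a ((PMF.mem_support_iff _ _).2 ha)]

/-! ### The program -/

/-- Puts `κ = ⌊k⌋ + 1` into variables `2` (in unary) and `3` (as a number). -/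
def kappaProg : Prog :=
  .seq (.assign 2 (litE 1)) (.seq (.assign 3 .one)
    (.while (.le (.var 3) (.var 1))
      (.seq (.assign 3 (.add (.var 3) .one)) (.assign 2 (.cons .nil (.var 2))))))

/-- Puts as many random bits into variable `5` as variable `4` says. -/
def coinProg : Prog :=
  .while (.var 4) (.seq (.flip 6) (.seq (.assign 5 (.cons (.var 6) (.var 5)))
    (.seq (.assign 6 .nil) (.assign 4 (.tl (.var 4))))))

/-- The number of random bits. -/
def countT (c : ℕ) : Tm :=
  .bind ((sizesT c).on (.cons (.var 3) (.var 1)))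
    (umulT.on (.cons (.tl (.tl (.var 0))) (.hd (.tl (.var 0)))))

/-- The decoding algorithm: it computes `κ`, tosses all coins, and carries out the rounds. The
compiled terms use the variables from `4` and from `6` on. -/
def decoder (c : ℕ) : Prog :=
  .seq (.seq kappaProg (.seq (compile 4 (countT c)) (.seq (.assign 5 .nil) (.assign 6 .nil))))
    (.seq coinProg (.seq (compile 6 (searchT c)) (.assign 0 (.var 6))))

theorem count_spec (c : ℕ) : ∃ p, ∀ (o : Val → ℂ) Y n κ a b, 1 ≤ n → 1 ≤ κ →
    rounds c n κ * roundLen n κ ≤ Y →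
    Cp o (countT c) [a, Val.unary κ, b, Val.unary n]
      (Val.unary (rounds c n κ * roundLen n κ)) p Y := by
  obtain ⟨p, hp⟩ := sizes_spec c
  obtain ⟨q, hq⟩ := umul_spec
  apply Exists.intro
  intro o Y n κ a b hn hκ hY
  obtain ⟨y₁, y₂, -, -⟩ := sizes_bounds hn hκ hY
  exact Cp.bind (Cp.on rfl (hp o Y _ n κ hn hκ hY)) (Cp.on rfl (hq o Y _ _ _ y₁ y₂))

theorem kappa_loop {n : ℕ} (s : Signal n) (k : ℝ) (hk : 0 ≤ k) (j m : ℕ) (σ : Store)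
    (hj : m + j = ⌊k⌋₊ + 1) (h₁ : σ 1 = .num k) (h₂ : σ 2 = Val.unary m) (h₃ : σ 3 = .num m) :
    ∃ σ', Exec s (.while (.le (.var 3) (.var 1))
        (.seq (.assign 3 (.add (.var 3) .one)) (.assign 2 (.cons .nil (.var 2)))))
        σ σ' (4 * j + 1) ∧
      σ' 0 = σ 0 ∧ σ' 1 = .num k ∧ σ' 2 = Val.unary (⌊k⌋₊ + 1) ∧
        σ' 3 = .num ((⌊k⌋₊ + 1 : ℕ) : ℂ) := by
  induction j generalizing m σ with
  | zero =>
    have hm : m = ⌊k⌋₊ + 1 := by omega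
    refine ⟨σ, Exec.while_false ?_, rfl, h₁, by rw [h₂, hm], by rw [h₃, hm]⟩
    have : k < m := by rw [hm]; push_cast; exact Nat.lt_floor_add_one k
    simp [h₁, h₃, truthy_ofBool, this]
  | succ j ih =>
    have hm : (m : ℝ) ≤ k := (Nat.le_floor_iff hk).1 (by omega)
    set σ₁ := Function.update (Function.update σ 3 (.num ((m : ℂ) + 1))) 2
      (Val.unary (m + 1)) with hσ₁
    have e : Exec s (.seq (.assign 3 (.add (.var 3) .one)) (.assign 2 (.cons .nil (.var 2))))
        σ σ₁ 3 := by
      have := (Exec.assign (s := s) 3 (.add (.var 3) .one) σ).seq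
        (Exec.assign 2 (.cons .nil (.var 2)) _)
      simpa [h₂, h₃, hσ₁, Val.unary] using this
    obtain ⟨σ', e', k₀, k₁, k₂, k₃⟩ := ih (m + 1) σ₁ (by omega) (by simp [hσ₁, h₁])
      (by simp [hσ₁]) (by simp [hσ₁])
    refine ⟨σ', ?_, by simpa [hσ₁] using k₀, k₁, k₂, k₃⟩
    have := Exec.while_true (e := .le (.var 3) (.var 1)) (by simp [h₁, h₃, truthy_ofBool, hm]) e e'
    rwa [show 3 + 1 + (4 * j + 1) = 4 * (j + 1) + 1 by ring] at this

theorem run_coinProg {n : ℕ} (s : Signal n) (R : List Prog) (m : ℕ) (l : List (ZMod 2))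
    (σ : Store) (h₄ : σ 4 = Val.unary m) (h₅ : σ 5 = bits l) (h₆ : σ 6 = .nil) :
    run s (8 * m + 1) ⟨coinProg :: R, σ⟩ = (coinList m).map fun l' =>
      ⟨R, Function.update (Function.update σ 5 (bits (l' ++ l))) 4 .nil⟩ := by
  induction m generalizing l σ with
  | zero =>
    have hσ : Function.update (Function.update σ 5 (bits l)) 4 .nil = σ := by
      rw [← h₅, Function.update_eq_self, show Val.nil = σ 4 from h₄.symm, Function.update_eq_self]
    simp [run, coinProg, step, h₄, Val.unary, Val.truthy, coinList, PMF.pure_map, hσ]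
  | succ m ih =>
    set body : Prog := .seq (.flip 6) (.seq (.assign 5 (.cons (.var 6) (.var 5)))
      (.seq (.assign 6 .nil) (.assign 4 (.tl (.var 4))))) with hbody
    have hs : step s ⟨coinProg :: R, σ⟩ = PMF.pure ⟨body :: coinProg :: R, σ⟩ := by
      simp [coinProg, step, h₄, Val.unary, Val.truthy, hbody]
    rw [show 8 * (m + 1) + 1 = ((((5 + (8 * m + 1)) + 1) + 1) + 1) by ring, run, hs,
      PMF.pure_bind, run, hbody, step, PMF.pure_bind, run, step, PMF.bind_map, coinList,
      PMF.map_bind]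
    congr 1
    funext b
    have e := (Exec.assign (s := s) 5 (.cons (.var 6) (.var 5))
        (Function.update σ 6 (Val.ofBool b))).seq
      ((Exec.assign 6 .nil _).seq (Exec.assign 4 (.tl (.var 4)) _)) (coinProg :: R)
    rw [Function.comp_apply, run_add, e, PMF.pure_bind, ih (bitOf b :: l) _ (by
      simp [h₄, Val.unary]) (by simp [h₅, ofBool_eq, cons_bits]) (by simp), PMF.map_comp]
    congr 1
    funext l'
    simp only [Function.comp_apply, List.append_assoc, List.singleton_append]
    congr 1
    funext j
    by_cases h4 : j = 4
    · simp [h4]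
    by_cases h5 : j = 5
    · simp [h5]
    by_cases h6 : j = 6
    · simp [h6, h₆]
    simp [Function.update_of_ne, h4, h5, h6]

/-- After sufficiently many steps the decoder has stopped, and its output is the result of the
search with random bits. -/
theorem run_decoder (c : ℕ) : ∃ p : Polynomial ℕ, ∀ (n : ℕ) (k : ℝ) (s : Signal n) (T : ℕ),
    1 ≤ n → 0 ≤ k →
    p.eval (rounds c n (⌊k⌋₊ + 1) * roundLen n (⌊k⌋₊ + 1)) ≤ T →
    ∃ σ : List (ZMod 2) → Store,
      run s T (start (decoder c) n k) =
        (coinList (rounds c n (⌊k⌋₊ + 1) * roundLen n (⌊k⌋₊ + 1))).map (fun l => ⟨[], σ l⟩) ∧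
      ∀ l, l.length = rounds c n (⌊k⌋₊ + 1) * roundLen n (⌊k⌋₊ + 1) → σ l 0 =
        .ofList ((search n (guessLen n (⌊k⌋₊ + 1)) (64 * ((⌊k⌋₊ + 1 : ℕ) : ℂ) ^ 2)
          (fun y => s ((bits y).toVec n)) (rounds c n (⌊k⌋₊ + 1)) l).map labV) := by
  obtain ⟨p, hp⟩ := count_spec c
  obtain ⟨q, hq⟩ := search_spec c
  refine ⟨12 * Polynomial.X + p + q + 20, fun n k s T hn hk hT => ?_⟩
  set κ := ⌊k⌋₊ + 1 with hκ
  set N := rounds c n κ * roundLen n κ with hN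
  set o : Val → ℂ := fun v => s (v.toVec n) with ho
  have hκN : κ ≤ N := by
    have h := sizes_bounds (c := c) hn (show 1 ≤ κ by omega) hN.symm.le
    refine le_trans ?_ h.2.2.2
    calc κ = 1 * (1 * (κ * 1)) := by ring
      _ ≤ (c + 2) * (n * (κ * n)) := by gcongr; omega
  -- the deterministic part before the random bits
  set σ₀ : Store := (start (decoder c) n k).store with hσ₀
  obtain ⟨σ₁, e₁, a₀, a₁, a₂, a₃⟩ := kappa_loop s k hk ⌊k⌋₊ 1
    (Function.update (Function.update σ₀ 2 (Val.unary 1)) 3 (.num 1)) (by omega)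
    (by simp [hσ₀, start]) (by simp) (by simp)
  have e₁' : Exec s kappaProg σ₀ σ₁ (1 + (1 + (4 * ⌊k⌋₊ + 1) + 1) + 1) := by
    refine Exec.seq (Exec.assign _ _ _) (Exec.seq (Exec.assign _ _ _) ?_)
    simpa using e₁
  obtain ⟨σ₂, e₂, v₂, k₂⟩ := exec_compile s (countT c)
    [.num ((κ : ℕ) : ℂ), Val.unary κ, .num k, Val.unary n] σ₁
    ⟨a₃, a₂, a₁, by simpa [hσ₀, start] using a₀, trivial⟩
  obtain ⟨hv, hc⟩ := hp o N n κ (.num κ) (.num k) hn (by omega) le_rfl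
  set σ₃ := Function.update (Function.update σ₂ 5 Val.nil) 6 Val.nil with hσ₃
  have e₃ : Exec s (.seq kappaProg (.seq (compile 4 (countT c))
      (.seq (.assign 5 .nil) (.assign 6 .nil)))) σ₀ σ₃ _ :=
    e₁'.seq (e₂.seq ((Exec.assign 5 .nil σ₂).seq (Exec.assign 6 .nil _)))
  have h0 : σ₃ 0 = Val.unary n := by
    simp [hσ₃, k₂ 0 (by simp), a₀, hσ₀, start]
  have h1 : σ₃ 1 = .num k := by simp [hσ₃, k₂ 1 (by simp), a₁]
  have h2 : σ₃ 2 = Val.unary κ := by simp [hσ₃, k₂ 2 (by simp), a₂, hκ]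
  have h3 : σ₃ 3 = .num κ := by simp [hσ₃, k₂ 3 (by simp), a₃, hκ]
  have h4 : σ₃ 4 = Val.unary N := by
    simpa [hσ₃] using v₂.trans hv
  -- the part behind the random bits
  have post : ∀ l : List (ZMod 2), l.length = N → ∃ τ t,
      Exec s (.seq (compile 6 (searchT c)) (.assign 0 (.var 6)))
        (Function.update (Function.update σ₃ 5 (bits (l ++ []))) 4 .nil) τ t ∧
      t ≤ q.eval N + 2 ∧ τ 0 = .ofList ((search n (guessLen n κ) (64 * (κ : ℂ) ^ 2)
        (fun y => s ((bits y).toVec n)) (rounds c n κ) l).map labV) := by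
    intro l hl
    obtain ⟨τ, e, v, _⟩ := exec_compile s (searchT c)
      [bits l, .nil, .num ((κ : ℕ) : ℂ), Val.unary κ, .num k, Val.unary n]
      (Function.update (Function.update σ₃ 5 (bits (l ++ []))) 4 .nil)
      ⟨by simp, by simp, by simpa using h3, by simpa using h2, by simpa using h1,
        by simpa using h0, trivial⟩
    obtain ⟨hv', hc'⟩ := hq o N n κ .nil (.num k) l hn (by omega) le_rfl hl
    refine ⟨_, _, e.seq (Exec.assign 0 (.var 6) τ), ?_, ?_⟩
    · rw [add_assoc]
      exact Nat.add_le_add_right hc' 2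
    · simpa using v.trans hv'
  have : Nonempty Store := ⟨σ₀⟩
  choose! τ t hτ ht hv' using post
  refine ⟨τ, ?_, hv'⟩
  simp only [Polynomial.eval_add, Polynomial.eval_mul, Polynomial.eval_X,
    Polynomial.eval_ofNat] at hT
  have r₁ : start (decoder c) n k = ⟨[decoder c], σ₀⟩ := rfl
  have st : ∀ (A B : Prog) (σ : Store) (R : List Prog) (v : ℕ),
      run s (v + 1) ⟨.seq A B :: R, σ⟩ = run s v ⟨A :: B :: R, σ⟩ := by
    intro A B σ R v
    rw [run, step, PMF.pure_bind]
  set pre := 1 + (1 + (4 * ⌊k⌋₊ + 1) + 1) + 1 + (cost o (countT c) [.num ((κ : ℕ) : ℂ),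
    Val.unary κ, .num k, Val.unary n] + (1 + 1 + 1) + 1) + 1 with hpre
  obtain ⟨w, hw⟩ := Nat.exists_eq_add_of_le (show
    pre + (8 * N + 1) + (q.eval N + 2) + 2 ≤ T by omega)
  have hT' : T = pre + ((8 * N + 1) + (q.eval N + 2 + w) + 1) + 1 := by omega
  rw [hT', r₁, decoder, st, run_add, e₃ _, PMF.pure_bind, st, run_add,
    run_coinProg s _ N [] σ₃ h4 (by simp [hσ₃, bits, Val.ofList]) (by simp [hσ₃]), PMF.bind_map,
    ← PMF.bind_pure_comp]
  refine pmf_bind_congr fun l hl => ?_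
  have hl' := length_of_mem_coinList hl
  obtain ⟨x, hx⟩ := Nat.exists_eq_add_of_le ((ht l hl').trans (Nat.le_add_right _ w))
  rw [Function.comp_apply, hx, run_add, hτ l hl' [], PMF.pure_bind, run_nil]
  rfl

/-! ### Signs and quadratic phases -/

/-- The sign `(-1) ^ z`. -/
def sgn (z : ZMod 2) : ℂ := if z = 0 then 1 else -1

theorem sgn_add (a b : ZMod 2) : sgn (a + b) = sgn a * sgn b := by
  rcases bit_cases a with rfl | rfl <;> rcases bit_cases b with rfl | rfl <;>
    simp [sgn, one_add_one_bit]

theorem sgn_mul_self (a : ZMod 2) : sgn a * sgn a = 1 := by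
  rcases bit_cases a with rfl | rfl <;> simp [sgn]

theorem norm_sgn (a : ZMod 2) : ‖sgn a‖ = 1 := by
  rcases bit_cases a with rfl | rfl <;> simp [sgn]

theorem star_sgn (a : ZMod 2) : star (sgn a) = sgn a := by
  rcases bit_cases a with rfl | rfl <;> simp [sgn]

theorem val_cast_add (a b : ZMod 2) :
    ((a + b).val : ZMod 4) = a.val + b.val - 2 * (a.val * b.val) := by
  revert a b; decide

theorem I_pow_congr {a b : ℕ} (h : (a : ZMod 4) = b) : Complex.I ^ a = Complex.I ^ b := by
  rw [ZMod.natCast_eq_natCast_iff] at h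
  rw [← Nat.div_add_mod a 4, ← Nat.div_add_mod b 4, pow_add, pow_add, pow_mul, pow_mul,
    Complex.I_pow_four, one_pow, one_pow, h]

theorem sgn_eq (z : ZMod 2) : sgn z = Complex.I ^ (2 * z.val) := by
  rcases bit_cases z with rfl | rfl <;> simp [sgn, ZMod.val_one]

theorem two_mul_val_sum {ι : Type*} (s : Finset ι) (f : ι → ZMod 2) :
    (2 * ((∑ i ∈ s, f i).val : ZMod 4)) = 2 * ∑ i ∈ s, ((f i).val : ZMod 4) := by
  classical
  induction s using Finset.induction_on with
  | empty => simp
  | insert i s hi ih =>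
    rw [Finset.sum_insert hi, Finset.sum_insert hi, val_cast_add, mul_add, ← ih]
    -- the product term `2 * (2 * a * b)` vanishes modulo four
    have h4 : (4 : ZMod 4) = 0 := by decide
    linear_combination (-((f i).val : ZMod 4) * ((∑ i ∈ s, f i).val : ZMod 4)) * h4

/-- The derivative of a quadratic phase is, up to a constant, a linear phase. -/
theorem I_pow_phase_add {n : ℕ} {P : BinMat n} (hP : P.IsSymm) (l y e : BinVec n) :
    Complex.I ^ phase P l (y + e) =
      Complex.I ^ phase P l y * Complex.I ^ phase P l e * sgn (P.mulVec e ⬝ᵥ y) := by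
  rw [sgn_eq, ← pow_add, ← pow_add]
  apply I_pow_congr
  set p : Matrix (Fin n) (Fin n) (ZMod 4) := P.map fun z => (z.val : ZMod 4) with hp
  set α : Fin n → ZMod 4 := fun i => (y i).val with hα
  set β : Fin n → ZMod 4 := fun i => (e i).val with hβ
  set μ : Fin n → ZMod 4 := fun i => (l i).val with hl
  -- modulo four, the lift of `y + e` is the sum of the lifts plus twice the vector `γ`
  set γ : Fin n → ZMod 4 := fun i => - (α i * β i) with hγ
  have hsymm : ∀ u v : Fin n → ZMod 4, u ⬝ᵥ p.mulVec v = v ⬝ᵥ p.mulVec u := by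
    intro u v
    have hpT : p.transpose = p := by
      ext i j
      rw [Matrix.transpose_apply, hp, Matrix.map_apply, Matrix.map_apply, hP.apply i j]
    rw [Matrix.dotProduct_mulVec, ← Matrix.mulVec_transpose, hpT, dotProduct_comm]
  have hph : ∀ z : BinVec n, ((phase P l z : ℕ) : ZMod 4) =
      (fun i => ((z i).val : ZMod 4)) ⬝ᵥ p.mulVec (fun i => ((z i).val : ZMod 4)) +
        2 * (μ ⬝ᵥ fun i => ((z i).val : ZMod 4)) := by
    intro z
    simp [phase, dotProduct, Matrix.mulVec, hp, hl, Finset.mul_sum, mul_assoc]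
  have hsum : (fun i => (((y + e) i).val : ZMod 4)) = α + β + (2 : ZMod 4) • γ := by
    funext i
    simp only [Pi.add_apply, Pi.smul_apply, smul_eq_mul, hγ, val_cast_add, hα, hβ]
    ring
  have hdot : (2 * ((P.mulVec e ⬝ᵥ y).val : ZMod 4)) = 2 * (α ⬝ᵥ p.mulVec β) := by
    have h1 : P.mulVec e ⬝ᵥ y = ∑ x : Fin n × Fin n, P x.1 x.2 * e x.2 * y x.1 := by
      rw [Fintype.sum_prod_type]
      simp [dotProduct, Matrix.mulVec, Finset.sum_mul]
    rw [h1, two_mul_val_sum, Fintype.sum_prod_type]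
    congr 1
    simp only [dotProduct, Matrix.mulVec, hα, hβ, hp, Finset.mul_sum, Matrix.map_apply]
    refine Finset.sum_congr rfl fun i _ => Finset.sum_congr rfl fun j _ => ?_
    have : ∀ a b c : ZMod 2, ((a * b * c).val : ZMod 4) = c.val * (a.val * b.val) := by decide
    exact this _ _ _
  have h4 : (4 : ZMod 4) = 0 := by decide
  push_cast
  rw [hph, hph, hph, hsum, hdot]
  simp only [Matrix.mulVec_add, Matrix.mulVec_smul, dotProduct_add, add_dotProduct,
    dotProduct_smul, smul_dotProduct, smul_eq_mul]
  rw [hsymm β α, hsymm γ α, hsymm γ β]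
  linear_combination (α ⬝ᵥ p.mulVec γ + β ⬝ᵥ p.mulVec γ + γ ⬝ᵥ p.mulVec γ + μ ⬝ᵥ γ) * h4

/-! ### Sums over affine subspaces -/

/-- The binary vector whose entries are the first `n` entries of a list. -/
def vec (n : ℕ) (l : List (ZMod 2)) : BinVec n := fun i => l.getD i 0

theorem vec_addL {n : ℕ} {x : List (ZMod 2)} (hx : x.length = n) (e : List (ZMod 2)) :
    vec n (addL x e) = vec n x + vec n e := by
  have : ∀ (x e : List (ZMod 2)) (i : ℕ), i < x.length →
      (addL x e).getD i 0 = x.getD i 0 + e.getD i 0 := by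
    intro x
    induction x with
    | nil => intro e i hi; simp at hi
    | cons a x ih =>
      intro e i hi
      cases i with
      | zero => cases e <;> simp [addL]
      | succ i =>
        have := ih e.tail i (by simpa using hi)
        cases e <;> simpa [addL] using this
  funext i
  exact this x e i (by rw [hx]; exact i.2)

theorem vec_ofFn {n : ℕ} (y : BinVec n) : vec n (List.ofFn y) = y := by
  funext i
  simp [vec]

/-- The sum of the values of `H` over the points `w + ∑ i ∈ S, v i` with `S` a subset of the
indices of the given vectors. -/
def hsum {n : ℕ} (H : BinVec n → ℂ) (w : BinVec n) : List (BinVec n) → ℂ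
  | [] => H w
  | v :: vs => hsum H w vs + hsum H (w + v) vs

theorem hsum_translate {n : ℕ} (H : BinVec n → ℂ) (t w : BinVec n) (vs : List (BinVec n)) :
    hsum (fun y => H (y + t)) w vs = hsum H (w + t) vs := by
  induction vs generalizing w with
  | nil => rfl
  | cons v vs ih => simp only [hsum, ih, add_right_comm w v t]

theorem hsum_mul_left {n : ℕ} (H : BinVec n → ℂ) (c : ℂ) (w : BinVec n) (vs : List (BinVec n)) :
    hsum (fun y => c * H y) w vs = c * hsum H w vs := by
  induction vs generalizing w with
  | nil => rfl
  | cons v vs ih => simp only [hsum, ih, mul_add]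

theorem hsum_sub_const {n : ℕ} (H : BinVec n → ℂ) (c : ℂ) (w : BinVec n) (vs : List (BinVec n)) :
    hsum (fun y => H y - c) w vs = hsum H w vs - 2 ^ vs.length * c := by
  induction vs generalizing w with
  | nil => simp [hsum]
  | cons v vs ih => simp only [hsum, ih, List.length_cons, pow_succ]; ring

theorem sum_hsum_eq_zero {n : ℕ} {H : BinVec n → ℂ} (h : ∑ y, H y = 0) (vs : List (BinVec n)) :
    ∑ w, hsum H w vs = 0 := by
  induction vs with
  | nil => exact h
  | cons v vs ih =>
    simp only [hsum, Finset.sum_add_distrib, ih, zero_add]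
    rw [← ih]
    exact Equiv.sum_comp (Equiv.addRight v) fun w => hsum H w vs

theorem avg_comm (a b : ℕ) (f : List (ZMod 2) → List (ZMod 2) → ℝ) :
    avg a (fun x => avg b fun y => f x y) = avg b fun y => avg a fun x => f x y := by
  simp only [avg_eq_sum, ← Finset.sum_div]
  rw [Finset.sum_comm]
  ring

/-- The sample points are pairwise independent, hence the second moment of the sum of a function
with mean zero over `2 ^ q` sample points is `2 ^ q` times that of the function. -/
theorem second_moment {n : ℕ} {H : BinVec n → ℂ} (h : ∑ y, H y = 0) (q : ℕ) :
    avg (q * n) (fun l => ∑ w, ‖hsum H w ((chunks n q l).map (vec n))‖ ^ 2) =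
      2 ^ q * ∑ w, ‖H w‖ ^ 2 := by
  induction q with
  | zero => simp [chunks, hsum, avg]
  | succ q ih =>
    rw [add_mul, one_mul, add_comm, avg_append]
    have h₁ : ∀ x y : List (ZMod 2), x.length = n →
        (∑ w, ‖hsum H w ((chunks n (q + 1) (x ++ y)).map (vec n))‖ ^ 2) =
        2 * ∑ w, ‖hsum H w ((chunks n q y).map (vec n))‖ ^ 2 +
        2 * ∑ w, (hsum H w ((chunks n q y).map (vec n)) *
          star (hsum H (w + vec n x) ((chunks n q y).map (vec n)))).re := by
      intro x y hx
      set vs := (chunks n q y).map (vec n)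
      have hc : chunks n (q + 1) (x ++ y) = x :: chunks n q y := by
        simp [chunks, ← hx]
      have h₂ : ∑ w, ‖hsum H (w + vec n x) vs‖ ^ 2 = ∑ w, ‖hsum H w vs‖ ^ 2 :=
        Equiv.sum_comp (Equiv.addRight (vec n x)) fun w => ‖hsum H w vs‖ ^ 2
      have h₃ : ∀ a b : ℂ, ‖a + b‖ ^ 2 = ‖a‖ ^ 2 + ‖b‖ ^ 2 + 2 * (a * star b).re := by
        intro a b
        rw [← Complex.normSq_eq_norm_sq, ← Complex.normSq_eq_norm_sq, ← Complex.normSq_eq_norm_sq,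
          Complex.normSq_add]
        rfl
      rw [hc, List.map_cons]
      simp only [hsum, h₃, Finset.sum_add_distrib]
      change _ + ∑ w, ‖hsum H (w + vec n x) vs‖ ^ 2 + _ = _
      rw [h₂, Finset.mul_sum Finset.univ (fun w => (hsum H w vs * _).re)]
      ring
    rw [avg_congr fun x hx => avg_congr fun y _ => h₁ x y hx, avg_comm]
    -- the cross term vanishes on average, since the new vector is uniformly distributed
    have h₄ : ∀ y, avg n (fun x => 2 * ∑ w, ‖hsum H w ((chunks n q y).map (vec n))‖ ^ 2 +
        2 * ∑ w, (hsum H w ((chunks n q y).map (vec n)) *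
          star (hsum H (w + vec n x) ((chunks n q y).map (vec n)))).re) =
        2 * ∑ w, ‖hsum H w ((chunks n q y).map (vec n))‖ ^ 2 := by
      intro y
      set vs := (chunks n q y).map (vec n)
      rw [avg_add_fun, avg_const, avg_mul_left, avg_eq_sum]
      simp only [vec_ofFn]
      have : ∑ x : BinVec n, ∑ w, (hsum H w vs * star (hsum H (w + x) vs)).re = 0 := by
        rw [Finset.sum_comm]
        refine Finset.sum_eq_zero fun w _ => ?_
        rw [← Complex.re_sum, ← Finset.mul_sum, ← star_sum,
          show ∑ x, hsum H (w + x) vs = 0 from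
            (Equiv.sum_comp (Equiv.addLeft w) fun x => hsum H x vs).trans (sum_hsum_eq_zero h vs)]
        simp
      rw [this]
      simp
    simp only [h₄]
    rw [avg_mul_left, ih, pow_succ]
    ring

/-! ### Correctness of the decoding of linear functions -/

/-- The signed sum of the values of a function at sample points. -/
def fsum {n : ℕ} (P : List (List (ZMod 2) × ℂ)) (K : BinVec n → ℂ) : ℂ :=
  (P.map fun x => x.2 * K (vec n x.1)).sum

theorem corr_eq_fsum {n : ℕ} {G : List (ZMod 2) → ℂ} {H : BinVec n → ℂ}
    (hG : ∀ y, y.length = n → G y = H (vec n y)) {P : List (List (ZMod 2) × ℂ)}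
    (hP : ∀ x ∈ P, x.1.length = n) (sh : List (ZMod 2)) :
    corr G P sh = fsum P fun y => H (y + vec n sh) := by
  have : ∀ (P : List (List (ZMod 2) × ℂ)) (z : ℂ), (∀ x ∈ P, x.1.length = n) →
      P.foldl (fun acc x => acc + x.2 * G (addL x.1 sh)) z =
        z + fsum P fun y => H (y + vec n sh) := by
    intro P
    induction P with
    | nil => simp [fsum]
    | cons x P ih =>
      intro z hP
      have hx := hP x (by simp)
      rw [List.foldl_cons, ih _ fun y hy => hP y (by simp [hy]),
        hG _ ((length_addL _ _).trans hx), vec_addL hx]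
      simp only [fsum, List.map_cons, List.sum_cons]
      ring
  rw [corr, this P 0 hP, zero_add]

theorem fsum_dbl {n : ℕ} {P : List (List (ZMod 2) × ℂ)} (hP : ∀ x ∈ P, x.1.length = n)
    (v : List (ZMod 2)) (b : ZMod 2) (K : BinVec n → ℂ) :
    fsum (dbl P v b) K = fsum P fun y => K y + sgn b * K (y + vec n v) := by
  induction P with
  | nil => simp [fsum, dbl]
  | cons x P ih =>
    have := ih fun y hy => hP y (by simp [hy])
    simp only [fsum] at this
    simp only [fsum, dbl_cons, List.map_append, List.sum_append, this, List.map_cons,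
      List.sum_cons, List.map_nil, List.sum_nil, vec_addL (hP x (by simp))]
    rcases bit_cases b with rfl | rfl
    · simp [sgn]; ring
    · simp [sgn]; ring

/-- With the correct guess of the values of the linear function at the spanning vectors, the signs
of the sample points agree with that linear function up to a common sign. -/
theorem fsum_points {n : ℕ} (a : BinVec n) {w : List (ZMod 2)} (hw : w.length = n)
    (vs : List (List (ZMod 2))) (K : BinVec n → ℂ) :
    fsum (points w vs (vs.map fun v => a ⬝ᵥ vec n v)) K =
      sgn (a ⬝ᵥ vec n w) * hsum (fun y => sgn (a ⬝ᵥ y) * K y) (vec n w) (vs.map (vec n)) := by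
  have h : ∀ (vs : List (List (ZMod 2))) (P : List (List (ZMod 2) × ℂ)),
      (∀ x ∈ P, x.1.length = n) →
      fsum (vs.foldl (fun (d : List (ZMod 2) × List (List (ZMod 2) × ℂ)) v =>
        (d.1.tail, dbl d.2 v (d.1.headD 0))) (vs.map fun v => a ⬝ᵥ vec n v, P)).2 K =
      fsum P fun y => sgn (a ⬝ᵥ y) * hsum (fun y => sgn (a ⬝ᵥ y) * K y) y (vs.map (vec n)) := by
    intro vs
    induction vs with
    | nil =>
      intro P hP
      simp only [List.foldl_nil, List.map_nil, hsum, ← mul_assoc, sgn_mul_self, one_mul]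
    | cons v vs ih =>
      intro P hP
      rw [List.foldl_cons]
      refine (ih _ (mem_dbl_length hP)).trans ?_
      rw [fsum_dbl hP]
      congr 1
      funext y
      simp only [List.map_cons, List.headD_cons, hsum, dotProduct_add, sgn_add]
      linear_combination (sgn (a ⬝ᵥ y) * hsum (fun y => sgn (a ⬝ᵥ y) * K y) (y + vec n v)
        (vs.map (vec n))) * sgn_mul_self (a ⬝ᵥ vec n v)
  refine (h vs [(w, 1)] (by simpa using hw)).trans ?_
  simp [fsum]

theorem vec_unitL {n : ℕ} (j : Fin n) : vec n (unitL j) = Pi.single j 1 := by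
  funext i
  simp only [vec, unitL, Pi.single_apply, Fin.ext_iff]
  rcases lt_trichotomy (i : ℕ) j with h | h | h
  · rw [List.getD_append _ _ _ _ (by simpa using h)]
    simp [h, h.ne]
  · rw [List.getD_append_right _ _ _ _ (by simp [h])]
    simp [h]
  · rw [List.getD_append_right _ _ _ _ (by simp [h.le]), if_neg h.ne']
    exact List.getD_eq_default _ _ (by simp; omega)

theorem vec_nil (n : ℕ) : vec n [] = 0 := rfl

/-- A bound for the failure of the samples: the deviations of the sums of `H` over the relevant
translates of the set of sample points from their expected value, relative to this value. -/
def badness {n : ℕ} (H : BinVec n → ℂ) (w : BinVec n) (vs : List (BinVec n)) : ℝ :=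
  9 / (4 ^ vs.length * ‖(∑ y, H y) / 2 ^ n‖ ^ 2) * ∑ t : Option (Fin n),
    ‖hsum (fun y => H y - (∑ y, H y) / 2 ^ n) (w + t.elim 0 fun j => Pi.single j 1) vs‖ ^ 2

/-- Two numbers within a third of a common number have a product, with one of them conjugated, of
positive real part. -/
theorem re_mul_star_pos {x y z : ℂ} (hx : 9 * ‖x - z‖ ^ 2 < ‖z‖ ^ 2)
    (hy : 9 * ‖y - z‖ ^ 2 < ‖z‖ ^ 2) : 0 < (x * star y).re := by
  have hx' : 3 * ‖x - z‖ < ‖z‖ := by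
    apply lt_of_pow_lt_pow_left₀ 2 (norm_nonneg z); linarith [mul_pow 3 ‖x - z‖ 2]
  have hy' : 3 * ‖y - z‖ < ‖z‖ := by
    apply lt_of_pow_lt_pow_left₀ 2 (norm_nonneg z); linarith [mul_pow 3 ‖y - z‖ 2]
  have e : (x * star y).re = ‖z‖ ^ 2 + ((x - z) * star z).re + (z * star (y - z)).re +
      ((x - z) * star (y - z)).re := by
    have hz : ‖z‖ ^ 2 = (z * star z).re := by
      rw [← Complex.normSq_eq_norm_sq]
      simp [Complex.normSq_apply]
    rw [hz, ← Complex.add_re, ← Complex.add_re, ← Complex.add_re, star_sub]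
    congr 1
    ring
  have hb : ∀ u v : ℂ, -(‖u‖ * ‖v‖) ≤ (u * star v).re := fun u v => by
    have := Complex.abs_re_le_norm (u * star v)
    rw [norm_mul, norm_star] at this
    exact (abs_le.1 this).1
  have h₁ := hb (x - z) z
  have h₂ := hb z (y - z)
  have h₃ := hb (x - z) (y - z)
  have hz : 0 < ‖z‖ := lt_of_le_of_lt (by positivity) hx'
  rw [e]
  nlinarith [norm_nonneg (x - z), norm_nonneg (y - z), mul_pos hz hz,
    mul_le_mul hx'.le hy'.le (by positivity) hz.le]

/-- If the samples are good, then the linear function that correlates with `H` is decoded. -/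
theorem linDec_eq {n : ℕ} {G : List (ZMod 2) → ℂ} {H : BinVec n → ℂ}
    (hG : ∀ y, y.length = n → G y = H (vec n y)) (a : BinVec n) {w : List (ZMod 2)}
    (hw : w.length = n) (vs : List (List (ZMod 2))) (h0 : ∑ y, sgn (a ⬝ᵥ y) * H y ≠ 0)
    (h : badness (fun y => sgn (a ⬝ᵥ y) * H y) (vec n w) (vs.map (vec n)) < 1) :
    linDec n G (points w vs (vs.map fun v => a ⬝ᵥ vec n v)) = List.ofFn a := by
  set H' : BinVec n → ℂ := fun y => sgn (a ⬝ᵥ y) * H y with hH'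
  set ρ : ℂ := (∑ y, H' y) / 2 ^ n with hρ
  set us := vs.map (vec n)
  have hρ0 : 0 < ‖ρ‖ := norm_pos_iff.2 (div_ne_zero h0 (pow_ne_zero n two_ne_zero))
  have hcorr : ∀ sh : List (ZMod 2), corr G (points w vs (vs.map fun v => a ⬝ᵥ vec n v)) sh =
      sgn (a ⬝ᵥ vec n w) * (sgn (a ⬝ᵥ vec n sh) * hsum H' (vec n w + vec n sh) us) := by
    intro sh
    rw [corr_eq_fsum hG fun x hx => (mem_points_length _ _ _ x hx).trans hw, fsum_points a hw,
      ← hsum_translate, ← hsum_mul_left _ (sgn (a ⬝ᵥ vec n sh))]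
    congr 2
    funext y
    rw [hH']
    simp only [dotProduct_add, sgn_add]
    linear_combination (-(sgn (a ⬝ᵥ y) * H (y + vec n sh))) * sgn_mul_self (a ⬝ᵥ vec n sh)
  have hdev : ∀ t : Option (Fin n), 9 * ‖hsum H' (vec n w + t.elim 0 fun j => Pi.single j 1) us -
      2 ^ us.length * ρ‖ ^ 2 < ‖(2 : ℂ) ^ us.length * ρ‖ ^ 2 := by
    intro t
    rw [badness, ← hρ, div_mul_eq_mul_div, div_lt_one (by positivity)] at h
    have := Finset.single_le_sum (f := fun t : Option (Fin n) =>
      ‖hsum (fun y => H' y - ρ) (vec n w + t.elim 0 fun j => Pi.single j 1) us‖ ^ 2)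
      (fun _ _ => by positivity) (Finset.mem_univ t)
    simp only [hsum_sub_const] at this h
    rw [norm_mul, norm_pow, Complex.norm_ofNat, mul_pow, ← pow_mul, mul_comm us.length 2, pow_mul]
    norm_num
    linarith
  apply List.ext_getElem (by simp [linDec])
  intro j hj₁ hj₂
  have hj : j < n := by simpa using hj₂
  simp only [linDec, List.getElem_map, List.getElem_range, List.getElem_ofFn, linBit]
  have hx := hdev (some ⟨j, hj⟩)
  have hy := hdev none
  simp only [Option.elim] at hx hy
  have hpos := re_mul_star_pos hx hy
  rw [hcorr, hcorr, vec_unitL ⟨j, hj⟩, vec_nil, dotProduct_zero, dotProduct_single, mul_one]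
  set X := hsum H' (vec n w + Pi.single ⟨j, hj⟩ 1) us
  set Y := hsum H' (vec n w + 0) us
  have hs := sgn_mul_self (a ⬝ᵥ vec n w)
  have e : sgn (a ⬝ᵥ vec n w) * (sgn (a ⟨j, hj⟩) * X) * star (sgn (a ⬝ᵥ vec n w) * (sgn 0 * Y)) =
      sgn (a ⟨j, hj⟩) * (X * star Y) := by
    rw [star_mul', star_mul', star_sgn, star_sgn]
    rw [show sgn 0 = 1 from if_pos rfl]
    linear_combination (sgn (a ⟨j, hj⟩) * X * star Y) * hs
  rw [e]
  rcases bit_cases (a ⟨j, hj⟩) with h1 | h1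
  · rw [h1, if_pos]
    simpa [sgn] using hpos.le
  · rw [h1, if_neg]
    rw [show sgn 1 = -1 from if_neg one_ne_zero, neg_one_mul, Complex.neg_re]
    linarith

/-- If the normalized mean of `H` is at least `δ`, then the samples fail rarely. -/
theorem avg_badness_le {n : ℕ} {H : BinVec n → ℂ} {B δ : ℝ} (hδ : 0 < δ) (hB : 0 < B)
    (hH : ∀ y, ‖H y‖ ≤ B) (hm : δ * B * 2 ^ n ≤ ‖∑ y, H y‖) {q : ℕ}
    (hq : 54 * (n + 1) ≤ δ ^ 2 * 2 ^ q) :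
    avg (n + q * n) (fun l => badness H (vec n (l.take n))
      ((chunks n q (l.drop n)).map (vec n))) ≤ 1 / 6 := by
  set ρ : ℂ := (∑ y, H y) / 2 ^ n with hρ
  have hρn : δ * B ≤ ‖ρ‖ := by
    rw [hρ, norm_div, norm_pow, Complex.norm_ofNat, le_div_iff₀ (by positivity)]
    exact hm
  set K : BinVec n → ℂ := fun y => H y - ρ with hK
  have hK0 : ∑ y, K y = 0 := by
    simp [hK, Finset.sum_sub_distrib, hρ]
    field_simp
    simp
  have hK2 : ∑ y, ‖K y‖ ^ 2 ≤ 2 ^ n * B ^ 2 := by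
    have h₁ : ∀ y, ‖K y‖ ^ 2 = ‖H y‖ ^ 2 - ‖ρ‖ ^ 2 - 2 * (K y * star ρ).re := by
      intro y
      have h₂ : H y = K y + ρ := by simp [hK]
      rw [h₂, ← Complex.normSq_eq_norm_sq, ← Complex.normSq_eq_norm_sq,
        ← Complex.normSq_eq_norm_sq, Complex.normSq_add]
      simp only [starRingEnd_apply]
      ring
    calc ∑ y, ‖K y‖ ^ 2 = ∑ y, (‖H y‖ ^ 2 - ‖ρ‖ ^ 2) := by
          rw [Finset.sum_congr rfl fun y _ => h₁ y, Finset.sum_sub_distrib, ← Finset.mul_sum,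
            ← Complex.re_sum, ← Finset.sum_mul, hK0]
          simp
      _ ≤ ∑ y : BinVec n, B ^ 2 := Finset.sum_le_sum fun y _ => by
          have := pow_le_pow_left₀ (norm_nonneg _) (hH y) 2
          nlinarith [sq_nonneg ‖ρ‖]
      _ = 2 ^ n * B ^ 2 := by simp
  have h₁ : avg (n + q * n) (fun l => badness H (vec n (l.take n))
      ((chunks n q (l.drop n)).map (vec n))) =
      avg (q * n) fun l => 9 / (4 ^ q * ‖ρ‖ ^ 2) * ((n + 1) / 2 ^ n *
        ∑ w, ‖hsum K w ((chunks n q l).map (vec n))‖ ^ 2) := by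
    rw [avg_append, avg_comm]
    refine avg_congr fun y _ => ?_
    rw [avg_eq_sum]
    have h₂ : ∀ x : BinVec n, badness H (vec n ((List.ofFn x ++ y).take n))
        ((chunks n q ((List.ofFn x ++ y).drop n)).map (vec n)) =
        9 / (4 ^ q * ‖ρ‖ ^ 2) * ∑ t : Option (Fin n),
          ‖hsum K (x + t.elim 0 fun j => Pi.single j 1) ((chunks n q y).map (vec n))‖ ^ 2 := by
      intro x
      rw [List.take_left' (by simp), List.drop_left' (by simp), vec_ofFn, badness]
      simp only [List.length_map, length_chunks, ← hρ, ← hK]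
    simp only [h₂]
    rw [← Finset.mul_sum, Finset.sum_comm, mul_div_assoc]
    congr 1
    have h₃ : ∀ t : Option (Fin n), ∑ x : BinVec n, ‖hsum K (x + t.elim 0 fun j => Pi.single j 1)
        ((chunks n q y).map (vec n))‖ ^ 2 =
        ∑ x, ‖hsum K x ((chunks n q y).map (vec n))‖ ^ 2 := fun t =>
      Equiv.sum_comp (Equiv.addRight (t.elim 0 fun j => Pi.single j 1 : BinVec n)) fun x =>
        ‖hsum K x ((chunks n q y).map (vec n))‖ ^ 2
    rw [Finset.sum_congr rfl fun t _ => h₃ t]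
    simp
    ring
  have hρ0 : 0 < ‖ρ‖ := lt_of_lt_of_le (by positivity) hρn
  rw [h₁, avg_mul_left, avg_mul_left, second_moment hK0]
  have h4 : (4 : ℝ) ^ q = 2 ^ q * 2 ^ q := by rw [← mul_pow]; norm_num
  calc 9 / (4 ^ q * ‖ρ‖ ^ 2) * ((n + 1) / 2 ^ n * (2 ^ q * ∑ w, ‖K w‖ ^ 2))
      ≤ 9 / (4 ^ q * ‖ρ‖ ^ 2) * ((n + 1) / 2 ^ n * (2 ^ q * (2 ^ n * B ^ 2))) := by gcongr
    _ = 9 * (n + 1) * B ^ 2 / (2 ^ q * ‖ρ‖ ^ 2) := by rw [h4]; field_simp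
    _ ≤ 1 / 6 := by
      rw [div_le_iff₀ (by positivity)]
      have h₅ : (δ * B) ^ 2 ≤ ‖ρ‖ ^ 2 := pow_le_pow_left₀ (by positivity) hρn 2
      have h₆ : 54 * (n + 1) * B ^ 2 ≤ δ ^ 2 * 2 ^ q * B ^ 2 := by gcongr
      have h₇ : 2 ^ q * (δ * B) ^ 2 ≤ 2 ^ q * ‖ρ‖ ^ 2 := by gcongr
      nlinarith

/-! ### Derivatives of correlated functions -/

/-- The extension of a vector by zeros, or its truncation. -/
def extend {d : ℕ} (n : ℕ) (x : BinVec d) : BinVec n :=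
  fun i => if h : (i : ℕ) < d then x ⟨i, h⟩ else 0

theorem extend_add {d : ℕ} (n : ℕ) (x y : BinVec d) :
    extend n (x + y) = extend n x + extend n y := by
  funext i
  simp only [extend, Pi.add_apply]
  split_ifs <;> simp

theorem extend_ne_zero {d n : ℕ} (h : d ≤ n) {x : BinVec d} (hx : x ≠ 0) : extend n x ≠ 0 := by
  intro h0
  refine hx (funext fun i => ?_)
  have := congrFun h0 ⟨i, i.2.trans_le h⟩
  simpa [extend] using this

theorem vec_add_self {n : ℕ} (x : BinVec n) : x + x = 0 := by
  funext i
  exact CharTwo.add_self_eq_zero (x i)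

/-- A function with a large mean has a large correlation with one of its translates, even if the
translations come from a rather small subspace. -/
theorem exists_derivative {n d : ℕ} (hd : d ≤ n) {H : BinVec n → ℂ} {b ε : ℝ} (hb : 0 < b)
    (hε : 0 < ε) (hH : ∀ y, ‖H y‖ ≤ b) (hm : ε * b * 2 ^ n ≤ ‖∑ y, H y‖)
    (h2 : 2 ≤ 2 ^ d * ε ^ 2) :
    ∃ e : BinVec n, e ≠ 0 ∧ (∀ i : Fin n, d ≤ i → e i = 0) ∧
      ε ^ 2 / 2 * b ^ 2 * 2 ^ n ≤ ‖∑ y, H y * star (H (y + e))‖ := by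
  by_contra! hcon
  set A : BinVec n → ℂ := fun e => ∑ y, H y * star (H (y + e)) with hA
  -- the second moment of the sums `g` over the cosets of the subspace is a sum of correlations
  set g : BinVec n → ℂ := fun y => ∑ x : BinVec d, H (y + extend n x) with hg
  have hsum : ∑ y, g y = 2 ^ d * ∑ y, H y := by
    have h₁ : ∀ x : BinVec d, ∑ y, H (y + extend n x) = ∑ y, H y := fun x =>
      Equiv.sum_comp (Equiv.addRight (extend n x : BinVec n)) H
    rw [hg, Finset.sum_comm, Finset.sum_congr rfl fun x _ => h₁ x]
    simp
  have hsq : (∑ y, ‖g y‖ ^ 2 : ℝ) = 2 ^ d * (∑ x : BinVec d, A (extend n x)).re := by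
    have h₁ : ∀ x x' : BinVec d, ∑ y, H (y + extend n x) * star (H (y + extend n x')) =
        A (extend n (x + x')) := by
      intro x x'
      rw [hA, ← Equiv.sum_comp (Equiv.addRight (extend n x : BinVec n))]
      refine Finset.sum_congr rfl fun y _ => ?_
      simp only [Equiv.coe_addRight, extend_add]
      rw [add_assoc, vec_add_self, add_zero, add_assoc]
    have h₂ : ∀ y, ‖g y‖ ^ 2 = (g y * star (g y)).re := by
      intro y
      rw [← Complex.normSq_eq_norm_sq]
      simp [Complex.normSq_apply]
    have h₃ : ∑ y, g y * star (g y) = 2 ^ d * ∑ x : BinVec d, A (extend n x) := by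
      simp only [hg, star_sum, Finset.sum_mul_sum]
      rw [Finset.sum_comm]
      have h₄ : ∀ x : BinVec d, ∑ y, ∑ x' : BinVec d,
          H (y + extend n x) * star (H (y + extend n x')) = ∑ x : BinVec d, A (extend n x) := by
        intro x
        rw [Finset.sum_comm, Finset.sum_congr rfl fun x' _ => h₁ x x']
        exact Equiv.sum_comp (Equiv.addLeft x) fun x => A (extend n x)
      rw [Finset.sum_congr rfl fun x _ => h₄ x]
      simp
    rw [Finset.sum_congr rfl fun y _ => h₂ y, ← Complex.re_sum, h₃,
      show (2 : ℂ) ^ d = ((2 ^ d : ℝ) : ℂ) by push_cast; rfl, Complex.re_ofReal_mul]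
  have hcs : (2 ^ d * (ε * b * 2 ^ n)) ^ 2 ≤ 2 ^ n * ∑ y, ‖g y‖ ^ 2 := by
    have h₁ : 2 ^ d * (ε * b * 2 ^ n) ≤ ∑ y, ‖g y‖ := by
      refine le_trans ?_ (norm_sum_le _ _)
      rw [hsum, norm_mul, norm_pow, Complex.norm_ofNat]
      gcongr
    refine (pow_le_pow_left₀ (by positivity) h₁ 2).trans ?_
    have := sq_sum_le_card_mul_sum_sq (s := Finset.univ) (f := fun y => ‖g y‖)
    simpa using this
  have h0 : ‖A 0‖ ≤ b ^ 2 * 2 ^ n := by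
    refine (norm_sum_le _ _).trans ?_
    calc ∑ y, ‖H y * star (H (y + 0))‖ ≤ ∑ y : BinVec n, b ^ 2 := Finset.sum_le_sum fun y _ => by
          rw [add_zero, norm_mul, norm_star, ← sq]
          exact pow_le_pow_left₀ (norm_nonneg _) (hH y) 2
      _ = b ^ 2 * 2 ^ n := by simp [mul_comm]
  have hup : (∑ x : BinVec d, A (extend n x)).re <
      b ^ 2 * 2 ^ n + 2 ^ d * (ε ^ 2 / 2 * b ^ 2 * 2 ^ n) := by
    have h₁ : extend n (0 : BinVec d) = 0 := by
      funext i
      simp [extend]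
    have h₂ : ∀ x ∈ Finset.univ.erase (0 : BinVec d),
        (A (extend n x)).re ≤ ε ^ 2 / 2 * b ^ 2 * 2 ^ n := fun x hx =>
      (Complex.re_le_norm _).trans (hcon _ (extend_ne_zero hd (Finset.ne_of_mem_erase hx))
        fun i hi => by simp [extend, not_lt.2 hi]).le
    have h₃ := Finset.sum_le_sum h₂
    rw [Complex.re_sum, ← Finset.add_sum_erase _ _ (Finset.mem_univ (0 : BinVec d)), h₁]
    simp only [Finset.sum_const, nsmul_eq_mul] at h₃
    rw [Finset.card_erase_of_mem (Finset.mem_univ _),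
      Nat.cast_pred (Finset.card_pos.2 ⟨0, by simp⟩)] at h₃
    simp only [Finset.card_univ, Fintype.card_fun, ZMod.card, Fintype.card_fin, Nat.cast_pow,
      Nat.cast_ofNat] at h₃
    have h₄ := (Complex.re_le_norm (A 0)).trans h0
    have h₅ : 0 < ε ^ 2 / 2 * b ^ 2 * 2 ^ n := by positivity
    linarith
  rw [hsq] at hcs
  have h₆ : b ^ 2 * 2 ^ n + 2 ^ d * (ε ^ 2 / 2 * b ^ 2 * 2 ^ n) ≤
      2 ^ d * ε ^ 2 * b ^ 2 * 2 ^ n := by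
    have : 2 * (b ^ 2 * 2 ^ n) ≤ 2 ^ d * ε ^ 2 * (b ^ 2 * 2 ^ n) := by gcongr
    linarith
  have h₇ := mul_lt_mul_of_pos_left (hup.trans_le h₆) (show (0 : ℝ) < 2 ^ n * 2 ^ d by positivity)
  nlinarith

/-! ### Truncation of the signal -/

theorem mul_star_re (z : ℂ) : (z * star z).re = ‖z‖ ^ 2 := by
  rw [← Complex.normSq_eq_norm_sq]
  simp [Complex.normSq_apply]

/-- The signal, with zeros at the positions where it is large. -/
def cut {n : ℕ} (s : BinVec n → ℂ) (T : ℝ) (y : BinVec n) : ℂ :=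
  open Classical in if ‖s y‖ ^ 2 ≤ T then s y else 0

theorem norm_cut_le {n : ℕ} (s : BinVec n → ℂ) {b : ℝ} (hb : 0 ≤ b) (y : BinVec n) :
    ‖cut s (b ^ 2) y‖ ≤ b := by
  unfold cut
  split_ifs with h
  · exact le_of_sq_le_sq h hb
  · simpa using hb

/-- A coordinate of more than `b` contributes at least `b` times as much to the sum of squares as
to the sum, so truncation affects correlations only slightly. -/
theorem norm_sub_cut_le {n : ℕ} (s : BinVec n → ℂ) {b : ℝ} (hb : 0 < b) (y : BinVec n) :
    ‖s y - cut s (b ^ 2) y‖ ≤ ‖s y‖ ^ 2 / b := by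
  unfold cut
  split_ifs with h
  · simp; positivity
  · rw [sub_zero, le_div_iff₀ hb, sq]
    have := lt_of_pow_lt_pow_left₀ 2 (norm_nonneg _) (not_le.1 h)
    gcongr

/-- Truncation at a sufficiently high level preserves half of a correlation with a phase. Here `a`
is the quadratic mean of the signal. -/
theorem correlation_cut {n : ℕ} {s φ : BinVec n → ℂ} (hφ : ∀ y, ‖φ y‖ = 1) {a r b : ℝ}
    (hb : 0 < b) (ha : ∑ y, ‖s y‖ ^ 2 = a ^ 2 * 2 ^ n) (hr : 0 < r)
    (hab : 2 * r * a ≤ b) (h : a / r * 2 ^ n ≤ ‖∑ y, s y * φ y‖) (ha0 : 0 < a) :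
    a / (2 * r) * 2 ^ n ≤ ‖∑ y, cut s (b ^ 2) y * φ y‖ := by
  have h₁ : ‖∑ y, s y * φ y‖ ≤ ‖∑ y, cut s (b ^ 2) y * φ y‖ + a ^ 2 * 2 ^ n / b := by
    have : ∑ y, s y * φ y = ∑ y, cut s (b ^ 2) y * φ y +
        ∑ y, (s y - cut s (b ^ 2) y) * φ y := by
      rw [← Finset.sum_add_distrib]
      exact Finset.sum_congr rfl fun y _ => by ring
    rw [this, ← ha, Finset.sum_div]
    refine (norm_add_le _ _).trans (add_le_add_right ((norm_sum_le _ _).trans ?_) _)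
    refine Finset.sum_le_sum fun y _ => ?_
    rw [norm_mul, hφ, mul_one]
    exact norm_sub_cut_le s hb y
  have h₂ : a ^ 2 * 2 ^ n / b ≤ a / (2 * r) * 2 ^ n := by
    rw [div_le_iff₀ hb]
    calc a ^ 2 * 2 ^ n = a / (2 * r) * 2 ^ n * (2 * r * a) := by field_simp
      _ ≤ _ := by gcongr
  have h₃ : a / r * 2 ^ n = a / (2 * r) * 2 ^ n + a / (2 * r) * 2 ^ n := by field_simp; ring
  linarith

/-- A signal that correlates with a phase is of the order of its quadratic mean at many positions.
-/
theorem card_typical {n : ℕ} {s φ : BinVec n → ℂ} (hφ : ∀ y, ‖φ y‖ = 1) {a r : ℝ}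
    (ha : ∑ y, ‖s y‖ ^ 2 = a ^ 2 * 2 ^ n) (hr : 0 < r) (ha0 : 0 < a)
    (h : a / r * 2 ^ n ≤ ‖∑ y, s y * φ y‖) :
    2 ^ n / (8 * r ^ 2) ≤ ∑ y, open Classical in
      if a / (4 * r) ≤ ‖s y‖ ∧ ‖s y‖ ≤ 2 * r * a then (1 : ℝ) else 0 := by
  classical
  set χ : BinVec n → ℝ := fun y => if a / (4 * r) ≤ ‖s y‖ ∧ ‖s y‖ ≤ 2 * r * a then 1 else 0
  have h₁ : ∀ y, ‖s y‖ ≤ a / (4 * r) + 2 * r * a * χ y + ‖s y‖ ^ 2 / (2 * r * a) := by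
    intro y
    by_cases h₂ : a / (4 * r) ≤ ‖s y‖
    · by_cases h₃ : ‖s y‖ ≤ 2 * r * a
      · have : χ y = 1 := if_pos ⟨h₂, h₃⟩
        rw [this, mul_one]
        have : 0 ≤ a / (4 * r) + ‖s y‖ ^ 2 / (2 * r * a) := by positivity
        linarith
      · have : χ y = 0 := if_neg fun h => h₃ h.2
        rw [this, mul_zero, add_zero]
        have h₄ : ‖s y‖ ≤ ‖s y‖ ^ 2 / (2 * r * a) := by
          rw [le_div_iff₀ (by positivity), sq]
          have := (not_le.1 h₃).le
          gcongr
        have : 0 ≤ a / (4 * r) := by positivity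
        linarith
    · have : χ y = 0 := if_neg fun h => h₂ h.1
      rw [this, mul_zero, add_zero]
      have : 0 ≤ ‖s y‖ ^ 2 / (2 * r * a) := by positivity
      linarith
  have h₂ : a / r * 2 ^ n ≤ a / (4 * r) * 2 ^ n + 2 * r * a * ∑ y, χ y +
      a ^ 2 * 2 ^ n / (2 * r * a) := by
    refine h.trans ((norm_sum_le _ _).trans ?_)
    calc ∑ y, ‖s y * φ y‖ = ∑ y, ‖s y‖ := by simp [hφ]
      _ ≤ ∑ y, (a / (4 * r) + 2 * r * a * χ y + ‖s y‖ ^ 2 / (2 * r * a)) :=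
        Finset.sum_le_sum fun y _ => h₁ y
      _ = _ := by
        rw [Finset.sum_add_distrib, Finset.sum_add_distrib, ← Finset.mul_sum,
          ← Finset.sum_div Finset.univ (fun y => ‖s y‖ ^ 2), ha]
        simp
        ring
  have h₃ : a ^ 2 * 2 ^ n / (2 * r * a) = a / (2 * r) * 2 ^ n := by field_simp
  have h₄ : a / r * 2 ^ n = a / (4 * r) * 2 ^ n + a / (4 * r) * 2 ^ n + a / (2 * r) * 2 ^ n := by
    field_simp; ring
  have h₅ : a / (4 * r) * 2 ^ n ≤ 2 * r * a * ∑ y, χ y := by linarith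
  rw [div_le_iff₀ (by positivity)]
  have h₆ : a * 2 ^ n ≤ a * ((∑ y, χ y) * (8 * r ^ 2)) := by
    have := mul_le_mul_of_nonneg_left h₅ (show 0 ≤ 4 * r by positivity)
    calc a * 2 ^ n = 4 * r * (a / (4 * r) * 2 ^ n) := by field_simp
      _ ≤ _ := this
      _ = _ := by ring
  exact le_of_mul_le_mul_left h₆ ha0

/-! ### Correctness of the recovery of a Hankel matrix -/

/-- The first `m` terms of a sequence in reverse order. -/
def revTerms (p : ℕ → ZMod 2) (m : ℕ) : List (ZMod 2) := ((List.range m).map p).reverse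

theorem revTerms_succ (p : ℕ → ZMod 2) (m : ℕ) : revTerms p (m + 1) = p m :: revTerms p m := by
  simp [revTerms, List.range_succ]

theorem getD_revTerms (p : ℕ → ZMod 2) {m r : ℕ} (h : r < m) :
    (revTerms p m).getD r 0 = p (m - 1 - r) := by
  rw [List.getD_eq_getElem _ _ (by simpa [revTerms] using h)]
  simp [revTerms]

theorem dotL_eq_sum (f x : List (ZMod 2)) :
    dotL f x = ∑ r ∈ Finset.range f.length, f.getD r 0 * x.getD r 0 := by
  induction f generalizing x with
  | nil => simp [dotL]
  | cons a f ih =>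
    rw [dotL, List.length_cons, Finset.sum_range_succ', ih, add_comm]
    congr 1
    · refine Finset.sum_congr rfl fun r _ => ?_
      cases x <;> simp
    · cases x <;> simp

theorem strip_eq (z : ℕ) (f g : List (ZMod 2)) :
    strip (List.replicate z 0 ++ 1 :: f) g = (1 :: f, g.drop z) := by
  have h₁ : ∀ (l : List (ZMod 2)) (g : List (ZMod 2)),
      l.foldl (fun d _ => if d.1.headD 0 ≠ 0 then d else (d.1.tail, d.2.tail)) (1 :: f, g) =
        (1 :: f, g) := by
    intro l g
    induction l with
    | nil => rfl
    | cons a l ih =>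
      rw [List.foldl_cons, if_pos (by simp)]
      exact ih
  have h₂ : ∀ (z : ℕ) (l g : List (ZMod 2)), z ≤ l.length →
      l.foldl (fun d _ => if d.1.headD 0 ≠ 0 then d else (d.1.tail, d.2.tail))
        (List.replicate z 0 ++ 1 :: f, g) = (1 :: f, g.drop z) := by
    intro z
    induction z with
    | zero => intro l g _; exact h₁ l g
    | succ z ih =>
      intro l g hl
      cases l with
      | nil => simp at hl
      | cons a l =>
        rw [List.foldl_cons, if_neg (by simp [List.replicate_succ])]
        rw [← List.drop_tail]
        exact ih l g.tail (by simpa using hl)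
  exact h₂ z _ g (by simp)

/-- A sequence is determined by a linear recurrence with known inhomogeneous terms; as long as the
recurrence does not apply yet, these terms are guessed. -/
theorem exists_solve_eq (n z : ℕ) (f : List (ZMod 2)) (p : ℕ → ZMod 2) :
    ∃ g : List (ZMod 2), g.length = z + 1 + f.length ∧ ∀ c : List (ZMod 2),
      (∀ i, i + f.length < n →
        c.getD i 0 = p (i + f.length) + dotL f (revTerms p (i + f.length))) →
      solve n (List.replicate z 0 ++ 1 :: f) g c = revTerms p n := by
  set q : ℕ → ZMod 2 := fun m => p m + dotL f (revTerms p m) with hq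
  refine ⟨List.replicate (z + 1) 0 ++ (List.range f.length).map q, by simp, fun c h => ?_⟩
  have hfeed : ((List.replicate (z + 1) (0 : ZMod 2) ++ (List.range f.length).map q).drop z).tail =
      (List.range f.length).map q := by
    rw [List.tail_drop, List.drop_left' (by simp)]
  rw [solve, strip_eq]
  simp only [List.tail_cons]
  rw [hfeed]
  set feed := (List.range f.length).map q ++ c with hf
  have hget : ∀ m, m < n → feed.getD m 0 = q m := by
    intro m hm
    by_cases hm' : m < f.length
    · rw [hf, List.getD_append _ _ _ _ (by simpa using hm'),
        List.getD_eq_getElem _ _ (by simpa using hm')]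
      simp
    · rw [hf, List.getD_append_right _ _ _ _ (by simpa using hm')]
      have := h (m - f.length) (by omega)
      rw [Nat.sub_add_cancel (by omega)] at this
      simpa using this
  have : ∀ m, m ≤ n → ((fun d : List (ZMod 2) × List (ZMod 2) =>
      (d.1.tail, (d.1.headD 0 + dotL f d.2) :: d.2))^[m] (feed, [])) =
        (feed.drop m, revTerms p m) := by
    intro m
    induction m with
    | zero => intro _; rfl
    | succ m ih =>
      intro hm
      rw [Function.iterate_succ_apply', ih (by omega)]
      have h₁ : (feed.drop m).headD 0 = q m := by
        rw [← hget m (by omega)]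
        simp [List.headD_eq_head?_getD, List.getD_eq_getElem?_getD]
      rw [h₁, revTerms_succ, hq]
      simp only [List.tail_drop]
      rw [add_assoc, CharTwo.add_self_eq_zero, add_zero]
  rw [this n le_rfl]

/-- A nonzero vector in decreasing order of its entries, without entries that are known to be
zero. -/
theorem exists_leading {n D : ℕ} {e : BinVec n} (he : e ≠ 0) (hD : D ≤ n)
    (h : ∀ i : Fin n, D ≤ i → e i = 0) : ∃ (z : ℕ) (f : List (ZMod 2)), z + 1 + f.length = D ∧
      vec n (List.replicate z 0 ++ 1 :: f).reverse = e := by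
  have key : ∀ D, D ≤ n → (∀ i : Fin n, D ≤ i → e i = 0) → ∃ (z : ℕ) (f : List (ZMod 2)),
      z + 1 + f.length = D ∧
      (List.replicate z 0 ++ 1 :: f).reverse = (List.ofFn e).take D := by
    intro D
    induction D with
    | zero =>
      intro _ h
      exact absurd (funext fun i => h i (Nat.zero_le _)) he
    | succ D ih =>
      intro hD h
      have ht : (List.ofFn e).take (D + 1) = (List.ofFn e).take D ++ [e ⟨D, hD⟩] := by
        rw [List.take_succ_eq_append_getElem (by simpa using hD)]
        simp
      rcases bit_cases (e ⟨D, hD⟩) with h0 | h1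
      · obtain ⟨z, f, hz, hr⟩ := ih (by omega) fun i hi => by
          rcases Nat.eq_or_lt_of_le hi with hi | hi
          · rw [← h0]; congr 1; exact Fin.ext hi.symm
          · exact h i hi
        refine ⟨z + 1, f, by omega, ?_⟩
        rw [List.replicate_succ, List.cons_append, List.reverse_cons, hr, ht, h0]
      · refine ⟨0, ((List.ofFn e).take D).reverse, by simp; omega, ?_⟩
        simp [ht, h1]
  obtain ⟨z, f, hz, hr⟩ := key D hD h
  refine ⟨z, f, hz, ?_⟩
  rw [hr]
  funext i
  simp only [vec]
  by_cases hi : (i : ℕ) < D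
  · rw [List.getD_eq_getElem _ _ (by simp; omega)]
    simp
  · rw [List.getD_eq_default _ _ (by simp; omega), h i (by omega)]

theorem norm_phase {n : ℕ} (P : BinMat n) (l y : BinVec n) :
    ‖star (Complex.I ^ phase P l y)‖ = 1 := by
  simp

/-- If a signal correlates with the phase of a symmetric matrix, then its derivative correlates
with a linear function. -/
theorem sum_derivative {n : ℕ} {P : BinMat n} (hP : P.IsSymm) (l e : BinVec n) (F : BinVec n → ℂ) :
    ‖∑ y, sgn (P.mulVec e ⬝ᵥ y) * (F y * star (F (y + e)))‖ =
      ‖∑ y, F y * star (Complex.I ^ phase P l y) *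
        star (F (y + e) * star (Complex.I ^ phase P l (y + e)))‖ := by
  have h : ∀ y, F y * star (Complex.I ^ phase P l y) *
      star (F (y + e) * star (Complex.I ^ phase P l (y + e))) = Complex.I ^ phase P l e *
        (sgn (P.mulVec e ⬝ᵥ y) * (F y * star (F (y + e)))) := by
    intro y
    have h₁ : Complex.I ^ phase P l y * star (Complex.I ^ phase P l y) = 1 := by
      rw [← starRingEnd_apply, Complex.mul_conj, Complex.normSq_eq_norm_sq]
      simp
    rw [star_mul', star_star, I_pow_phase_add hP]
    linear_combination (Complex.I ^ phase P l e *
        (sgn (P.mulVec e ⬝ᵥ y) * (F y * star (F (y + e))))) * h₁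
  rw [Finset.sum_congr rfl fun y _ => h y, ← Finset.mul_sum, norm_mul]
  simp

/-- With suitable guesses, half of the reverse diagonals are recovered from all sample points that
are good for a certain function with a large mean. -/
theorem exists_recover_eq {n D : ℕ} (hD1 : 1 ≤ D) {G : List (ZMod 2) → ℂ} {F : BinVec n → ℂ}
    (hG : ∀ y, y.length = n → G y = F (vec n y)) {P : BinMat n} (hP : P.IsSymm) {p : ℕ → ZMod 2}
    (hp : ∀ i j : Fin n, (i : ℕ) + j < n → P i j = p (i + j)) (l : BinVec n) {b ε : ℝ} (hb : 0 < b)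
    (hε : 0 < ε) (hε1 : ε ≤ 1) (hF : ∀ y, ‖F y‖ ≤ b)
    (hm : ε * b * 2 ^ n ≤ ‖∑ y, F y * star (Complex.I ^ phase P l y)‖)
    (h2 : 2 ≤ 2 ^ D * ε ^ 2) :
    ∃ (u g : List (ZMod 2)) (a : BinVec n) (H : BinVec n → ℂ), u.length = D ∧ g.length = D ∧
      (∀ y, ‖H y‖ ≤ b ^ 2) ∧ ε ^ 2 / 2 * b ^ 2 * 2 ^ n ≤ ‖∑ y, H y‖ ∧
      ∀ (w : List (ZMod 2)) (vs : List (List (ZMod 2))), w.length = n →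
        badness H (vec n w) (vs.map (vec n)) < 1 →
        recover n G w vs u g (vs.map fun v => a ⬝ᵥ vec n v) = revTerms p n := by
  by_cases hD : D ≤ n
  · obtain ⟨e, he0, he, hcor⟩ := exists_derivative hD
      (H := fun y => F y * star (Complex.I ^ phase P l y)) hb hε
      (fun y => by rw [norm_mul, norm_phase, mul_one]; exact hF y) hm h2
    rw [← sum_derivative hP] at hcor
    obtain ⟨z, f, hz, hvec⟩ := exists_leading he0 hD he
    -- the linear function of the derivative is a combination of consecutive reverse diagonals, with
    -- the leading coefficient one
    have hrec : ∀ i, i + f.length < n → (List.ofFn (P.mulVec e)).getD i 0 =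
        p (i + f.length) + dotL f (revTerms p (i + f.length)) := by
      intro i hi
      have hin : i < n := by omega
      rw [List.getD_eq_getElem _ _ (by simpa using hin), List.getElem_ofFn, dotL_eq_sum]
      have hsum : P.mulVec e ⟨i, hin⟩ =
          ∑ j ∈ Finset.range n, p (i + j) * (List.replicate z 0 ++ 1 :: f).reverse.getD j 0 := by
        rw [← Fin.sum_univ_eq_sum_range (fun j : ℕ =>
          p (i + j) * (List.replicate z (0 : ZMod 2) ++ 1 :: f).reverse.getD j 0) n]
        simp only [Matrix.mulVec, dotProduct]
        refine Finset.sum_congr rfl fun j _ => ?_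
        have hj : (List.replicate z 0 ++ 1 :: f).reverse.getD j 0 = e j := congrFun hvec j
        rw [hj]
        by_cases hij : i + (j : ℕ) < n
        · rw [hp ⟨i, hin⟩ j hij]
        · have : e j = 0 := by
            rw [← hj]
            simp only [List.reverse_append, List.reverse_cons, List.reverse_replicate]
            rw [List.getD_append_right _ _ _ _ (by simp; omega)]
            rw [List.getD_eq_getElem?_getD, List.getElem?_replicate]
            split_ifs <;> rfl
          rw [this, mul_zero, mul_zero]
      have hsplit : ∀ j, (List.replicate z 0 ++ 1 :: f).reverse.getD j 0 =
          if j < f.length then f.getD (f.length - 1 - j) 0 else if j = f.length then 1 else 0 := by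
        intro j
        simp only [List.reverse_append, List.reverse_cons, List.reverse_replicate,
          List.append_assoc]
        split_ifs with h₁ h₂
        · rw [List.getD_append _ _ _ _ (by simpa using h₁),
            List.getD_eq_getElem _ _ (by simpa using h₁), List.getD_eq_getElem _ _ (by omega)]
          simp
        · rw [List.getD_append_right _ _ _ _ (by simp; omega)]
          simp [h₂]
        · rw [List.getD_append_right _ _ _ _ (by simp; omega),
            List.getD_append_right _ _ _ _ (by simp; omega),
            List.getD_eq_getElem?_getD, List.getElem?_replicate]
          split_ifs <;> rfl
      rw [hsum, ← Finset.sum_subset (Finset.range_subset_range.2 (show f.length + 1 ≤ n by omega))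
        fun j _ hj => ?_]
      · rw [Finset.sum_range_succ, hsplit f.length, if_neg (lt_irrefl _), if_pos rfl, mul_one,
          add_comm, ← Finset.sum_range_reflect]
        congr 1
        refine Finset.sum_congr rfl fun r hr => ?_
        have hr' := Finset.mem_range.1 hr
        rw [hsplit, if_pos (by omega), getD_revTerms p (by omega), mul_comm]
        congr 2 <;> omega
      · have hj' : ¬ j < f.length + 1 := fun h => hj (Finset.mem_range.2 h)
        rw [hsplit, if_neg (by omega), if_neg (by omega), mul_zero]
    obtain ⟨g, hg, hsolve⟩ := exists_solve_eq n z f p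
    refine ⟨List.replicate z 0 ++ 1 :: f, g, P.mulVec e,
      fun y => sgn (P.mulVec e ⬝ᵥ y) * (F y * star (F (y + e))), by simp; omega, hg.trans hz,
      fun y => ?_, hcor, ?_⟩
    · rw [norm_mul, norm_mul, norm_sgn, norm_star, one_mul, sq]
      exact mul_le_mul (hF _) (hF _) (norm_nonneg _) hb.le
    · intro w vs hw hbad
      rw [recover, linDec_eq (H := fun y => F y * star (F (y + e))) ?_ (P.mulVec e) hw vs ?_ hbad]
      · exact hsolve _ hrec
      · intro y hy
        rw [hG y hy, hG _ ((length_addL _ _).trans hy), vec_addL hy, hvec]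
      · exact norm_pos_iff.1 (lt_of_lt_of_le (by positivity) hcor)
  · -- With at least `n` guessed bits, the reverse diagonals are guessed directly.
    obtain ⟨g, hg, hsolve⟩ := exists_solve_eq n 0 (List.replicate (D - 1) 0) p
    refine ⟨1 :: List.replicate (D - 1) 0, g, 0, fun _ => ((b ^ 2 : ℝ) : ℂ), by simp; omega,
      hg.trans (by simp; omega), fun _ => ?_, ?_, fun w vs _ _ => hsolve _ fun i hi => absurd hi ?_⟩
    · rw [Complex.norm_real, Real.norm_of_nonneg (by positivity)]
    · have : ε ^ 2 / 2 ≤ 1 := by nlinarith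
      simp only [Finset.sum_const, nsmul_eq_mul, norm_mul, Complex.norm_real,
        Real.norm_of_nonneg (show 0 ≤ b ^ 2 by positivity)]
      simp only [Finset.card_univ, Fintype.card_fun, ZMod.card, Fintype.card_fin, Nat.cast_pow,
        Nat.cast_ofNat, norm_pow, Complex.norm_ofNat]
      calc ε ^ 2 / 2 * b ^ 2 * 2 ^ n ≤ 1 * b ^ 2 * 2 ^ n := by gcongr
        _ = 2 ^ n * b ^ 2 := by ring
    · rw [List.length_replicate]; omega

/-! ### Hankel matrices and their reverse diagonals -/

/-- The reverse diagonals of a matrix, read off its first row and its last column. -/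
def diag {n : ℕ} (P : BinMat n) (m : ℕ) : ZMod 2 :=
  if h : m < n then P ⟨0, by omega⟩ ⟨m, h⟩
  else if h : m - (n - 1) < n then P ⟨m - (n - 1), h⟩ ⟨n - 1, by omega⟩ else 0

theorem IsHankel.eq_diag {n : ℕ} {P : BinMat n} (hP : IsHankel P) (i j : Fin n) :
    P i j = diag P (i + j) := by
  have := i.2
  have := j.2
  unfold diag
  split_ifs with h₁ h₂
  · exact hP _ _ _ _ (by simp)
  · exact hP _ _ _ _ (by simp; omega)
  · omega

theorem IsHankel.isSymm {n : ℕ} {P : BinMat n} (hP : IsHankel P) : P.IsSymm := by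
  ext i j
  exact hP _ _ _ _ (add_comm _ _)

/-- The matrix of a quadratic form in the reversed coordinates. -/
def revMat {n : ℕ} (P : BinMat n) : BinMat n := P.submatrix Fin.rev Fin.rev

theorem phase_revMat {n : ℕ} (P : BinMat n) (l y : BinVec n) :
    phase (revMat P) (l ∘ Fin.rev) (y ∘ Fin.rev) = phase P l y := by
  unfold phase revMat
  congr 1
  · rw [← Equiv.sum_comp Fin.revPerm]
    refine Finset.sum_congr rfl fun i _ => ?_
    rw [← Equiv.sum_comp Fin.revPerm]
    simp
  · rw [← Equiv.sum_comp Fin.revPerm]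
    simp

theorem vec_reverse {n : ℕ} {y : List (ZMod 2)} (hy : y.length = n) :
    vec n y.reverse = vec n y ∘ Fin.rev := by
  funext i
  have := i.2
  simp only [vec, Function.comp, Fin.val_rev]
  rw [List.getD_eq_getElem _ _ (by simp; omega), List.getD_eq_getElem _ _ (by omega),
    List.getElem_reverse]
  congr 1
  omega

/-- The list of all reverse diagonals, composed of its two halves. -/
def diagList {n : ℕ} (P : BinMat n) : List (ZMod 2) :=
  (revTerms (diag P) n).tail.reverse ++ revTerms (fun m => diag P (2 * n - 2 - m)) n

theorem getD_diagList {n : ℕ} (P : BinMat n) {m : ℕ} (h : m < 2 * n - 1) :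
    (diagList P).getD m 0 = diag P m := by
  obtain ⟨n, rfl⟩ : ∃ n', n = n' + 1 := ⟨n - 1, by omega⟩
  rw [diagList, revTerms_succ, List.tail_cons]
  by_cases hm : m < n
  · rw [List.getD_append _ _ _ _ (by simpa [revTerms] using hm),
      List.getD_eq_getElem _ _ (by simpa [revTerms] using hm)]
    simp [revTerms]
  · rw [List.getD_append_right _ _ _ _ (by simp [revTerms]; omega),
      getD_revTerms _ (by simp [revTerms]; omega)]
    congr 1
    simp [revTerms]
    omega

/-! ### The quadratic form of a Hankel matrix -/

theorem overlap_cons (p : List (ZMod 2)) (a : ZMod 2) (y : List (ZMod 2)) :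
    overlap p (a :: y) = (p.headD 0).val * a.val + overlap p.tail y := by
  have h : overlap p (a :: y) = (y.foldl (fun d b => (d.1.tail,
      if b ≠ 0 then (if d.1.headD 0 ≠ 0 then d.2 + 1 else d.2) else d.2))
      (p.tail, if a ≠ 0 then (if p.headD 0 ≠ 0 then 0 + 1 else 0) else 0)).2 := rfl
  rw [h, foldl_overlap]
  rcases bit_cases a with rfl | rfl <;> rcases bit_cases (p.headD 0) with h | h <;>
    rw [h] <;> simp [ZMod.val_one]

theorem overlap_eq_sum (p y : List (ZMod 2)) :
    overlap p y = ∑ j ∈ Finset.range y.length, (p.getD j 0).val * (y.getD j 0).val := by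
  induction y generalizing p with
  | nil => rfl
  | cons a y ih =>
    rw [overlap_cons, List.length_cons, Finset.sum_range_succ', ih, add_comm]
    congr 1
    · refine Finset.sum_congr rfl fun r _ => ?_
      cases p <;> simp
    · cases p <;> simp

theorem quadL_eq_sum (p y : List (ZMod 2)) :
    quadL p y = ∑ i ∈ Finset.range y.length, ∑ j ∈ Finset.range y.length,
      (y.getD i 0).val * (p.getD (i + j) 0).val * (y.getD j 0).val := by
  have h : ∀ (z p : List (ZMod 2)) (k : ℕ), (z.foldl (fun (d : List (ZMod 2) × ℕ) a =>
      (d.1.tail, if a ≠ 0 then d.2 + overlap d.1 y else d.2)) (p, k)).2 =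
      k + ∑ i ∈ Finset.range z.length, (z.getD i 0).val * overlap (p.drop i) y := by
    intro z
    induction z with
    | nil => intro p k; rfl
    | cons a z ih =>
      intro p k
      rw [List.foldl_cons]
      refine (ih _ _).trans ?_
      rw [List.length_cons, Finset.sum_range_succ']
      simp only [List.drop_tail, List.getD_cons_succ, List.getD_cons_zero, List.drop_zero]
      rcases bit_cases a with rfl | rfl
      · simp
      · simp [ZMod.val_one]; ring
  refine (h y p 0).trans ?_
  rw [zero_add]
  refine Finset.sum_congr rfl fun i _ => ?_
  rw [overlap_eq_sum, Finset.mul_sum]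
  refine Finset.sum_congr rfl fun j _ => ?_
  rw [← mul_assoc]
  congr 3
  simp [List.getD_eq_getElem?_getD]

theorem IsHankel.quadL_diagList {n : ℕ} {P : BinMat n} (hP : IsHankel P) {y : List (ZMod 2)}
    (hy : y.length = n) : quadL (diagList P) y = phase P 0 (vec n y) := by
  rw [quadL_eq_sum, hy, phase]
  simp only [Pi.zero_apply, ZMod.val_zero, zero_mul, Finset.sum_const_zero, mul_zero, add_zero]
  rw [← Fin.sum_univ_eq_sum_range (fun i => ∑ j ∈ Finset.range n,
    (y.getD i 0).val * ((diagList P).getD (i + j) 0).val * (y.getD j 0).val) n]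
  refine Finset.sum_congr rfl fun i _ => ?_
  rw [← Fin.sum_univ_eq_sum_range (fun j =>
    (y.getD i 0).val * ((diagList P).getD (i + j) 0).val * (y.getD j 0).val) n]
  refine Finset.sum_congr rfl fun j _ => ?_
  rw [getD_diagList P (by omega), hP.eq_diag i j]
  rfl

/-- The vector `l` enters the phase only by a sign. -/
theorem star_I_pow_phase {n : ℕ} (P : BinMat n) (l y : BinVec n) :
    sgn (l ⬝ᵥ y) * star (Complex.I ^ phase P 0 y) = star (Complex.I ^ phase P l y) := by
  rw [← star_sgn, ← star_mul', sgn_eq, ← pow_add]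
  congr 1
  apply I_pow_congr
  have h : (2 * ((l ⬝ᵥ y).val : ZMod 4)) = 2 * ∑ i, ((l i * y i).val : ZMod 4) :=
    two_mul_val_sum _ _
  have hv : ∀ a b : ZMod 2, ((a * b).val : ZMod 4) = a.val * b.val := by decide
  simp only [phase]
  push_cast
  rw [h]
  simp [hv, add_comm]

/-! ### Correctness of a round -/

/-- A function with values of norm at most `B` whose mean is at least `δ * B`. -/
def IsBiased {n : ℕ} (δ : ℝ) (H : BinVec n → ℂ) : Prop :=
  ∃ B : ℝ, 0 < B ∧ (∀ y, ‖H y‖ ≤ B) ∧ δ * B * 2 ^ n ≤ ‖∑ y, H y‖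

/-- If the truncated signal correlates with a Hankel codeword, then with suitable guesses a round
finds this codeword from all sample points that are good for three biased functions. -/
theorem exists_candidate_eq {n D : ℕ} (hn : 1 ≤ n) (hD1 : 1 ≤ D) {s : BinVec n → ℂ} {P : BinMat n}
    (hP : IsHankel P) (l : BinVec n) {S : List (ZMod 2) → ℂ} (hS : ∀ y, S y = s (vec n y)) {t : ℂ}
    {y₀ : List (ZMod 2)} {b ε : ℝ} (hb : 0 < b) (hε : 0 < ε) (hε1 : ε ≤ 1)
    (hT : (t * (S y₀ * star (S y₀))).re = b ^ 2)
    (hm : ε * b * 2 ^ n ≤ ‖∑ y, cut s (b ^ 2) y * star (Complex.I ^ phase P l y)‖)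
    (h2 : 2 ≤ 2 ^ D * ε ^ 2) :
    ∃ (u₁ g₁ u₂ g₂ : List (ZMod 2)) (a₁ a₂ a₃ : BinVec n) (H₁ H₂ H₃ : BinVec n → ℂ),
      u₁.length = D ∧ g₁.length = D ∧ u₂.length = D ∧ g₂.length = D ∧
      IsBiased (ε ^ 2 / 2) H₁ ∧ IsBiased (ε ^ 2 / 2) H₂ ∧ IsBiased (ε ^ 2 / 2) H₃ ∧
      ∀ (w : List (ZMod 2)) (vs : List (List (ZMod 2))), w.length = n →
        badness H₁ (vec n w) (vs.map (vec n)) < 1 → badness H₂ (vec n w) (vs.map (vec n)) < 1 →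
        badness H₃ (vec n w) (vs.map (vec n)) < 1 →
        candidate n t S ⟨y₀, w, vs, u₁, g₁, u₂, g₂, vs.map fun v => a₁ ⬝ᵥ vec n v,
          vs.map fun v => a₂ ⬝ᵥ vec n v, vs.map fun v => a₃ ⬝ᵥ vec n v⟩ =
          (diagList P, List.ofFn l) := by
  have hF : ∀ y, trunc S (t * (S y₀ * star (S y₀))) y = cut s (b ^ 2) (vec n y) := by
    intro y
    unfold trunc cut
    rw [hT, hS, mul_star_re]
  set F := cut s (b ^ 2) with hFdef
  have hFb : ∀ y, ‖F y‖ ≤ b := norm_cut_le s hb.le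
  obtain ⟨u₁, g₁, a₁, H₁, hu₁, hg₁, hb₁, hm₁, h₁⟩ := exists_recover_eq hD1
    (G := trunc S (t * (S y₀ * star (S y₀)))) (fun y _ => hF y) hP.isSymm
    (fun i j _ => hP.eq_diag i j) l hb hε hε1 hFb hm h2
  have hm' : ε * b * 2 ^ n ≤ ‖∑ y : BinVec n, F (y ∘ Fin.rev) *
      star (Complex.I ^ phase (revMat P) (l ∘ Fin.rev) y)‖ := by
    refine hm.trans_eq (congrArg _ ?_)
    rw [← Equiv.sum_comp (Equiv.arrowCongr Fin.revPerm (Equiv.refl (ZMod 2)))]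
    refine Finset.sum_congr rfl fun y _ => ?_
    have : (Equiv.arrowCongr Fin.revPerm (Equiv.refl (ZMod 2))) y = y ∘ Fin.rev := by
      funext i; simp [Equiv.arrowCongr]
    rw [this, ← phase_revMat, Function.comp_assoc,
      show Fin.rev ∘ Fin.rev = (id : Fin n → Fin n) from funext Fin.rev_rev, Function.comp_id]
  have hrev : ∀ i j : Fin n, (i : ℕ) + j < n → revMat P i j = diag P (2 * n - 2 - (i + j)) := by
    intro i j _
    have := i.2
    have := j.2
    rw [revMat, Matrix.submatrix_apply, hP.eq_diag, Fin.val_rev, Fin.val_rev]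
    congr 1
    omega
  obtain ⟨u₂, g₂, a₂, H₂, hu₂, hg₂, hb₂, hm₂, h₂⟩ := exists_recover_eq hD1
    (G := fun y => trunc S (t * (S y₀ * star (S y₀))) y.reverse)
    (F := fun y => F (y ∘ Fin.rev)) (fun y hy => by rw [hF, vec_reverse hy])
    (hP.isSymm.submatrix Fin.rev) (p := fun m => diag P (2 * n - 2 - m)) hrev
    (l ∘ Fin.rev) hb hε hε1 (fun y => hFb _) hm' h2
  have hsum : ∀ y, sgn (l ⬝ᵥ y) * (F y * star (Complex.I ^ phase P 0 y)) =
      F y * star (Complex.I ^ phase P l y) := by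
    intro y
    rw [← star_I_pow_phase P l y]
    ring
  refine ⟨u₁, g₁, u₂, g₂, a₁, a₂, l, H₁, H₂,
    fun y => sgn (l ⬝ᵥ y) * (F y * star (Complex.I ^ phase P 0 y)), hu₁, hg₁, hu₂, hg₂,
    ⟨b ^ 2, by positivity, hb₁, hm₁⟩, ⟨b ^ 2, by positivity, hb₂, hm₂⟩, ⟨b, hb, fun y => ?_, ?_⟩,
    fun w vs hw w₁ w₂ w₃ => ?_⟩
  · beta_reduce
    rw [hsum, norm_mul, norm_phase, mul_one]
    exact hFb y
  · simp only [hsum]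
    refine le_trans ?_ hm
    gcongr
    nlinarith
  · have hp : (recover n (trunc S (t * (S y₀ * star (S y₀)))) w vs u₁ g₁
        (vs.map fun v => a₁ ⬝ᵥ vec n v)).tail.reverse ++
        recover n (fun y => trunc S (t * (S y₀ * star (S y₀))) y.reverse) w vs u₂ g₂
          (vs.map fun v => a₂ ⬝ᵥ vec n v) = diagList P := by
      rw [h₁ w vs hw w₁, h₂ w vs hw w₂, diagList]
    simp only [candidate]
    rw [hp, linDec_eq (H := fun y => F y * star (Complex.I ^ phase P 0 y)) ?_ l hw vs ?_ w₃]
    · intro y hy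
      rw [hF, hP.quadL_diagList hy]
    · simp only [hsum]
      exact norm_pos_iff.1 (lt_of_lt_of_le (by positivity) hm)

/-! ### The probability of success of a round -/

theorem avg_append_ge {a b : ℕ} {f g : List (ZMod 2) → ℝ} {β : ℝ}
    (h : ∀ x, x.length = a → β * g x ≤ avg b fun y => f (x ++ y)) :
    β * avg a g ≤ avg (a + b) f := by
  rw [avg_append, ← avg_mul_left]
  exact avg_mono h

/-- With probability at least one half, the sample points are good for three given biased
functions. -/
theorem avg_three_badness {n q : ℕ} {δ : ℝ} (hδ : 0 < δ) {H₁ H₂ H₃ : BinVec n → ℂ}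
    (h₁ : IsBiased δ H₁) (h₂ : IsBiased δ H₂) (h₃ : IsBiased δ H₃)
    (hq : 54 * (n + 1) ≤ δ ^ 2 * 2 ^ q) :
    1 / 2 ≤ avg (n + q * n) fun l => 1 -
      (badness H₁ (vec n (l.take n)) ((chunks n q (l.drop n)).map (vec n)) +
      (badness H₂ (vec n (l.take n)) ((chunks n q (l.drop n)).map (vec n)) +
      badness H₃ (vec n (l.take n)) ((chunks n q (l.drop n)).map (vec n)))) := by
  obtain ⟨B₁, hB₁, hb₁, hm₁⟩ := h₁
  obtain ⟨B₂, hB₂, hb₂, hm₂⟩ := h₂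
  obtain ⟨B₃, hB₃, hb₃, hm₃⟩ := h₃
  have e₁ := avg_badness_le hδ hB₁ hb₁ hm₁ hq
  have e₂ := avg_badness_le hδ hB₂ hb₂ hm₂ hq
  have e₃ := avg_badness_le hδ hB₃ hb₃ hm₃ hq
  simp only [sub_eq_add_neg]
  rw [avg_add_fun, avg_const]
  simp only [← neg_one_mul (_ + (_ + _))]
  rw [avg_mul_left, avg_add_fun, avg_add_fun]
  linarith

theorem badness_nonneg {n : ℕ} (H : BinVec n → ℂ) (w : BinVec n) (vs : List (BinVec n)) :
    0 ≤ badness H w vs := by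
  unfold badness
  positivity

theorem chunks_append {n q : ℕ} {x y : List (ZMod 2)} (h : q * n ≤ x.length) :
    chunks n q (x ++ y) = chunks n q x := by
  induction q generalizing x with
  | zero => rfl
  | succ q ih =>
    rw [add_mul, one_mul] at h
    rw [chunks, chunks, List.take_append_of_le_length (by omega),
      List.drop_append_of_le_length (by omega), ih (by simp; omega)]

theorem parse_eq {n D : ℕ} {y₀ w v u₁ g₁ u₂ g₂ b₁ b₂ b₃ : List (ZMod 2)} (z : List (ZMod 2))
    (h₀ : y₀.length = n) (h₁ : w.length = n) (h₂ : v.length = D * n) (h₃ : u₁.length = D)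
    (h₄ : g₁.length = D) (h₅ : u₂.length = D) (h₆ : g₂.length = D) (h₇ : b₁.length = D)
    (h₈ : b₂.length = D) (h₉ : b₃.length = D) :
    Seed.parse n D (y₀ ++ (w ++ (v ++ (u₁ ++ (g₁ ++ (u₂ ++ (g₂ ++ (b₁ ++ (b₂ ++ (b₃ ++ z)))))))))) =
      ⟨y₀, w, chunks n D v, u₁, g₁, u₂, g₂, b₁, b₂, b₃⟩ := by
  unfold Seed.parse
  simp only [List.take_left' h₀, List.drop_left' h₀, List.take_left' h₁, List.drop_left' h₁,
    List.drop_left' h₂, List.take_left' h₃, List.drop_left' h₃, List.take_left' h₄,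
    List.drop_left' h₄, List.take_left' h₅, List.drop_left' h₅, List.take_left' h₆,
    List.drop_left' h₆, List.take_left' h₇, List.drop_left' h₇, List.take_left' h₈,
    List.drop_left' h₈, List.take_left' h₉, chunks_append h₂.ge]

/-- A seed depends only on the bits of its round. -/
theorem parse_append {n D : ℕ} {x : List (ZMod 2)} (z : List (ZMod 2))
    (hx : x.length = (D + 2) * n + 7 * D) : Seed.parse n D (x ++ z) = Seed.parse n D x := by
  have split : ∀ (m : ℕ) (x : List (ZMod 2)), m ≤ x.length → ∃ a b : List (ZMod 2),
      x = a ++ b ∧ a.length = m ∧ b.length = x.length - m := fun m x h =>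
    ⟨x.take m, x.drop m, (List.take_append_drop m x).symm, by simpa using h, by simp⟩
  rw [add_mul] at hx
  obtain ⟨y₀, x, rfl, h₀, hx₀⟩ := split n x (by omega)
  obtain ⟨w, x, rfl, h₁, hx₁⟩ := split n x (by omega)
  obtain ⟨v, x, rfl, h₂, hx₂⟩ := split (D * n) x (by omega)
  obtain ⟨u₁, x, rfl, h₃, hx₃⟩ := split D x (by omega)
  obtain ⟨g₁, x, rfl, h₄, hx₄⟩ := split D x (by omega)
  obtain ⟨u₂, x, rfl, h₅, hx₅⟩ := split D x (by omega)
  obtain ⟨g₂, x, rfl, h₆, hx₆⟩ := split D x (by omega)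
  obtain ⟨b₁, x, rfl, h₇, hx₇⟩ := split D x (by omega)
  obtain ⟨b₂, b₃, rfl, h₈, hx₈⟩ := split D x (by omega)
  have h₉ : b₃.length = D := by omega
  simp only [List.append_assoc]
  rw [parse_eq z h₀ h₁ h₂ h₃ h₄ h₅ h₆ h₇ h₈ h₉]
  have := parse_eq [] h₀ h₁ h₂ h₃ h₄ h₅ h₆ h₇ h₈ h₉
  rw [List.append_nil] at this
  exact this.symm

/-- Once `y₀` has been chosen such that the truncated signal correlates with a Hankel codeword, the
remaining bits of a round are good with probability at least `2 ^ (-7 D - 1)`. -/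
theorem avg_round_ge {n D : ℕ} (hn : 1 ≤ n) (hD1 : 1 ≤ D) {s : BinVec n → ℂ} {P : BinMat n}
    (hP : IsHankel P) (l : BinVec n) {S : List (ZMod 2) → ℂ} (hS : ∀ y, S y = s (vec n y)) {t : ℂ}
    {y₀ : List (ZMod 2)} (hy₀ : y₀.length = n) {b ε : ℝ} (hb : 0 < b) (hε : 0 < ε) (hε1 : ε ≤ 1)
    (hT : (t * (S y₀ * star (S y₀))).re = b ^ 2)
    (hm : ε * b * 2 ^ n ≤ ‖∑ y, cut s (b ^ 2) y * star (Complex.I ^ phase P l y)‖)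
    (h2 : 2 ≤ 2 ^ D * ε ^ 2) (hq : 54 * (n + 1) ≤ (ε ^ 2 / 2) ^ 2 * 2 ^ D) :
    (1 / 2) ^ (7 * D) * (1 / 2) ≤ avg (n + D * n + 7 * D) fun x => open Classical in
      if candidate n t S (Seed.parse n D (y₀ ++ x)) = (diagList P, List.ofFn l) then (1 : ℝ)
      else 0 := by
  classical
  obtain ⟨u₁, g₁, u₂, g₂, a₁, a₂, a₃, H₁, H₂, H₃, hu₁, hg₁, hu₂, hg₂, hb₁, hb₂, hb₃, hgood⟩ :=
    exists_candidate_eq hn hD1 hP l hS hb hε hε1 hT hm h2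
  refine (mul_le_mul_of_nonneg_left (avg_three_badness (by positivity) hb₁ hb₂ hb₃ hq)
    (by positivity)).trans (avg_append_ge fun x hx => ?_)
  set w := vec n (x.take n)
  set vs := (chunks n D (x.drop n)).map (vec n)
  have p₁ := badness_nonneg H₁ w vs
  have p₂ := badness_nonneg H₂ w vs
  have p₃ := badness_nonneg H₃ w vs
  have pavg : 0 ≤ avg (7 * D) fun y => if candidate n t S (Seed.parse n D (y₀ ++ (x ++ y))) =
      (diagList P, List.ofFn l) then (1 : ℝ) else 0 :=
    avg_nonneg fun y => by split_ifs <;> norm_num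
  by_cases hlt : badness H₁ w vs + (badness H₂ w vs + badness H₃ w vs) < 1
  · have hw : (x.take n).length = n := by simp; omega
    have hv : (x.drop n).length = D * n := by simp; omega
    set vl := chunks n D (x.drop n) with hvl
    have hlen : vl.length = D := length_chunks _ _ _
    set b₁ := vl.map fun v => a₁ ⬝ᵥ vec n v with hb₁
    set b₂ := vl.map fun v => a₂ ⬝ᵥ vec n v with hb₂
    set b₃ := vl.map fun v => a₃ ⬝ᵥ vec n v with hb₃
    have hl₁ : b₁.length = D := by rw [hb₁, List.length_map, hlen]
    have hl₂ : b₂.length = D := by rw [hb₂, List.length_map, hlen]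
    have hl₃ : b₃.length = D := by rw [hb₃, List.length_map, hlen]
    refine (mul_le_of_le_one_right (by positivity) (by linarith)).trans
      ((avg_eq_point (7 * D) (u₁ ++ (g₁ ++ (u₂ ++ (g₂ ++ (b₁ ++ (b₂ ++ b₃)))))) (by
        simp only [List.length_append, hu₁, hg₁, hu₂, hg₂, hl₁, hl₂, hl₃]; ring)).trans
      (avg_mono fun y _ => ?_))
    split_ifs with h₁ h₂
    · exact le_rfl
    · refine absurd ?_ h₂
      have hpe := parse_eq [] hy₀ hw hv hu₁ hg₁ hu₂ hg₂ hl₁ hl₂ hl₃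
      rw [List.append_nil, ← h₁, ← List.append_assoc (x.take n), List.take_append_drop] at hpe
      rw [hpe]
      exact hgood (x.take n) vl hw (by linarith) (by linarith) (by linarith)
    · norm_num
    · exact le_rfl
  · exact (mul_nonpos_of_nonneg_of_nonpos (by positivity) (by linarith)).trans pavg

/-- A round finds a given heavy Hankel codeword with a probability that is inversely polynomial. -/
theorem round_success {n κ D : ℕ} (hn : 1 ≤ n) (hκ : 1 ≤ κ) (hD : 2 ^ 29 * (κ * n) ^ 9 ≤ 2 ^ D)
    {s : BinVec n → ℂ} {S : List (ZMod 2) → ℂ} (hS : ∀ y, S y = s (vec n y)) {P : BinMat n}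
    (hP : IsHankel P) (l : BinVec n) (hA : 0 < ∑ y, ‖s y‖ ^ 2)
    (hheavy : (∑ y, ‖s y‖ ^ 2) * 2 ^ n ≤
      κ * ‖∑ y, s y * star (Complex.I ^ phase P l y)‖ ^ 2) :
    1 / (κ * 2 ^ (7 * D + 4)) ≤ avg ((D + 2) * n + 7 * D) fun x => open Classical in
      if candidate n (64 * (κ : ℂ) ^ 2) S (Seed.parse n D x) = (diagList P, List.ofFn l)
      then (1 : ℝ) else 0 := by
  classical
  have hD1 : 1 ≤ D := by
    by_contra h
    have : D = 0 := by omega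
    subst this
    have : 1 ≤ (κ * n) ^ 9 := Nat.one_le_pow _ _ (by positivity)
    omega
  have hκ' : (1 : ℝ) ≤ κ := by exact_mod_cast hκ
  have hn' : (1 : ℝ) ≤ n := by exact_mod_cast hn
  have hD' : (2 : ℝ) ^ 29 * (κ * n) ^ 9 ≤ 2 ^ D := by exact_mod_cast hD
  set r := Real.sqrt κ with hr
  have hr2 : r ^ 2 = κ := Real.sq_sqrt (by positivity)
  have hr0 : 0 < r := Real.sqrt_pos.2 (by positivity)
  set a := Real.sqrt ((∑ y, ‖s y‖ ^ 2) / 2 ^ n) with ha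
  have ha2 : a ^ 2 = (∑ y, ‖s y‖ ^ 2) / 2 ^ n := Real.sq_sqrt (by positivity)
  have ha0 : 0 < a := Real.sqrt_pos.2 (by positivity)
  have hsum : ∑ y, ‖s y‖ ^ 2 = a ^ 2 * 2 ^ n := by rw [ha2]; field_simp
  have hcor : a / r * 2 ^ n ≤ ‖∑ y, s y * star (Complex.I ^ phase P l y)‖ := by
    apply le_of_sq_le_sq _ (norm_nonneg _)
    rw [mul_pow, div_pow, hr2, div_mul_eq_mul_div, div_le_iff₀ (by positivity)]
    rw [hsum] at hheavy
    linarith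
  have hφ : ∀ y, ‖star (Complex.I ^ phase P l y)‖ = 1 := norm_phase P l
  have hcard := card_typical hφ hsum hr0 ha0 hcor
  set ε : ℝ := 1 / (32 * κ ^ 2) with hε
  have hε0 : 0 < ε := by positivity
  have hε1 : ε ≤ 1 := by
    rw [hε, div_le_one (by positivity)]
    nlinarith
  have hεD : (2 : ℝ) ^ 29 * (κ ^ 8 * n) ≤ 2 ^ D := by
    refine le_trans ?_ hD'
    rw [mul_pow]
    have h₁ : (κ : ℝ) ^ 8 ≤ κ ^ 9 := pow_le_pow_right₀ hκ' (by norm_num)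
    have h₂ : (n : ℝ) ≤ n ^ 9 := le_self_pow₀ hn' (by norm_num)
    gcongr
  have hq : 54 * ((n : ℝ) + 1) ≤ (ε ^ 2 / 2) ^ 2 * 2 ^ D := by
    have : (ε ^ 2 / 2) ^ 2 * (2 ^ 29 * (κ ^ 8 * n)) = 128 * n := by
      rw [hε]; field_simp; norm_num
    have h₁ := mul_le_mul_of_nonneg_left hεD (show 0 ≤ (ε ^ 2 / 2) ^ 2 by positivity)
    linarith
  have h2 : 2 ≤ 2 ^ D * ε ^ 2 := by
    have h₁ : (ε ^ 2 / 2) ^ 2 * 2 ^ D ≤ 2 ^ D * ε ^ 2 := by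
      have h₂ : (ε ^ 2 / 2) ^ 2 ≤ ε ^ 2 := by nlinarith [pow_le_one₀ (n := 2) hε0.le hε1]
      rw [mul_comm]
      gcongr
    linarith
  set χ : BinVec n → ℝ := fun y => if a / (4 * r) ≤ ‖s y‖ ∧ ‖s y‖ ≤ 2 * r * a then 1 else 0
  have hχ : 1 / (8 * (κ : ℝ)) ≤ avg n fun x => χ (vec n x) := by
    rw [avg_eq_sum]
    simp only [vec_ofFn]
    rw [le_div_iff₀ (by positivity), ← hr2]
    refine le_trans (le_of_eq ?_) hcard
    ring
  have e : (D + 2) * n + 7 * D = n + (n + D * n + 7 * D) := by ring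
  rw [e]
  -- `χ` marks the choices of `y₀` for which the level of the truncation is suitable
  refine le_trans ?_ (avg_append_ge (g := fun x => χ (vec n x))
    (β := (1 / 2) ^ (7 * D) * (1 / 2)) fun x hx => ?_)
  · refine le_trans (le_of_eq ?_) (mul_le_mul_of_nonneg_left hχ (by positivity))
    rw [pow_add, one_div_pow]
    field_simp
    norm_num
  · by_cases hgood : a / (4 * r) ≤ ‖s (vec n x)‖ ∧ ‖s (vec n x)‖ ≤ 2 * r * a
    · have h1 : χ (vec n x) = 1 := if_pos hgood
      rw [h1, mul_one]
      have hsx : 0 < ‖s (vec n x)‖ := lt_of_lt_of_le (by positivity) hgood.1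
      refine avg_round_ge hn hD1 hP l hS hx (b := 8 * κ * ‖s (vec n x)‖) (by positivity) hε0 hε1
        ?_ ?_ h2 hq
      · rw [hS, show (64 : ℂ) * (κ : ℂ) ^ 2 = ((64 * κ ^ 2 : ℝ) : ℂ) by push_cast; rfl,
          Complex.re_ofReal_mul, mul_star_re]
        ring
      · refine le_trans ?_ (correlation_cut hφ (by positivity) hsum hr0 ?_ hcor ha0)
        · gcongr
          calc ε * (8 * κ * ‖s (vec n x)‖) ≤ ε * (8 * κ * (2 * r * a)) := by
                gcongr
                exact hgood.2
            _ = a / (2 * r) := by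
              rw [hε, ← hr2]; field_simp; norm_num
        · calc 2 * r * a = 8 * κ * (a / (4 * r)) := by
                rw [← hr2]; field_simp; norm_num
            _ ≤ _ := by gcongr; exact hgood.1
    · have h0 : χ (vec n x) = 0 := if_neg hgood
      rw [h0, mul_zero]
      exact avg_nonneg fun y => by split_ifs <;> norm_num

/-! ### The probability of success of all rounds -/

theorem search_succ (n D : ℕ) (t : ℂ) (S : List (ZMod 2) → ℂ) (R : ℕ) (l : List (ZMod 2))
    (x : List (ZMod 2) × List (ZMod 2)) :
    x ∈ search n D t S (R + 1) l ↔ x = candidate n t S (Seed.parse n D l) ∨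
      x ∈ search n D t S R (l.drop ((D + 2) * n + 7 * D)) := by
  have h : ∀ (R : ℕ) (l : List (ZMod 2)) (acc : List (List (ZMod 2) × List (ZMod 2))),
      ((fun d : List (ZMod 2) × List (List (ZMod 2) × List (ZMod 2)) =>
        (d.1.drop ((D + 2) * n + 7 * D), candidate n t S (Seed.parse n D d.1) :: d.2))^[R]
          (l, acc)).2 = search n D t S R l ++ acc := by
    intro R
    induction R with
    | zero => intro l acc; rfl
    | succ R ih =>
      intro l acc
      rw [search, Function.iterate_succ_apply, Function.iterate_succ_apply, ih, ih]
      simp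
  rw [search, Function.iterate_succ_apply, h]
  simp [or_comm]

/-- The rounds are independent. -/
theorem avg_search_fail (n D : ℕ) (t : ℂ) (S : List (ZMod 2) → ℂ)
    (x : List (ZMod 2) × List (ZMod 2)) {η : ℝ}
    (h : η ≤ avg ((D + 2) * n + 7 * D) fun l => open Classical in
      if candidate n t S (Seed.parse n D l) = x then (1 : ℝ) else 0) (R : ℕ) :
    avg (R * ((D + 2) * n + 7 * D)) (fun l => open Classical in
      if x ∈ search n D t S R l then (0 : ℝ) else 1) ≤ Real.exp (-η) ^ R := by
  classical
  induction R with
  | zero =>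
    rw [Nat.zero_mul, pow_zero]
    change (if x ∈ search n D t S 0 [] then (0 : ℝ) else 1) ≤ 1
    split_ifs <;> norm_num
  | succ R ih =>
    rw [add_mul, one_mul, add_comm, avg_append]
    have h₁ : ∀ l₁, l₁.length = (D + 2) * n + 7 * D → ∀ l₂,
        (if x ∈ search n D t S (R + 1) (l₁ ++ l₂) then (0 : ℝ) else 1) =
        (1 - if candidate n t S (Seed.parse n D l₁) = x then (1 : ℝ) else 0) *
          if x ∈ search n D t S R l₂ then (0 : ℝ) else 1 := by
      intro l₁ h₁ l₂
      rw [← if_congr (search_succ n D t S R (l₁ ++ l₂) x).symm rfl rfl, parse_append l₂ h₁,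
        List.drop_left' h₁]
      by_cases h₂ : candidate n t S (Seed.parse n D l₁) = x
      · rw [if_pos (Or.inl h₂.symm), if_pos h₂]; ring
      · rw [if_neg h₂, sub_zero, one_mul]
        exact if_congr (or_iff_right fun h => h₂ h.symm) rfl rfl
    set c := avg (R * ((D + 2) * n + 7 * D)) fun l =>
      if x ∈ search n D t S R l then (0 : ℝ) else 1 with hc
    have hc0 : 0 ≤ c := avg_nonneg fun l => by split_ifs <;> norm_num
    rw [avg_congr fun l₁ hl => (avg_congr fun l₂ _ => h₁ l₁ hl l₂).trans
      ((avg_mul_left _ _ _).trans (mul_comm _ _)), avg_mul_left]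
    simp only [sub_eq_add_neg]
    rw [avg_add_fun, avg_const]
    simp only [← neg_one_mul (ite _ _ _)]
    rw [avg_mul_left, pow_succ]
    refine mul_le_mul ih (le_trans ?_ (Real.add_one_le_exp (-η))) ?_ (by positivity)
    · linarith
    · have := avg_mono (m := (D + 2) * n + 7 * D) (g := fun _ => 1) (f := fun l =>
        if candidate n t S (Seed.parse n D l) = x then (1 : ℝ) else 0)
        fun l _ => by split_ifs <;> norm_num
      rw [avg_const] at this
      linarith

theorem avg_finset_sum {ι : Type*} (m : ℕ) (s : Finset ι) (f : ι → List (ZMod 2) → ℝ) :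
    avg m (fun l => ∑ i ∈ s, f i l) = ∑ i ∈ s, avg m (f i) := by
  classical
  induction s using Finset.induction_on with
  | empty => simp [avg_const]
  | insert i s hi ih =>
    simp only [Finset.sum_insert hi]
    rw [avg_add_fun, ih]

/-! ### Heavy codewords -/

theorem norm_inner_codeword {n : ℕ} (s : Signal n) (P : BinMat n) (l : BinVec n) :
    ‖inner ℂ s (codeword P l)‖ ^ 2 =
      ‖∑ y, s y * star (Complex.I ^ phase P l y)‖ ^ 2 / 2 ^ n := by
  have h : inner ℂ s (codeword P l) =
      star (∑ y, s y * star (Complex.I ^ phase P l y)) / (Real.sqrt (2 ^ n) : ℂ) := by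
    rw [PiLp.inner_apply, star_sum, Finset.sum_div]
    refine Finset.sum_congr rfl fun y _ => ?_
    simp only [RCLike.inner_apply, codeword, star_mul', star_star, starRingEnd_apply]
    ring
  rw [h, norm_div, norm_star, div_pow, Complex.norm_real, Real.norm_of_nonneg (Real.sqrt_nonneg _),
    Real.sq_sqrt (by positivity)]

theorem heavy_bound {n κ : ℕ} {k : ℝ} (hk : 1 ≤ k) (hκ : k ≤ κ) {s : Signal n} {P : BinMat n}
    {l : BinVec n} (h : Heavy k s (codeword P l)) : (∑ y, ‖s y‖ ^ 2) * 2 ^ n ≤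
      κ * ‖∑ y, s y * star (Complex.I ^ phase P l y)‖ ^ 2 := by
  rw [Heavy, norm_inner_codeword, EuclideanSpace.norm_sq_eq, one_div_mul_eq_div,
    div_le_div_iff₀ (by positivity) (by positivity)] at h
  refine h.trans ?_
  rw [mul_comm]
  gcongr

/-! ### The running time -/

theorem two_pow_clog_le {M : ℕ} (hM : 1 ≤ M) : 2 ^ Nat.clog 2 M ≤ 2 * M := by
  rcases Nat.eq_or_lt_of_le hM with rfl | h
  · simp
  · have h₁ := Nat.pow_pred_clog_lt_self (b := 2) (by norm_num) h
    have h₂ : 0 < Nat.clog 2 M := Nat.clog_pos (by norm_num) h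
    have h₃ : 2 ^ Nat.clog 2 M = 2 * 2 ^ (Nat.clog 2 M).pred := by
      conv_lhs => rw [← Nat.succ_pred_eq_of_pos h₂, pow_succ]
      ring
    omega

/-- A polynomial bound for the total number of random bits. -/
def coinBound (c : ℕ) : Polynomial ℕ :=
  (Polynomial.C (2 ^ 207 * 2 ^ 63 * (c + 2)) * Polynomial.X ^ 65) *
    ((Polynomial.C 9 * Polynomial.X + Polynomial.C 31) * Polynomial.X +
      Polynomial.C 7 * (Polynomial.C 9 * Polynomial.X + Polynomial.C 29))

theorem coins_le (c : ℕ) {n κ : ℕ} (hn : 1 ≤ n) (hκ : 1 ≤ κ) :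
    rounds c n κ * roundLen n κ ≤ (coinBound c).eval (κ * n) := by
  have hM : 1 ≤ κ * n := Nat.mul_pos hκ hn
  have hnM : n ≤ κ * n := Nat.le_mul_of_pos_left _ hκ
  have hL : Nat.clog 2 (κ * n) ≤ κ * n := Nat.clog_le_of_le_pow Nat.lt_two_pow_self.le
  simp only [coinBound, Polynomial.eval_mul, Polynomial.eval_add, Polynomial.eval_pow,
    Polynomial.eval_C, Polynomial.eval_X]
  refine Nat.mul_le_mul ?_ ?_
  · have h₁ : 2 ^ (7 * guessLen n κ + 4) ≤ 2 ^ 207 * (2 * (κ * n)) ^ 63 := by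
      rw [show 7 * guessLen n κ + 4 = 207 + Nat.clog 2 (κ * n) * 63 by unfold guessLen; ring,
        pow_add, pow_mul]
      exact Nat.mul_le_mul_left _ (Nat.pow_le_pow_left (two_pow_clog_le hM) _)
    calc rounds c n κ ≤ 2 ^ 207 * (2 * (κ * n)) ^ 63 * ((c + 2) * (κ * n * (κ * n))) :=
          Nat.mul_le_mul h₁ (Nat.mul_le_mul_left _ (Nat.mul_le_mul_right _ hnM))
      _ = 2 ^ 207 * 2 ^ 63 * (c + 2) * (κ * n) ^ 65 := by ring
  · unfold roundLen guessLen
    refine Nat.add_le_add (Nat.mul_le_mul (by omega) hnM) (by omega)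

theorem eval_map_mono (p : Polynomial ℕ) {x y : ℝ} (hx : 0 ≤ x) (hxy : x ≤ y) :
    (p.map (Nat.castRingHom ℝ)).eval x ≤ (p.map (Nat.castRingHom ℝ)).eval y := by
  rw [Polynomial.eval_map, Polynomial.eval_map, Polynomial.eval₂_eq_sum, Polynomial.eval₂_eq_sum]
  refine Finset.sum_le_sum fun i _ => ?_
  simp only [eq_natCast]
  gcongr

theorem eval_map_natCast (p : Polynomial ℕ) (m : ℕ) :
    (p.map (Nat.castRingHom ℝ)).eval (m : ℝ) = ((p.eval m : ℕ) : ℝ) := by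
  rw [Polynomial.eval_natCast_map]
  rfl

/-! ### Correctness of the algorithm -/

theorem bitAt_bits (l : List (ZMod 2)) (i : ℕ) : (bits l).bitAt i = l.getD i 0 := by
  rw [Val.bitAt, bits, Val.toList_ofList, show Val.nil = bitV 0 from (if_pos rfl).symm,
    List.getD_map, truthy_bitV]
  rcases bit_cases (l.getD i 0) with h | h <;> rw [h] <;> simp

theorem toVec_bits {n : ℕ} (l : List (ZMod 2)) : (bits l).toVec n = vec n l :=
  funext fun i => bitAt_bits l i

/-- The failure probability of all rounds, summed over all pairs of a matrix and a vector. -/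
theorem failure_bound (c : ℕ) {n κ : ℕ} (hn : 1 ≤ n) (hκ : 1 ≤ κ) :
    (2 : ℝ) ^ (n * n + n) * Real.exp (-(1 / (κ * 2 ^ (7 * guessLen n κ + 4)))) ^ rounds c n κ ≤
      ((2 ^ n)⁻¹) ^ c := by
  have hκ' : (κ : ℝ) ≠ 0 := by positivity
  have h₁ : Real.exp (-(1 / (κ * 2 ^ (7 * guessLen n κ + 4)))) ^ rounds c n κ =
      Real.exp (-1) ^ ((c + 2) * (n * n)) := by
    rw [← Real.exp_nat_mul, ← Real.exp_nat_mul, rounds]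
    generalize guessLen n κ = D
    refine congrArg Real.exp ?_
    push_cast
    field_simp
  have h₂ : Real.exp (-1) ≤ 1 / 2 := by
    rw [Real.exp_neg, ← one_div]
    have := Real.add_one_le_exp 1
    exact one_div_le_one_div_of_le (by norm_num) (by linarith)
  have h₃ : n ≤ n * n := Nat.le_mul_of_pos_left _ hn
  have h₄ : n * c + (n * n + n) ≤ (c + 2) * (n * n) := by nlinarith
  calc _ ≤ (2 : ℝ) ^ (n * n + n) * (1 / 2) ^ (n * c + (n * n + n)) := by
        rw [h₁]
        gcongr
        exact (pow_le_pow_left₀ (Real.exp_nonneg _) h₂ _).trans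
          (pow_le_pow_of_le_one (by norm_num) (by norm_num) h₄)
    _ = ((2 ^ n)⁻¹) ^ c := by
        rw [pow_add (1 / 2 : ℝ), one_div_pow, one_div_pow, inv_pow, ← pow_mul]
        field_simp

/-- The output of the algorithm contains the labels of all heavy Hankel codewords, with high
probability. -/
theorem decoder_correct (c : ℕ) : ∃ p : Polynomial ℝ, ∀ n : ℕ, 1 ≤ n → ∀ k : ℝ, 1 ≤ k →
    ∀ s : Signal n, HaltsWithin (decoder c) k s ⌊p.eval (k * n)⌋₊ ∧
      (s ≠ 0 → (output (decoder c) k s ⌊p.eval (k * n)⌋₊).toOuterMeasure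
        {v | ¬ ∀ P : BinMat n, IsHankel P → ∀ l : BinVec n, Heavy k s (codeword P l) →
          labV (diagList P, List.ofFn l) ∈ v.toList} ≤ ((2 ^ n : ENNReal)⁻¹) ^ c) := by
  classical
  obtain ⟨p, hp⟩ := run_decoder c
  refine ⟨((p.comp (coinBound c)).map (Nat.castRingHom ℝ)).comp
    (Polynomial.C 2 * Polynomial.X), fun n hn k hk s => ?_⟩
  set T := ⌊(((p.comp (coinBound c)).map (Nat.castRingHom ℝ)).comp
    (Polynomial.C 2 * Polynomial.X)).eval (k * n)⌋₊ with hT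
  set κ := ⌊k⌋₊ + 1 with hκ
  have hκ1 : 1 ≤ κ := by omega
  have hkκ : k ≤ κ := by rw [hκ]; push_cast; exact (Nat.lt_floor_add_one k).le
  have hκk : (κ : ℝ) ≤ 2 * k := by
    rw [hκ]; push_cast; linarith [Nat.floor_le (show 0 ≤ k by linarith)]
  have hpT : p.eval (rounds c n κ * roundLen n κ) ≤ T := by
    refine Nat.le_floor ?_
    have hmono : ∀ a b : ℕ, a ≤ b → p.eval a ≤ p.eval b := fun a b h => by
      rw [Polynomial.eval_eq_sum, Polynomial.eval_eq_sum]
      exact Finset.sum_le_sum fun i _ => Nat.mul_le_mul_left _ (Nat.pow_le_pow_left h i)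
    refine (Nat.cast_le.2 (hmono _ _ (coins_le c hn hκ1))).trans ?_
    rw [← Polynomial.eval_comp, ← eval_map_natCast, Polynomial.eval_comp]
    refine eval_map_mono _ (by positivity) ?_
    simp only [Polynomial.eval_mul, Polynomial.eval_C, Polynomial.eval_X]
    push_cast
    rw [← mul_assoc]
    gcongr
  obtain ⟨σ, hrun, hσ⟩ := hp n k s T hn (by linarith) hpT
  refine ⟨fun C hC => ?_, fun hs => ?_⟩
  · rw [hrun, PMF.mem_support_map_iff] at hC
    obtain ⟨l, _, rfl⟩ := hC
    rfl
  set S : List (ZMod 2) → ℂ := fun y => s ((bits y).toVec n) with hSdef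
  set D := guessLen n κ with hDdef
  set R := rounds c n κ with hRdef
  have hD : 2 ^ 29 * (κ * n) ^ 9 ≤ 2 ^ D := by
    rw [hDdef, guessLen, pow_add, mul_comm, mul_comm 9, pow_mul]
    exact Nat.mul_le_mul_right _ (Nat.pow_le_pow_left (Nat.le_pow_clog (by norm_num) _) _)
  have hS : ∀ y, S y = s (vec n y) := by
    intro y
    exact congrArg s (toVec_bits y)
  have hA : 0 < ∑ y, ‖s y‖ ^ 2 := by
    rw [← EuclideanSpace.norm_sq_eq]
    have := norm_pos_iff.2 hs
    positivity
  rw [output, hrun, PMF.map_comp, PMF.toOuterMeasure_map_apply, coinList_toOuterMeasure]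
  have hE : ((2 ^ n : ENNReal)⁻¹) ^ c = ENNReal.ofReal (((2 ^ n : ℝ)⁻¹) ^ c) := by
    rw [ENNReal.ofReal_pow (by positivity), ENNReal.ofReal_inv_of_pos (by positivity),
      ENNReal.ofReal_pow (by norm_num)]
    simp
  rw [hE]
  apply ENNReal.ofReal_le_ofReal
  set A : Finset (BinMat n × BinVec n) := Finset.univ.filter fun x =>
    IsHankel x.1 ∧ Heavy k s (codeword x.1 x.2) with hAdef
  -- union bound over all heavy codewords
  have hunion : avg (R * roundLen n κ) (Set.indicator
      ((fun C : Config => C.store 0) ∘ (fun l => (⟨[], σ l⟩ : Config)) ⁻¹'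
        {v | ¬ ∀ P : BinMat n, IsHankel P → ∀ l : BinVec n, Heavy k s (codeword P l) →
          labV (diagList P, List.ofFn l) ∈ v.toList}) fun _ => 1) ≤
      avg (R * roundLen n κ) fun l => ∑ x ∈ A,
        if (diagList x.1, List.ofFn x.2) ∈ search n D (64 * (κ : ℂ) ^ 2) S R l
        then (0 : ℝ) else 1 := by
    refine avg_mono fun l hl => ?_
    have hnn : ∀ x ∈ A, (0 : ℝ) ≤
        if (diagList x.1, List.ofFn x.2) ∈ search n D (64 * (κ : ℂ) ^ 2) S R l
        then (0 : ℝ) else 1 := fun x _ => by split_ifs <;> norm_num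
    rw [Set.indicator_apply]
    split_ifs with h
    · simp only [Set.mem_preimage, Function.comp, Set.mem_ofPred_eq, not_forall] at h
      obtain ⟨P, hP, m, hm, hmem⟩ := h
      rw [hσ l hl, Val.toList_ofList] at hmem
      refine le_trans (le_of_eq ?_) (Finset.single_le_sum hnn
        (show (P, m) ∈ A from Finset.mem_filter.2 ⟨Finset.mem_univ _, hP, hm⟩))
      exact (if_neg fun h => hmem (List.mem_map_of_mem h)).symm
    · exact Finset.sum_nonneg hnn
  refine hunion.trans ?_
  rw [avg_finset_sum]
  have hone : ∀ x ∈ A, avg (R * roundLen n κ) (fun l =>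
      if (diagList x.1, List.ofFn x.2) ∈ search n D (64 * (κ : ℂ) ^ 2) S R l
        then (0 : ℝ) else 1) ≤ Real.exp (-(1 / (κ * 2 ^ (7 * D + 4)))) ^ R := by
    intro x hx
    obtain ⟨hP, hheavy⟩ := (Finset.mem_filter.1 hx).2
    exact avg_search_fail n D _ S _ (round_success hn hκ1 hD hS hP x.2 hA
      (heavy_bound hk hkκ hheavy)) R
  refine (Finset.sum_le_sum hone).trans ?_
  rw [Finset.sum_const, nsmul_eq_mul]
  refine le_trans ?_ (failure_bound c hn hκ1)
  gcongr
  have hcard : A.card ≤ 2 ^ (n * n + n) := by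
    refine (Finset.card_le_univ A).trans (le_of_eq ?_)
    rw [Fintype.card_prod, pow_add, pow_mul]
    congr 1
    · exact (Fintype.card_congr
        (Matrix.of (m := Fin n) (n := Fin n) (α := ZMod 2)).symm).trans (by simp)
    · simp
  exact_mod_cast hcard

end
end Kerdock


namespace Kerdock

/-! ### Labels of codewords -/

theorem toHankel_bits_diagList {n : ℕ} {P : BinMat n} (hP : IsHankel P) :
    (bits (diagList P)).toHankel n = P := by
  ext i j
  rw [Val.toHankel, Matrix.of_apply, bitAt_bits, getD_diagList P (by omega), hP.eq_diag]

theorem toVec_bits_diagList {n : ℕ} (P : BinMat n) (i : Fin n) :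
    (bits (diagList P)).toVec n i = P ⟨0, i.pos⟩ i := by
  rw [Val.toVec, bitAt_bits, getD_diagList P (by omega), diag, dif_pos i.2]

theorem isHankel_lfKerdock {n : ℕ} (h : Polynomial (ZMod 2)) (a : BinVec n) :
    IsHankel (lfKerdock h a) := by
  intro i j i' j' e
  simp only [lfKerdock, Matrix.of_apply, e]

theorem lfKerdock_zero_apply {n : ℕ} (h : Polynomial (ZMod 2)) (a : BinVec n) (i : Fin n) :
    lfKerdock h a ⟨0, i.pos⟩ i = a i := by
  rw [lfKerdock, Matrix.of_apply, zero_add]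
  exact LinearRecurrence.mkSol_eq_init (feedback n h) a i

end Kerdock

theorem mainTheorem3 :
    -- arbitrary Kerdock codes inside the Hankel code, codewords labelled by `(P, ℓ)`
    (∀ c : ℕ, ∃ (A : Kerdock.Prog) (p : Polynomial ℝ),
      ∀ (n : ℕ), 1 ≤ n → ∀ k : ℝ, 1 ≤ k → ∀ s : Kerdock.Signal n,
        Kerdock.HaltsWithin A k s ⌊p.eval (k * n)⌋₊ ∧
        (s ≠ 0 → ∀ K : Set (Kerdock.BinMat n),
          Kerdock.IsKerdockSet K → (∀ P ∈ K, Kerdock.IsHankel P) →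
          (Kerdock.output A k s ⌊p.eval (k * n)⌋₊).toOuterMeasure
            {v | ¬ ∀ P ∈ K, ∀ l : Kerdock.BinVec n,
                Kerdock.Heavy k s (Kerdock.codeword P l) → (P, l) ∈ Kerdock.hankelLabels n v}
            ≤ ((2 ^ n : ENNReal)⁻¹) ^ c)) ∧
    -- the linear-feedback Kerdock code of a primitive polynomial `h`, codewords labelled by the
    -- top row `a` of the matrix and `ℓ`, so that every listed label is one of this Kerdock code
    (∀ c : ℕ, ∃ (A : Kerdock.Prog) (p : Polynomial ℝ),
      ∀ (n : ℕ), 1 ≤ n → ∀ k : ℝ, 1 ≤ k → ∀ s : Kerdock.Signal n,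
        Kerdock.HaltsWithin A k s ⌊p.eval (k * n)⌋₊ ∧
        (s ≠ 0 → ∀ h : Polynomial (ZMod 2), Kerdock.IsPrimitivePoly n h →
          (Kerdock.output A k s ⌊p.eval (k * n)⌋₊).toOuterMeasure
            {v | ¬ ∀ a l : Kerdock.BinVec n,
                Kerdock.Heavy k s (Kerdock.codeword (Kerdock.lfKerdock h a) l) →
                  (a, l) ∈ Kerdock.rowLabels n v}
            ≤ ((2 ^ n : ENNReal)⁻¹) ^ c)) := by
  refine ⟨fun c => ?_, fun c => ?_⟩
  · obtain ⟨p, hp⟩ := Kerdock.decoder_correct c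
    refine ⟨Kerdock.decoder c, p, fun n hn k hk s => ⟨(hp n hn k hk s).1, fun hs K _ hH => ?_⟩⟩
    refine (MeasureTheory.measure_mono ?_).trans ((hp n hn k hk s).2 hs)
    refine fun v hv hgood => hv ?_
    intro P hP l hl
    refine List.mem_map.2 ⟨_, hgood P (hH P hP) l hl, ?_⟩
    exact Prod.ext (Kerdock.toHankel_bits_diagList (hH P hP))
      ((Kerdock.toVec_bits _).trans (Kerdock.vec_ofFn l))
  · obtain ⟨p, hp⟩ := Kerdock.decoder_correct c
    refine ⟨Kerdock.decoder c, p, fun n hn k hk s => ⟨(hp n hn k hk s).1, fun hs h _ => ?_⟩⟩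
    refine (MeasureTheory.measure_mono ?_).trans ((hp n hn k hk s).2 hs)
    refine fun v hv hgood => hv ?_
    intro a l hl
    refine List.mem_map.2 ⟨_, hgood _ (Kerdock.isHankel_lfKerdock h a) l hl, ?_⟩
    exact Prod.ext (funext fun i => (Kerdock.toVec_bits_diagList _ i).trans
      (Kerdock.lfKerdock_zero_apply h a i)) ((Kerdock.toVec_bits _).trans (Kerdock.vec_ofFn l))
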